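/- Let $(D,0)=(V(f),0)\subset(\mathbb{C}^n,0)$ be a germ of a free divisor: $f$ is holomorphic on an open neighbourhood $U$ of $0$ with $f(0)=0$, it defines a reduced divisor $D$ in $U$, and the sheaf $\operatorname{Der}(-\log D)=\{\delta\in\operatorname{Der}_{\mathbb{C}^n} : \delta(f)\in (f)\}$ of logarithmic vector fields is locally free on $U$. Let $\mathcal{C}^\bullet$ be the complex of sheaves $\mathcal{C}^p=\mathcal{H}om_{\mathcal{O}}(\bigwedge^p\operatorname{Der}(-\log D),\operatorname{Der}_{\mathbb{C}^n}/\operatorname{Der}(-\log D))$ with the Lie algebroid differential; in low degrees $(d^0\sigma)(\delta)=-[\delta,\sigma]$ and $(d^1\psi)(\delta\wedge\nu)=-[\delta,\psi(\nu)]+[\nu,\psi(\delta)]+\psi([\delta,\nu])$. Let $\mathcal{H}^1(\mathcal{C}^\bullet)_0$ be the stalk at $0$ of its first cohomology sheaf. For a finite-dimensional local $\mathbb{C}$-algebra $A$ with maximal ideal $\mathfrak{m}$ and $S=\operatorname{Spec}A$, an admissible deformation of $(D,0)$ over $S$ is a germ of a closed subspace $X\subset\mathbb{C}^n\times S$ at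 $0$ that is flat over $S$, together with an isomorphism of $(D,0)$ with its central fibre $X_0\subset\mathbb{C}^n$, such that $\operatorname{Der}(-\log X/S)/\mathfrak{m}\operatorname{Der}(-\log X/S)=\operatorname{Der}(-\log D)$ (where $D$ is identified with $X_0$; that is, the restriction map $\operatorname{Der}(-\log X/S)\to\operatorname{Der}_{\mathbb{C}^n}$ has kernel $\mathfrak{m}\operatorname{Der}(-\log X/S)$ and image the module of vector fields logarithmic along $X_0$). Let $\mathbf{FD}_D(A)$ be the set of isomorphism classes of such deformations, where isomorphisms are isomorphisms of total spaces over $S$ inducing the identity on $D$; it is functorial in $A$ by base change. Put $\mathcal{FT}^1(D)=\mathbf{FD}_D(\mathbb{C}[\epsilon])$, $\epsilon^2=0$. Then the map $\mathbf{FD}_D(\mathbb{C}[\epsilon]\times_{\mathbb{C}}\mathbb{C}[\epsilon])\to\mathcal{FT}^1(D)\times\mathcal{FT}^1(D)$ induced by the two projections is bijective, so that $\mathcal{FT}^1(D)$ has its usual structure of a tangent space of a deformation functor (addition induced by the map $\mathbb{C}[\epsilon]\times_{\mathbb{C}}\mathbb{C}[\epsilon]\to\mathbb{C}[\epsilon]$,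 $a+b_1\epsilon_1+b_2\epsilon_2\mapsto a+(b_1+b_2)\epsilon$, multiplication by $c\in\mathbb{C}$ induced by $\epsilon\mapsto c\,\epsilon$), and with this structure there is an isomorphism of complex vector spaces $$\mathcal{H}^1(\mathcal{C}^\bullet)_0\cong\mathcal{FT}^1(D).$$ -/

import Mathlib

open Filter Topology
open scoped TensorProduct

namespace FreeDivisor

noncomputable section

/-! ### Germs of holomorphic functions and of vector fields -/

instance germAlgebra {X : Type} (l : Filter X) : Algebra ℂ (Germ l ℂ) :=
  Algebra.ofModule
    (fun c a b => by
      induction a using Germ.inductionOn with | _ a =>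
      induction b using Germ.inductionOn with | _ b =>
      exact congrArg (fun h : X → ℂ => (h : Germ l ℂ)) (smul_mul_assoc c a b))
    (fun c a b => by
      induction a using Germ.inductionOn with | _ a =>
      induction b using Germ.inductionOn with | _ b =>
      exact congrArg (fun h : X → ℂ => (h : Germ l ℂ)) (mul_smul_comm c a b))

/-- The germs at `x` of functions on `ℂⁿ` that are holomorphic near `x`. -/
def holGerms {n : ℕ} (x : Fin n → ℂ) : Subalgebra ℂ (Germ (𝓝 x) ℂ) where
  carrier := {g | ∃ F : (Fin n → ℂ) → ℂ, AnalyticAt ℂ F x ∧ (F : Germ (𝓝 x) ℂ) = g}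
  mul_mem' := by
    rintro _ _ ⟨F, hF, rfl⟩ ⟨G, hG, rfl⟩
    exact ⟨F * G, hF.mul hG, rfl⟩
  add_mem' := by
    rintro _ _ ⟨F, hF, rfl⟩ ⟨G, hG, rfl⟩
    exact ⟨F + G, hF.add hG, rfl⟩
  algebraMap_mem' c := by
    refine ⟨fun _ => c, analyticAt_const, ?_⟩
    rw [Algebra.algebraMap_eq_smul_one]
    exact congrArg (fun h : (Fin n → ℂ) → ℂ => (h : Germ (𝓝 x) ℂ))
      (funext fun _ => (mul_one c).symm)

/-- The local ring `𝒪_{ℂⁿ,x}`. -/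
def Stalk {n : ℕ} (x : Fin n → ℂ) : Type := holGerms x

instance {n : ℕ} (x : Fin n → ℂ) : CommRing (Stalk x) :=
  inferInstanceAs (CommRing (holGerms x))

instance {n : ℕ} (x : Fin n → ℂ) : Algebra ℂ (Stalk x) :=
  inferInstanceAs (Algebra ℂ (holGerms x))

open Classical in
/-- The germ at `x` of a function that is holomorphic near `x`
(and `0`, by convention, for every other function). -/
def germ {n : ℕ} (F : (Fin n → ℂ) → ℂ) (x : Fin n → ℂ) : Stalk x :=
  if h : AnalyticAt ℂ F x then (⟨(F : Germ (𝓝 x) ℂ), F, h, rfl⟩ : holGerms x) else 0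

/-- The action of `∂/∂xᵢ` on germs of functions. -/
def partialFun {n : ℕ} (x : Fin n → ℂ) (i : Fin n) (g : Germ (𝓝 x) ℂ) : Germ (𝓝 x) ℂ :=
  Germ.map' (fun (F : (Fin n → ℂ) → ℂ) y => fderiv ℂ F y (Pi.single i 1))
    (fun _ _ h => (Filter.EventuallyEq.fderiv (𝕜 := ℂ) h).mono fun _ hy =>
      congrArg (fun L : (Fin n → ℂ) →L[ℂ] ℂ => L (Pi.single i 1)) hy) g

theorem partialFun_mem {n : ℕ} (x : Fin n → ℂ) (i : Fin n) (g : holGerms x) :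
    partialFun x i g ∈ holGerms x := by
  obtain ⟨_, F, hF, rfl⟩ := g
  exact ⟨fun y => fderiv ℂ F y (Pi.single i 1),
    (ContinuousLinearMap.analyticAt
      (ContinuousLinearMap.apply ℂ ℂ (Pi.single i 1 : Fin n → ℂ)) _).comp hF.fderiv, rfl⟩

theorem partialFun_add {n : ℕ} (x : Fin n → ℂ) (i : Fin n) (g h : holGerms x) :
    partialFun x i (g + h : holGerms x) = partialFun x i g + partialFun x i h := by
  obtain ⟨_, F, hF, rfl⟩ := g
  obtain ⟨_, G, hG, rfl⟩ := h
  refine Germ.coe_eq.2 ?_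
  filter_upwards [hF.eventually_analyticAt, hG.eventually_analyticAt] with y hy hy'
  exact congrArg (fun L : (Fin n → ℂ) →L[ℂ] ℂ => L (Pi.single i 1))
    (fderiv_add hy.differentiableAt hy'.differentiableAt)

theorem partialFun_smul {n : ℕ} (x : Fin n → ℂ) (i : Fin n) (c : ℂ) (g : holGerms x) :
    partialFun x i (c • g : holGerms x) = c • partialFun x i g := by
  obtain ⟨_, F, hF, rfl⟩ := g
  refine Germ.coe_eq.2 ?_
  filter_upwards [hF.eventually_analyticAt] with y hy
  exact congrArg (fun L : (Fin n → ℂ) →L[ℂ] ℂ => L (Pi.single i 1))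
    (fderiv_const_smul hy.differentiableAt c)

theorem partialFun_mul {n : ℕ} (x : Fin n → ℂ) (i : Fin n) (g h : holGerms x) :
    partialFun x i (g * h : holGerms x) = g * partialFun x i h + h * partialFun x i g := by
  obtain ⟨_, F, hF, rfl⟩ := g
  obtain ⟨_, G, hG, rfl⟩ := h
  refine Germ.coe_eq.2 ?_
  filter_upwards [hF.eventually_analyticAt, hG.eventually_analyticAt] with y hy hy'
  exact congrArg (fun L : (Fin n → ℂ) →L[ℂ] ℂ => L (Pi.single i 1))
    (fderiv_mul hy.differentiableAt hy'.differentiableAt)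

/-- The coordinate vector field `∂/∂xᵢ`, as a derivation of `𝒪_{ℂⁿ,x}`. -/
def coordField {n : ℕ} (x : Fin n → ℂ) (i : Fin n) : Derivation ℂ (Stalk x) (Stalk x) :=
  Derivation.mk'
    { toFun := fun g => (⟨partialFun x i (g : holGerms x).1, partialFun_mem x i g⟩ : holGerms x)
      map_add' := fun g h => Subtype.ext (partialFun_add x i g h)
      map_smul' := fun c g => Subtype.ext (partialFun_smul x i c g) }
    (fun g h => Subtype.ext (partialFun_mul x i g h))

/-- The stalk at `x` of the sheaf `Der_{ℂⁿ}` of holomorphic vector fields. -/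
abbrev Der {n : ℕ} (x : Fin n → ℂ) : Type := Derivation ℂ (Stalk x) (Stalk x)

/-- The germ at `x` of the vector field `∑ᵢ vᵢ ∂/∂xᵢ`. -/
def fieldGerm {n : ℕ} (v : (Fin n → ℂ) → (Fin n → ℂ)) (x : Fin n → ℂ) : Der x :=
  ∑ i, germ (fun y => v y i) x • coordField x i

/-! ### Logarithmic vector fields -/

/-- The `k`-derivations of `R` that preserve the ideal `I`. For `R = 𝒪_{ℂⁿ,x}` these are the
vector fields logarithmic along `V(I)`; for `k = 𝒪_S` and `R = 𝒪_{ℂⁿ × S}` they are the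
relative ones. -/
def logDer (k : Type) {R : Type} [CommRing k] [CommRing R] [Algebra k R] (I : Ideal R) :
    Submodule R (Derivation k R R) where
  carrier := {δ | ∀ g ∈ I, δ g ∈ I}
  add_mem' := fun ha hb g hg => I.add_mem (ha g hg) (hb g hg)
  zero_mem' := fun _ _ => I.zero_mem
  smul_mem' := fun c _ ha g hg => I.mul_mem_left c (ha g hg)

theorem mem_logDer_span_singleton {k R : Type} [CommRing k] [CommRing R] [Algebra k R] (f : R)
    (δ : Derivation k R R) :
    δ ∈ logDer k (Ideal.span {f}) ↔ δ f ∈ Ideal.span {f} := by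
  refine ⟨fun h => h f (Ideal.mem_span_singleton_self f), fun h g hg => ?_⟩
  obtain ⟨a, rfl⟩ := Ideal.mem_span_singleton'.1 hg
  rw [δ.leibniz, smul_eq_mul, smul_eq_mul]
  exact Ideal.add_mem _ (Ideal.mul_mem_left _ _ h)
    (Ideal.mul_mem_right _ _ (Ideal.mem_span_singleton_self f))

theorem lie_mem_logDer {k R : Type} [CommRing k] [CommRing R] [Algebra k R] {I : Ideal R}
    {δ ν : Derivation k R R} (hδ : δ ∈ logDer k I) (hν : ν ∈ logDer k I) :
    ⁅δ, ν⁆ ∈ logDer k I := fun g hg => by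
  rw [Derivation.commutator_apply]
  exact I.sub_mem (hδ _ (hν g hg)) (hν _ (hδ g hg))

/-- The stalk at `x` of the sheaf `Der(-log D)`, `D = V(f)`. -/
abbrev LogDer {n : ℕ} (f : (Fin n → ℂ) → ℂ) (x : Fin n → ℂ) : Submodule (Stalk x) (Der x) :=
  logDer ℂ (Ideal.span {germ f x})

/-- `v` is a section over `W` of the sheaf `Der(-log D)`, `D = V(f)`. -/
def IsLogField {n : ℕ} (f : (Fin n → ℂ) → ℂ) (W : Set (Fin n → ℂ))
    (v : (Fin n → ℂ) → (Fin n → ℂ)) : Prop :=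
  AnalyticOnNhd ℂ v W ∧ ∀ y ∈ W, fieldGerm v y ∈ LogDer f y

/-- `f = 0` defines a reduced divisor in the open set `U`. -/
structure IsReducedDivisor {n : ℕ} (f : (Fin n → ℂ) → ℂ) (U : Set (Fin n → ℂ)) : Prop where
  isOpen : IsOpen U
  analytic : AnalyticOnNhd ℂ f U
  germ_ne_zero : ∀ x ∈ U, germ f x ≠ 0
  reduced : ∀ x ∈ U, IsReduced (Stalk x ⧸ Ideal.span {germ f x})

/-- `f = 0` defines a free divisor in the open set `U`: it is a reduced divisor, and the sheaf
`Der(-log D)` is locally free on `U`. -/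
structure IsFreeDivisor {n : ℕ} (f : (Fin n → ℂ) → ℂ) (U : Set (Fin n → ℂ)) : Prop
    extends IsReducedDivisor f U where
  locally_free : ∀ x ∈ U, ∃ W : Set (Fin n → ℂ), IsOpen W ∧ x ∈ W ∧ W ⊆ U ∧
    ∃ (r : ℕ) (v : Fin r → (Fin n → ℂ) → (Fin n → ℂ)),
      (∀ k, IsLogField f W (v k)) ∧
      ∀ y ∈ W, LinearIndependent (Stalk y) (fun k => fieldGerm (v k) y) ∧
        Submodule.span (Stalk y) (Set.range fun k => fieldGerm (v k) y) = LogDer f y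

/-! ### The Lie algebroid complex in degrees `0`, `1`, `2` -/

/-- The stalk at `x` of `Der / Der(-log D)`. -/
abbrev Normal {n : ℕ} (f : (Fin n → ℂ) → ℂ) (x : Fin n → ℂ) : Type := Der x ⧸ LogDer f x

/-- The map `[δ, -]` on `Der / Der(-log D)`, for a logarithmic vector field `δ`. -/
def act {n : ℕ} {f : (Fin n → ℂ) → ℂ} {x : Fin n → ℂ} (δ : LogDer f x) :
    Normal f x →ₗ[ℂ] Normal f x :=
  ((LogDer f x).restrictScalars ℂ).mapQ ((LogDer f x).restrictScalars ℂ)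
    (LieAlgebra.ad ℂ (Der x) (δ : Der x)) (fun _ hν => lie_mem_logDer δ.2 hν)

theorem act_mk {n : ℕ} {f : (Fin n → ℂ) → ℂ} {x : Fin n → ℂ} (δ : LogDer f x) (σ : Der x) :
    act δ ((LogDer f x).mkQ σ) = (LogDer f x).mkQ ⁅(δ : Der x), σ⁆ := rfl

/-- The bracket of `Der(-log D)`. -/
def bracket {n : ℕ} {f : (Fin n → ℂ) → ℂ} {x : Fin n → ℂ} (δ ν : LogDer f x) : LogDer f x :=
  ⟨⁅(δ : Der x), (ν : Der x)⁆, lie_mem_logDer δ.2 ν.2⟩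

/-- The differential `d⁰` on stalks: `(d⁰ m)(δ) = -[δ, m]`. -/
def d0 {n : ℕ} {f : (Fin n → ℂ) → ℂ} {x : Fin n → ℂ} (m : Normal f x) :
    LogDer f x →ₗ[Stalk x] Normal f x where
  toFun δ := -act δ m
  map_add' δ ν := by
    obtain ⟨σ, rfl⟩ := (LogDer f x).mkQ_surjective m
    rw [act_mk, act_mk, act_mk, Submodule.coe_add, add_lie, map_add, neg_add]
  map_smul' c δ := by
    obtain ⟨σ, rfl⟩ := (LogDer f x).mkQ_surjective m
    rw [act_mk, act_mk, RingHom.id_apply, ← map_neg, ← map_neg, ← map_smul]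
    refine (Submodule.Quotient.eq _).2 ?_
    have h : -⁅((c • δ : LogDer f x) : Der x), σ⁆ - c • -⁅(δ : Der x), σ⁆ =
        σ c • (δ : Der x) := by
      ext g
      simp
    rw [h]
    exact (LogDer f x).smul_mem _ δ.2

/-- The differential `d¹` on stalks:
`(d¹ ψ)(δ ∧ ν) = -[δ, ψ(ν)] + [ν, ψ(δ)] + ψ([δ, ν])`. -/
def d1 {n : ℕ} {f : (Fin n → ℂ) → ℂ} {x : Fin n → ℂ} (ψ : LogDer f x →ₗ[Stalk x] Normal f x)
    (δ ν : LogDer f x) : Normal f x :=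
  -act δ (ψ ν) + act ν (ψ δ) + ψ (bracket δ ν)

theorem d1_d0 {n : ℕ} {f : (Fin n → ℂ) → ℂ} {x : Fin n → ℂ} (m : Normal f x)
    (δ ν : LogDer f x) : d1 (d0 m) δ ν = 0 := by
  obtain ⟨σ, rfl⟩ := (LogDer f x).mkQ_surjective m
  have h : ∀ μ : LogDer f x, d0 ((LogDer f x).mkQ σ) μ = -(LogDer f x).mkQ ⁅(μ : Der x), σ⁆ :=
    fun _ => rfl
  have hb : ((bracket δ ν : LogDer f x) : Der x) = ⁅(δ : Der x), (ν : Der x)⁆ := rfl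
  rw [d1, h, h, h, map_neg, map_neg, act_mk, act_mk, hb, lie_lie, map_sub]
  abel

/-- The family of stalks `m` is a section over `V` of the quotient sheaf
`𝒞⁰ = Der / Der(-log D)`: near every point of `V` it is the class of a holomorphic vector
field. -/
def IsSection0 {n : ℕ} (f : (Fin n → ℂ) → ℂ) (V : Set (Fin n → ℂ))
    (m : ∀ y : Fin n → ℂ, Normal f y) : Prop :=
  ∀ x ∈ V, ∃ W : Set (Fin n → ℂ), IsOpen W ∧ x ∈ W ∧ W ⊆ V ∧
    ∃ v : (Fin n → ℂ) → (Fin n → ℂ), AnalyticOnNhd ℂ v W ∧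
      ∀ y ∈ W, m y = (LogDer f y).mkQ (fieldGerm v y)

/-- A family of linear maps of stalks over all points. -/
def Family1 {n : ℕ} (f : (Fin n → ℂ) → ℂ) : Type :=
  ∀ y : Fin n → ℂ, LogDer f y →ₗ[Stalk y] Normal f y

instance {n : ℕ} (f : (Fin n → ℂ) → ℂ) : AddCommGroup (Family1 f) :=
  inferInstanceAs (AddCommGroup (∀ y : Fin n → ℂ, LogDer f y →ₗ[Stalk y] Normal f y))

instance {n : ℕ} (f : (Fin n → ℂ) → ℂ) : Module ℂ (Family1 f) :=
  inferInstanceAs (Module ℂ (∀ y : Fin n → ℂ, LogDer f y →ₗ[Stalk y] Normal f y))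

theorem Family1.add_apply {n : ℕ} {f : (Fin n → ℂ) → ℂ} (ψ ψ' : Family1 f) (y : Fin n → ℂ) :
    (ψ + ψ') y = ψ y + ψ' y := rfl

theorem Family1.smul_apply {n : ℕ} {f : (Fin n → ℂ) → ℂ} (c : ℂ) (ψ : Family1 f)
    (y : Fin n → ℂ) : (c • ψ) y = c • ψ y := rfl

theorem Family1.zero_apply {n : ℕ} {f : (Fin n → ℂ) → ℂ} (y : Fin n → ℂ) :
    (0 : Family1 f) y = 0 := rfl

/-- The family of stalks `ψ` is a section over `V` of the sheaf
`𝒞¹ = ℋom(Der(-log D), Der / Der(-log D))`: it maps sections of `Der(-log D)` to sections of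
`Der / Der(-log D)`. -/
def IsSection1 {n : ℕ} (f : (Fin n → ℂ) → ℂ) (V : Set (Fin n → ℂ)) (ψ : Family1 f) : Prop :=
  ∀ W : Set (Fin n → ℂ), IsOpen W → W ⊆ V →
    ∀ v : (Fin n → ℂ) → (Fin n → ℂ), IsLogField f W v →
      ∀ x ∈ W, ∃ W' : Set (Fin n → ℂ), IsOpen W' ∧ x ∈ W' ∧ W' ⊆ W ∧
        ∃ u : (Fin n → ℂ) → (Fin n → ℂ), AnalyticOnNhd ℂ u W' ∧
          ∀ y ∈ W', ∀ h : fieldGerm v y ∈ LogDer f y,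
            ψ y ⟨fieldGerm v y, h⟩ = (LogDer f y).mkQ (fieldGerm u y)

theorem germ_eq {n : ℕ} {F : (Fin n → ℂ) → ℂ} {x : Fin n → ℂ} (hF : AnalyticAt ℂ F x) :
    germ F x = (⟨(F : Germ (𝓝 x) ℂ), F, hF, rfl⟩ : holGerms x) := dif_pos hF

theorem germ_add {n : ℕ} {F G : (Fin n → ℂ) → ℂ} {x : Fin n → ℂ} (hF : AnalyticAt ℂ F x)
    (hG : AnalyticAt ℂ G x) : germ (fun y => F y + G y) x = germ F x + germ G x := by
  rw [germ_eq hF, germ_eq hG, germ_eq (hF.fun_add hG)]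
  rfl

theorem germ_smul {n : ℕ} {F : (Fin n → ℂ) → ℂ} {x : Fin n → ℂ} (c : ℂ)
    (hF : AnalyticAt ℂ F x) : germ (fun y => c * F y) x = c • germ F x := by
  rw [germ_eq hF, germ_eq (analyticAt_const.fun_mul hF)]
  rfl

theorem fieldGerm_add {n : ℕ} {v w : (Fin n → ℂ) → (Fin n → ℂ)} {x : Fin n → ℂ}
    (hv : AnalyticAt ℂ v x) (hw : AnalyticAt ℂ w x) :
    fieldGerm (fun y => v y + w y) x = fieldGerm v x + fieldGerm w x := by
  simp only [fieldGerm, Pi.add_apply, ← Finset.sum_add_distrib, ← add_smul]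
  exact Finset.sum_congr rfl fun i _ => by
    rw [germ_add (analyticAt_pi_iff.1 hv i) (analyticAt_pi_iff.1 hw i)]

theorem fieldGerm_smul {n : ℕ} {v : (Fin n → ℂ) → (Fin n → ℂ)} {x : Fin n → ℂ} (c : ℂ)
    (hv : AnalyticAt ℂ v x) : fieldGerm (fun y => c • v y) x = c • fieldGerm v x := by
  simp only [fieldGerm, Pi.smul_apply, smul_eq_mul, Finset.smul_sum, ← smul_assoc]
  exact Finset.sum_congr rfl fun i _ => by rw [germ_smul c (analyticAt_pi_iff.1 hv i)]

theorem fieldGerm_zero {n : ℕ} (x : Fin n → ℂ) : fieldGerm (fun _ => 0) x = 0 := by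
  have h := fieldGerm_smul (x := x) (v := fun _ => (0 : Fin n → ℂ)) 0 analyticAt_const
  simpa using h

theorem IsSection0.zero {n : ℕ} {f : (Fin n → ℂ) → ℂ} {V : Set (Fin n → ℂ)} (hV : IsOpen V) :
    IsSection0 f V 0 := fun x hx =>
  ⟨V, hV, hx, subset_rfl, fun _ => 0, fun _ _ => analyticAt_const, fun y _ => by
    rw [fieldGerm_zero, map_zero]; rfl⟩

theorem IsSection0.add {n : ℕ} {f : (Fin n → ℂ) → ℂ} {V V' : Set (Fin n → ℂ)}
    {m m' : ∀ y : Fin n → ℂ, Normal f y} (h : IsSection0 f V m) (h' : IsSection0 f V' m') :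
    IsSection0 f (V ∩ V') (m + m') := fun x hx => by
  obtain ⟨W, hW, hxW, hWV, v, hv, hm⟩ := h x hx.1
  obtain ⟨W', hW', hxW', hWV', v', hv', hm'⟩ := h' x hx.2
  refine ⟨W ∩ W', hW.inter hW', ⟨hxW, hxW'⟩, Set.inter_subset_inter hWV hWV',
    fun y => v y + v' y, fun y hy => (hv y hy.1).fun_add (hv' y hy.2), fun y hy => ?_⟩
  rw [fieldGerm_add (hv y hy.1) (hv' y hy.2), map_add, ← hm y hy.1, ← hm' y hy.2]
  rfl

theorem IsSection0.smul {n : ℕ} {f : (Fin n → ℂ) → ℂ} {V : Set (Fin n → ℂ)}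
    {m : ∀ y : Fin n → ℂ, Normal f y} (c : ℂ) (h : IsSection0 f V m) :
    IsSection0 f V (c • m) := fun x hx => by
  obtain ⟨W, hW, hxW, hWV, v, hv, hm⟩ := h x hx
  refine ⟨W, hW, hxW, hWV, fun y => c • v y,
    fun y hy => analyticAt_const.fun_smul (hv y hy), fun y hy => ?_⟩
  rw [fieldGerm_smul c (hv y hy), Pi.smul_apply, hm y hy]
  rfl

theorem IsSection1.zero {n : ℕ} {f : (Fin n → ℂ) → ℂ} {V : Set (Fin n → ℂ)} :
    IsSection1 f V 0 := fun W hW _ _ _ x hx =>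
  ⟨W, hW, hx, subset_rfl, fun _ => 0, fun _ _ => analyticAt_const, fun y _ _ => by
    rw [fieldGerm_zero, map_zero]; rfl⟩

theorem IsSection1.add {n : ℕ} {f : (Fin n → ℂ) → ℂ} {V V' : Set (Fin n → ℂ)}
    {ψ ψ' : Family1 f} (h : IsSection1 f V ψ) (h' : IsSection1 f V' ψ') :
    IsSection1 f (V ∩ V') (ψ + ψ') := fun W hW hWV w hw x hx => by
  obtain ⟨A, hA, hxA, hAW, v, hv, hm⟩ := h W hW (fun y hy => (hWV hy).1) w hw x hx
  obtain ⟨A', hA', hxA', hAW', v', hv', hm'⟩ := h' W hW (fun y hy => (hWV hy).2) w hw x hx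
  refine ⟨A ∩ A', hA.inter hA', ⟨hxA, hxA'⟩, fun y hy => hAW hy.1,
    fun y => v y + v' y, fun y hy => (hv y hy.1).fun_add (hv' y hy.2), fun y hy hl => ?_⟩
  rw [fieldGerm_add (hv y hy.1) (hv' y hy.2), map_add, ← hm y hy.1 hl, ← hm' y hy.2 hl]
  rfl

theorem IsSection1.smul {n : ℕ} {f : (Fin n → ℂ) → ℂ} {V : Set (Fin n → ℂ)} {ψ : Family1 f}
    (c : ℂ) (h : IsSection1 f V ψ) : IsSection1 f V (c • ψ) := fun W hW hWV w hw x hx => by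
  obtain ⟨A, hA, hxA, hAW, v, hv, hm⟩ := h W hW hWV w hw x hx
  refine ⟨A, hA, hxA, hAW, fun y => c • v y,
    fun y hy => analyticAt_const.fun_smul (hv y hy), fun y hy hl => ?_⟩
  rw [fieldGerm_smul c (hv y hy), Family1.smul_apply, LinearMap.smul_apply, hm y hy hl]
  rfl

/-- The germs at `x` of sections of `ker (d¹ : 𝒞¹ → 𝒞²)`, each given by a representative. -/
def cocycles {n : ℕ} (f : (Fin n → ℂ) → ℂ) (x : Fin n → ℂ) : Submodule ℂ (Family1 f) where
  carrier := {ψ | ∃ V : Set (Fin n → ℂ), IsOpen V ∧ x ∈ V ∧ IsSection1 f V ψ ∧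
    ∀ y ∈ V, ∀ δ ν : LogDer f y, d1 (ψ y) δ ν = 0}
  zero_mem' := ⟨Set.univ, isOpen_univ, trivial, IsSection1.zero, fun y _ δ ν => by simp [d1, Family1.zero_apply]⟩
  add_mem' := by
    rintro ψ ψ' ⟨V, hV, hx, hs, hd⟩ ⟨V', hV', hx', hs', hd'⟩
    refine ⟨V ∩ V', hV.inter hV', ⟨hx, hx'⟩, hs.add hs', fun y hy δ ν => ?_⟩
    have h := congrArg₂ (· + ·) (hd y hy.1 δ ν) (hd' y hy.2 δ ν)
    simp only [d1, add_zero] at h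
    simp only [d1, Family1.add_apply, LinearMap.add_apply, map_add]
    rw [← h]
    abel
  smul_mem' := by
    rintro c ψ ⟨V, hV, hx, hs, hd⟩
    refine ⟨V, hV, hx, hs.smul c, fun y hy δ ν => ?_⟩
    have h := congrArg (c • ·) (hd y hy δ ν)
    simp only [d1, smul_zero, smul_add, smul_neg] at h
    simp only [d1, Family1.smul_apply, LinearMap.smul_apply, map_smul]
    exact h

/-- The germs at `x` of sections of the image of `d⁰ : 𝒞⁰ → 𝒞¹`, each given by a
representative; these include the families that vanish near `x`. -/
def coboundaries {n : ℕ} (f : (Fin n → ℂ) → ℂ) (x : Fin n → ℂ) : Submodule ℂ (Family1 f) where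
  carrier := {ψ | ∃ V : Set (Fin n → ℂ), IsOpen V ∧ x ∈ V ∧
    ∃ m : ∀ y : Fin n → ℂ, Normal f y, IsSection0 f V m ∧ ∀ y ∈ V, ψ y = d0 (m y)}
  zero_mem' := ⟨Set.univ, isOpen_univ, trivial, 0, IsSection0.zero isOpen_univ, fun y _ =>
    LinearMap.ext fun δ => by simp [d0, Family1.zero_apply]⟩
  add_mem' := by
    rintro ψ ψ' ⟨V, hV, hx, m, hs, hd⟩ ⟨V', hV', hx', m', hs', hd'⟩
    refine ⟨V ∩ V', hV.inter hV', ⟨hx, hx'⟩, m + m', hs.add hs', fun y hy => ?_⟩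
    rw [Family1.add_apply, hd y hy.1, hd' y hy.2]
    refine LinearMap.ext fun δ => ?_
    simp [d0, add_comm]
  smul_mem' := by
    rintro c ψ ⟨V, hV, hx, m, hs, hd⟩
    refine ⟨V, hV, hx, c • m, hs.smul c, fun y hy => ?_⟩
    rw [Family1.smul_apply, hd y hy]
    refine LinearMap.ext fun δ => ?_
    simp [d0]

/-- The stalk at `x` of the first cohomology sheaf `ℋ¹(𝒞•)`, as a complex vector space: the
direct limit of `ker d¹ / im d⁰` over the open neighbourhoods of `x`. -/
abbrev H1 {n : ℕ} (f : (Fin n → ℂ) → ℂ) (x : Fin n → ℂ) : Type :=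
  cocycles f x ⧸ (coboundaries f x).submoduleOf (cocycles f x)

/-! ### Admissible deformations

The base is a fat point `S = Spec A`, for a finite-dimensional local `ℂ`-algebra `A` with
residue map `ρ : A → ℂ`; then `𝒪_{ℂⁿ × S, 0} = A ⊗ 𝒪_{ℂⁿ, 0}`. -/

/-- The local ring `𝒪_{ℂⁿ × Spec A, 0}`. -/
abbrev RelStalk (n : ℕ) (A : Type) [CommRing A] [Algebra ℂ A] : Type :=
  A ⊗[ℂ] Stalk (0 : Fin n → ℂ)

section Deformations

variable {n : ℕ} {A B : Type} [CommRing A] [Algebra ℂ A] [CommRing B] [Algebra ℂ B]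

/-- Restriction of functions on `ℂⁿ × Spec A` to the central fibre `ℂⁿ`. -/
def restrict (ρ : A →ₐ[ℂ] ℂ) : RelStalk n A →ₐ[ℂ] Stalk (0 : Fin n → ℂ) :=
  Algebra.TensorProduct.lift ((Algebra.ofId ℂ (Stalk (0 : Fin n → ℂ))).comp ρ)
    (AlgHom.id ℂ (Stalk (0 : Fin n → ℂ))) (fun _ _ => Commute.all _ _)

/-- Restriction of relative vector fields on `ℂⁿ × Spec A` to the central fibre `ℂⁿ`. -/
def restrictDer (ρ : A →ₐ[ℂ] ℂ) (δ : Derivation A (RelStalk n A) (RelStalk n A)) :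
    Der (0 : Fin n → ℂ) :=
  Derivation.mk'
    { toFun := fun g => restrict ρ (δ (1 ⊗ₜ g))
      map_add' := fun g h => by rw [TensorProduct.tmul_add, map_add, map_add]
      map_smul' := fun c g => by
        rw [TensorProduct.tmul_smul, ← algebraMap_smul A c ((1 : A) ⊗ₜ[ℂ] g), δ.map_smul,
          algebraMap_smul, map_smul, RingHom.id_apply] }
    (fun g h => by
      have e : (1 : A) ⊗ₜ[ℂ] (g * h) = (1 ⊗ₜ g) * (1 ⊗ₜ h) := by simp
      change restrict ρ (δ (1 ⊗ₜ (g * h))) =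
        g * restrict ρ (δ (1 ⊗ₜ h)) + h * restrict ρ (δ (1 ⊗ₜ g))
      rw [e, δ.leibniz]
      simp [restrict])

/-- An admissible deformation over `Spec A` of the germ at `0` of `D = V(f)`. -/
structure AdmissibleDeformation (f : (Fin n → ℂ) → ℂ) (ρ : A →ₐ[ℂ] ℂ) where
  /-- The ideal of the total space `X ⊆ ℂⁿ × Spec A`. -/
  ideal : Ideal (RelStalk n A)
  /-- The projection `X → Spec A` is flat. -/
  flat : Module.Flat A (RelStalk n A ⧸ ideal)
  /-- The closed embedding `D → X`, followed by the inclusion `X ⊆ ℂⁿ × Spec A`. -/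
  emb : RelStalk n A →ₐ[ℂ] Stalk (0 : Fin n → ℂ) ⧸ Ideal.span {germ f 0}
  emb_surjective : Function.Surjective emb
  /-- The embedding is an isomorphism of `D` with the central fibre of `X`. -/
  ker_emb : RingHom.ker emb =
    ideal ⊔ (RingHom.ker ρ).map (algebraMap A (RelStalk n A))
  /-- `Der(-log X/S) / 𝔪 Der(-log X/S) = Der(-log D)`, with `D` identified with the central
  fibre: the image of `Der(-log X/S)` in `Der` is the module of logarithmic vector fields ... -/
  image_logDer : ∀ η : Der (0 : Fin n → ℂ),
    η ∈ logDer ℂ (ideal.map (restrict (n := n) ρ)) ↔ ∃ δ ∈ logDer A ideal, restrictDer ρ δ = η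
  /-- ... and the kernel of `Der(-log X/S) → Der` is `𝔪 Der(-log X/S)`. -/
  ker_logDer : ∀ δ ∈ logDer A ideal, restrictDer ρ δ = 0 →
    δ ∈ (RingHom.ker ρ).map (algebraMap A (RelStalk n A)) • logDer A ideal

/-- Isomorphism of deformations: an isomorphism of total spaces over `Spec A` that induces the
identity of `D`. -/
def AdmissibleDeformation.Iso {f : (Fin n → ℂ) → ℂ} {ρ : A →ₐ[ℂ] ℂ}
    (X Y : AdmissibleDeformation f ρ) : Prop :=
  ∃ τ : (RelStalk n A ⧸ X.ideal) ≃ₐ[A] (RelStalk n A ⧸ Y.ideal),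
    ∀ r s : RelStalk n A, τ (Ideal.Quotient.mk X.ideal r) = Ideal.Quotient.mk Y.ideal s →
      X.emb r = Y.emb s

theorem AdmissibleDeformation.emb_eq {f : (Fin n → ℂ) → ℂ} {ρ : A →ₐ[ℂ] ℂ}
    (X : AdmissibleDeformation f ρ) {r s : RelStalk n A}
    (h : Ideal.Quotient.mk X.ideal r = Ideal.Quotient.mk X.ideal s) : X.emb r = X.emb s := by
  rw [← sub_eq_zero, ← map_sub, ← RingHom.mem_ker, X.ker_emb]
  exact Ideal.mem_sup_left (Ideal.Quotient.eq.1 h)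

instance isoSetoid (f : (Fin n → ℂ) → ℂ) (ρ : A →ₐ[ℂ] ℂ) :
    Setoid (AdmissibleDeformation f ρ) where
  r := AdmissibleDeformation.Iso
  iseqv :=
    { refl := fun X => ⟨AlgEquiv.refl, fun _ _ h => X.emb_eq h⟩
      symm := fun {X Y} ⟨τ, hτ⟩ => ⟨τ.symm, fun r s h =>
        (hτ s r ((τ.symm_apply_eq).1 h).symm).symm⟩
      trans := fun {X Y Z} ⟨τ, hτ⟩ ⟨σ, hσ⟩ => ⟨τ.trans σ, fun r s h => by
        obtain ⟨t, ht⟩ := Ideal.Quotient.mk_surjective (τ (Ideal.Quotient.mk X.ideal r))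
        refine (hτ r t ht.symm).trans (hσ t s ?_)
        rw [ht]
        exact h⟩ }

/-- The set `FD_D(A)` of isomorphism classes of admissible deformations over `Spec A`. -/
def FD (f : (Fin n → ℂ) → ℂ) (ρ : A →ₐ[ℂ] ℂ) : Type := Quotient (isoSetoid f ρ)

/-- `b ∈ FD_D(B)` is the image of `a ∈ FD_D(A)` under the map `FD_D(φ)`, i.e. it is the class of
the base change along `φ : A → B` of a deformation in the class `a`. -/
def FDMaps {f : (Fin n → ℂ) → ℂ} {ρ : A →ₐ[ℂ] ℂ} {ρ' : B →ₐ[ℂ] ℂ} (φ : A →ₐ[ℂ] B)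
    (a : FD f ρ) (b : FD f ρ') : Prop :=
  ∃ (X : AdmissibleDeformation f ρ) (Y : AdmissibleDeformation f ρ'),
    Quotient.mk _ X = a ∧ Quotient.mk _ Y = b ∧
    Y.ideal = X.ideal.map
      (Algebra.TensorProduct.map φ (AlgHom.id ℂ (Stalk (0 : Fin n → ℂ)))) ∧
    ∀ r, Y.emb (Algebra.TensorProduct.map φ (AlgHom.id ℂ (Stalk (0 : Fin n → ℂ))) r) = X.emb r

end Deformations

/-! ### First order deformations -/

/-- The residue map of the local algebra `ℂ ⊕ V` with `V² = 0`: for `V = ℂ` this algebra is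
`ℂ[ε] = ℂ[t]/(t²)`, for `V = ℂ × ℂ` it is `ℂ[ε] ×_ℂ ℂ[ε]`. -/
abbrev residue (V : Type) [AddCommGroup V] [Module ℂ V] [Module ℂᵐᵒᵖ V] [IsCentralScalar ℂ V] :
    TrivSqZeroExt ℂ V →ₐ[ℂ] ℂ :=
  TrivSqZeroExt.fstHom ℂ ℂ V

/-- `ℱ𝒯¹(D) = FD_D(ℂ[t]/(t²))`. -/
abbrev FT1 {n : ℕ} (f : (Fin n → ℂ) → ℂ) : Type := FD f (residue ℂ)

/-- The set `FD_D(ℂ[ε] ×_ℂ ℂ[ε])`. -/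
abbrev FT1Pair {n : ℕ} (f : (Fin n → ℂ) → ℂ) : Type := FD f (residue (ℂ × ℂ))

end

end FreeDivisor

/-!
Write `R` for the local ring `𝒪_{ℂⁿ,0}`, `h ∈ R` for the germ of `f`, `L` for the module of
logarithmic vector fields, `T ⊆ R` for the ideal of all `σ(h) + c h`, with `σ` a vector field
(`tjurina`), and `K ⊆ R` for the space of those `g` such that `δ(g) - a g ∈ T` for every `δ ∈ L`,
`δ(h) = a h` (`admissiblePerturbation`). Both sides of the theorem are identified with `K / T`.

*Deformations.* Over `A = ℂ ⊕ V` with `V² = 0`, a function on `ℂⁿ × Spec A` consists of its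
restriction to `ℂⁿ` and of its components along the linear forms on `V` (`restrict`, `contract`).
The embedding of `D` into a deformation lifts to an automorphism of `ℂⁿ` (`exists_algEquiv_lift`),
so the deformation may be assumed embedded with `D` in its standard position. Flatness then says
that it is given by one equation `H` restricting to `h` (`exists_equation`, `flat_quotient_span`),
and admissibility that every component of `H` lies in `K`: an extension `δ + ∑ bᵢ σᵢ` of `δ ∈ L` is
logarithmic exactly if the `σᵢ(h)` cancel the `δ(gᵢ) - a gᵢ` modulo `h`. An isomorphism of two such
deformations over the identity of `D` is given by vector fields, so two equations are isomorphic
exactly if their components agree modulo `T` (`ofEquation_mk_eq_iff`). Hence the set of isomorphism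
classes is `Hom(V*, K / T)`, naturally in `V`, which gives the tangent space condition
(`existsUnique_fdMaps`) and the vector space structure on `FT1`.

*Cohomology.* A perturbation `g ∈ K` has an obstruction cochain: `δ` is sent to the class of a `σ`
for which `δ + ε σ` is logarithmic for `h + ε g` (`Matches`). It is closed (`Matches.d1_eq_zero`),
and exact if and only if `g ∈ T` (`Matches.exists_eq_d0_iff`). Here reducedness enters: no
minimal prime of `(h)` contains all partial derivatives of `h`, since it would then be stable under
all derivations and be contained in every power of the maximal ideal. Conversely every
closed cochain is an obstruction (`exists_matches`). Saito's criterion (`span_det_eq_span`) says that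
the coefficient determinant of a basis of `L` is an equation of `D`; a closed cochain `ψ` lifts the
basis `δᵢ` to relative fields `δᵢ + ε σᵢ` that are closed under brackets up to linear combination,
and the determinant of the lifted coefficient matrix is then an eigenfunction of the lifted fields,
so that its `ε`-component is, up to a unit, the required `g`. A local basis of `Der(-log D)` carries
these statements from the stalk at `0` to a neighbourhood.

*Local rings.* The commutative algebra rests on `R` being noetherian, which is proved by Weierstrass
division; with Krull's intersection theorem it implies that algebra homomorphisms and derivations
out of `R` are determined by the coordinate functions.
-/

open Filter Topology
open scoped TensorProduct

namespace FreeDivisor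

noncomputable section

/-! ### The local rings of germs -/

section Germs

variable {n m : ℕ} {x : Fin n → ℂ}

theorem exists_germ_eq (r : Stalk x) : ∃ F : (Fin n → ℂ) → ℂ, AnalyticAt ℂ F x ∧ germ F x = r := by
  obtain ⟨_, F, hF, rfl⟩ := r
  exact ⟨F, hF, germ_eq hF⟩

theorem germ_eq_germ_iff {F G : (Fin n → ℂ) → ℂ} (hF : AnalyticAt ℂ F x) (hG : AnalyticAt ℂ G x) :
    germ F x = germ G x ↔ F =ᶠ[𝓝 x] G := by
  rw [germ_eq hF, germ_eq hG]
  exact Subtype.ext_iff.trans Germ.coe_eq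

theorem germ_congr {F G : (Fin n → ℂ) → ℂ} (hF : AnalyticAt ℂ F x) (h : F =ᶠ[𝓝 x] G) :
    germ F x = germ G x :=
  (germ_eq_germ_iff hF (hF.congr h)).2 h

theorem germ_mul {F G : (Fin n → ℂ) → ℂ} (hF : AnalyticAt ℂ F x) (hG : AnalyticAt ℂ G x) :
    germ (fun y => F y * G y) x = germ F x * germ G x := by
  rw [germ_eq hF, germ_eq hG, germ_eq (hF.fun_mul hG)]
  rfl

theorem germ_const (c : ℂ) : germ (fun _ => c) x = algebraMap ℂ (Stalk x) c := by
  rw [germ_eq analyticAt_const, Algebra.algebraMap_eq_smul_one]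
  refine Subtype.ext ?_
  exact congrArg (fun h : (Fin n → ℂ) → ℂ => (h : Germ (𝓝 x) ℂ))
      (funext fun _ => (mul_one c).symm)

theorem germ_zero : germ (fun _ => 0) x = (0 : Stalk x) := by
  rw [germ_const, map_zero]

theorem germ_one : germ (fun _ => 1) x = (1 : Stalk x) := by
  rw [germ_const, map_one]

theorem germ_sub {F G : (Fin n → ℂ) → ℂ} (hF : AnalyticAt ℂ F x) (hG : AnalyticAt ℂ G x) :
    germ (fun y => F y - G y) x = germ F x - germ G x := by
  rw [germ_eq hF, germ_eq hG, germ_eq (hF.fun_sub hG)]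
  rfl

theorem germ_sum {ι : Type*} (s : Finset ι) {F : ι → (Fin n → ℂ) → ℂ}
    (hF : ∀ i ∈ s, AnalyticAt ℂ (F i) x) :
    germ (fun y => ∑ i ∈ s, F i y) x = ∑ i ∈ s, germ (F i) x := by
  classical
  induction s using Finset.induction_on with
  | empty => simpa using germ_zero
  | insert a s ha ih =>
    simp only [Finset.sum_insert ha]
    rw [germ_add (hF a (Finset.mem_insert_self a s))
      (Finset.analyticAt_fun_sum s fun i hi => hF i (Finset.mem_insert_of_mem hi)),
      ih fun i hi => hF i (Finset.mem_insert_of_mem hi)]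

/-- The value at `x` of a germ at `x`. -/
def value (x : Fin n → ℂ) : Stalk x →ₐ[ℂ] ℂ where
  toFun r := Germ.value (r : holGerms x).1
  map_one' := rfl
  map_zero' := rfl
  map_mul' := by
    rintro ⟨_, F, hF, rfl⟩ ⟨_, G, hG, rfl⟩
    rfl
  map_add' := by
    rintro ⟨_, F, hF, rfl⟩ ⟨_, G, hG, rfl⟩
    rfl
  commutes' c := by
    rw [← germ_const, germ_eq analyticAt_const]
    rfl

theorem value_germ {F : (Fin n → ℂ) → ℂ} (hF : AnalyticAt ℂ F x) : value x (germ F x) = F x := by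
  rw [germ_eq hF]
  rfl

theorem isUnit_iff_value_ne_zero (r : Stalk x) : IsUnit r ↔ value x r ≠ 0 := by
  refine ⟨fun h => (h.map (value x)).ne_zero, fun h => ?_⟩
  obtain ⟨F, hF, rfl⟩ := exists_germ_eq r
  rw [value_germ hF] at h
  refine IsUnit.of_mul_eq_one (germ (fun y => (F y)⁻¹) x) ?_
  rw [← germ_mul hF (hF.fun_inv h), ← germ_one]
  refine germ_congr (hF.fun_mul (hF.fun_inv h)) ?_
  filter_upwards [hF.continuousAt.eventually_ne h] with y hy
  exact mul_inv_cancel₀ hy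

instance : Nontrivial (Stalk x) := (value x).toRingHom.domain_nontrivial

instance : IsLocalRing (Stalk x) :=
  IsLocalRing.of_nonunits_add fun a b ha hb => by
    simp only [mem_nonunits_iff, isUnit_iff_value_ne_zero, not_not] at ha hb ⊢
    rw [map_add, ha, hb, add_zero]

theorem mem_maximalIdeal_iff (r : Stalk x) :
    r ∈ IsLocalRing.maximalIdeal (Stalk x) ↔ value x r = 0 := by
  rw [IsLocalRing.mem_maximalIdeal, mem_nonunits_iff, isUnit_iff_value_ne_zero, not_not]

/-- The germ at `x` of the `i`-th coordinate centred at `x`. -/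
def coord (x : Fin n → ℂ) (i : Fin n) : Stalk x := germ (fun y => y i - x i) x

theorem analyticAt_coord (z : Fin n → ℂ) (i : Fin n) (c : ℂ) :
    AnalyticAt ℂ (fun y : Fin n → ℂ => y i - c) z :=
  ((ContinuousLinearMap.proj (R := ℂ) (φ := fun _ : Fin n => ℂ) i).analyticAt z).sub
    analyticAt_const

theorem analyticAt_apply (z : Fin n → ℂ) (i : Fin n) :
    AnalyticAt ℂ (fun y : Fin n → ℂ => y i) z :=
  (ContinuousLinearMap.proj (R := ℂ) (φ := fun _ : Fin n => ℂ) i).analyticAt z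

theorem value_coord (i : Fin n) : value x (coord x i) = 0 := by
  rw [coord, value_germ (analyticAt_coord x i (x i)), sub_self]

/-- An analytic function is its value plus a linear form in the centred coordinates with
analytic coefficients: the shifted power series supplies the coefficients. -/
theorem exists_eq_add_apply {F : (Fin n → ℂ) → ℂ} (hF : AnalyticAt ℂ F x) :
    ∃ G : (Fin n → ℂ) → ((Fin n → ℂ) →L[ℂ] ℂ), AnalyticAt ℂ G x ∧
      ∀ᶠ y in 𝓝 x, F y = F x + G y (y - x) := by
  obtain ⟨p, r, hp⟩ := hF
  have hq : HasFPowerSeriesOnBall p.shift.sum p.shift 0 p.shift.radius :=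
    p.shift.hasFPowerSeriesOnBall (by rw [FormalMultilinearSeries.radius_shift]
                                      exact hp.r_pos.trans_le hp.r_le)
  have hG : AnalyticAt ℂ (fun y => p.shift.sum (y - x)) x :=
    AnalyticAt.fun_comp (g := p.shift.sum) (f := fun y => y - x)
      (by simpa using hq.analyticAt) (analyticAt_id.sub analyticAt_const)
  refine ⟨_, hG, ?_⟩
  filter_upwards [Metric.eball_mem_nhds x hp.r_pos] with y hy
  have hy' : y - x ∈ Metric.eball (0 : Fin n → ℂ) r := by
    simpa [edist_eq_enorm_sub] using hy
  have h1 := hp.hasSum hy'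
  rw [add_sub_cancel] at h1
  have h2 := hq.hasSum (y := y - x) (by
    rw [FormalMultilinearSeries.radius_shift]
    exact Metric.eball_subset_eball hp.r_le hy')
  rw [zero_add] at h2
  have h3 := (ContinuousLinearMap.apply ℂ ℂ (y - x)).hasSum h2
  have h4 := (hasSum_nat_add_iff' 1).2 h1
  have h5 : F y - ∑ i ∈ Finset.range 1, (p i fun _ => y - x) = p.shift.sum (y - x) (y - x) :=
    h4.unique (by
      convert h3 using 2 with k
      change _ = p (k + 1) (Fin.snoc (fun _ => y - x) (y - x))
      congr 1
      funext j
      refine Fin.lastCases ?_ (fun j => ?_) j <;> simp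
      rfl)
  rw [← h5, Finset.sum_range_one, hp.coeff_zero]
  ring

theorem mem_span_coord_iff (r : Stalk x) :
    r ∈ Ideal.span (Set.range (coord x)) ↔ value x r = 0 := by
  constructor
  · intro h
    have : Ideal.span (Set.range (coord x)) ≤ RingHom.ker (value x) :=
      Ideal.span_le.2 (by rintro _ ⟨i, rfl⟩; exact value_coord i)
    exact this h
  · intro h
    obtain ⟨F, hF, rfl⟩ := exists_germ_eq r
    rw [value_germ hF] at h
    obtain ⟨G, hG, hFG⟩ := exists_eq_add_apply hF
    have hGi : ∀ i, AnalyticAt ℂ (fun y => G y (Pi.single i 1)) x := fun i =>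
      ((ContinuousLinearMap.apply ℂ ℂ (Pi.single i 1 : Fin n → ℂ)).analyticAt _).comp hG
    have e : germ F x = ∑ i, germ (fun y => G y (Pi.single i 1)) x * coord x i := by
      simp only [coord, ← germ_mul (hGi _) (analyticAt_coord x _ (x _))]
      rw [← germ_sum _ fun i _ => (hGi i).fun_mul (analyticAt_coord x i (x i))]
      refine germ_congr hF ?_
      filter_upwards [hFG] with y hy
      rw [hy, h, zero_add]
      conv_lhs => rw [pi_eq_sum_univ' (y - x), map_sum]
      refine Finset.sum_congr rfl fun i _ => ?_
      rw [map_smul, smul_eq_mul, mul_comm]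
      rfl
    rw [e]
    exact Ideal.sum_mem _ fun i _ => Ideal.mul_mem_left _ _ (Ideal.subset_span ⟨i, rfl⟩)

theorem maximalIdeal_eq_span_coord :
    IsLocalRing.maximalIdeal (Stalk x) = Ideal.span (Set.range (coord x)) := by
  ext r
  rw [mem_maximalIdeal_iff, mem_span_coord_iff]

instance : IsDomain (Stalk x) := by
  refine @NoZeroDivisors.to_isDomain _ _ _ ⟨fun {a b} hab => ?_⟩
  by_contra! h
  obtain ⟨⟨F, hF, rfl⟩, ⟨G, hG, rfl⟩⟩ := exists_germ_eq a, exists_germ_eq b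
  rw [← germ_mul hF hG, ← germ_zero, germ_eq_germ_iff (hF.fun_mul hG) analyticAt_const] at hab
  obtain ⟨ε, hε, hball⟩ := Metric.eventually_nhds_iff_ball.1
    (hF.eventually_analyticAt.and (hG.eventually_analyticAt.and hab))
  have key : ∃ y ∈ Metric.ball x ε, F y ≠ 0 := by
    by_contra! hc
    refine h.1 ?_
    rw [← germ_zero, germ_eq_germ_iff hF analyticAt_const]
    exact eventually_of_mem (Metric.ball_mem_nhds x hε) hc
  obtain ⟨y, hy, hFy⟩ := key
  have hGy : G =ᶠ[𝓝 y] 0 := by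
    filter_upwards [(hball y hy).1.continuousAt.eventually_ne hFy,
      Metric.isOpen_ball.mem_nhds hy] with z hz hz'
    exact (mul_eq_zero.1 (hball z hz').2.2).resolve_left hz
  have hG0 := AnalyticOnNhd.eqOn_zero_of_preconnected_of_eventuallyEq_zero
    (fun z hz => (hball z hz).2.1) (convex_ball x ε).isPreconnected hy hGy
  refine h.2 ?_
  rw [← germ_zero, germ_eq_germ_iff hG analyticAt_const]
  exact eventually_of_mem (Metric.ball_mem_nhds x hε) hG0

/-- Pull-back of germs along an analytic map. -/
def pull {y : Fin m → ℂ} (φ : (Fin n → ℂ) → (Fin m → ℂ)) (hφ : AnalyticAt ℂ φ x) (hy : φ x = y) :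
    Stalk y →ₐ[ℂ] Stalk x where
  toFun r := (⟨Germ.compTendsto (r : holGerms y).1 φ (hy ▸ hφ.continuousAt), by
    obtain ⟨_, F, hF, rfl⟩ := r
    exact ⟨F ∘ φ, (hy ▸ hF : AnalyticAt ℂ F (φ x)).comp hφ, rfl⟩⟩ : holGerms x)
  map_one' := rfl
  map_zero' := rfl
  map_mul' := by
    rintro ⟨_, F, hF, rfl⟩ ⟨_, G, hG, rfl⟩
    rfl
  map_add' := by
    rintro ⟨_, F, hF, rfl⟩ ⟨_, G, hG, rfl⟩
    rfl
  commutes' c := by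
    rw [← germ_const, ← germ_const, germ_eq analyticAt_const, germ_eq analyticAt_const]
    rfl

theorem pull_germ {y : Fin m → ℂ} {φ : (Fin n → ℂ) → (Fin m → ℂ)} (hφ : AnalyticAt ℂ φ x)
    (hy : φ x = y) {F : (Fin m → ℂ) → ℂ} (hF : AnalyticAt ℂ F y) :
    pull φ hφ hy (germ F y) = germ (fun z => F (φ z)) x := by
  subst hy
  rw [germ_eq hF, germ_eq (hF.fun_comp hφ)]
  rfl

theorem pull_pull {k : ℕ} {y : Fin m → ℂ} {z : Fin k → ℂ}
    {φ : (Fin n → ℂ) → (Fin m → ℂ)} (hφ : AnalyticAt ℂ φ x) (hy : φ x = y)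
    {χ : (Fin m → ℂ) → (Fin k → ℂ)} (hχ : AnalyticAt ℂ χ y) (hz : χ y = z)
    {ω : (Fin n → ℂ) → (Fin k → ℂ)} (hω : AnalyticAt ℂ ω x) (hz' : ω x = z)
    (h : ∀ᶠ t in 𝓝 x, χ (φ t) = ω t) (r : Stalk z) :
    pull φ hφ hy (pull χ hχ hz r) = pull ω hω hz' r := by
  obtain ⟨F, hF, rfl⟩ := exists_germ_eq r
  subst hy hz
  have h1 : AnalyticAt ℂ (fun t => F (χ t)) (φ x) := hF.fun_comp hχ
  rw [pull_germ hχ rfl hF, pull_germ hφ rfl h1, pull_germ hω hz' hF]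
  refine germ_congr (h1.fun_comp hφ) ?_
  filter_upwards [h] with t ht
  rw [ht]

theorem pull_id {φ : (Fin n → ℂ) → (Fin n → ℂ)} (hφ : AnalyticAt ℂ φ x) (hx : φ x = x)
    (h : ∀ᶠ t in 𝓝 x, φ t = t) (r : Stalk x) : pull φ hφ hx r = r := by
  obtain ⟨F, hF, rfl⟩ := exists_germ_eq r
  rw [pull_germ hφ hx hF]
  refine (germ_congr hF ?_).symm
  filter_upwards [h] with t ht
  rw [ht]

theorem analyticAt_partial {F : (Fin n → ℂ) → ℂ} (hF : AnalyticAt ℂ F x) (i : Fin n) :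
    AnalyticAt ℂ (fun y => fderiv ℂ F y (Pi.single i 1)) x :=
  (ContinuousLinearMap.analyticAt
    (ContinuousLinearMap.apply ℂ ℂ (Pi.single i 1 : Fin n → ℂ)) _).comp hF.fderiv

theorem coordField_germ {F : (Fin n → ℂ) → ℂ} (hF : AnalyticAt ℂ F x) (i : Fin n) :
    coordField x i (germ F x) = germ (fun y => fderiv ℂ F y (Pi.single i 1)) x := by
  rw [germ_eq hF, germ_eq (analyticAt_partial hF i)]
  rfl

theorem coordField_coord (i j : Fin n) : coordField x i (coord x j) = if i = j then 1 else 0 := by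
  rw [coord, coordField_germ (analyticAt_coord x j (x j))]
  have : (fun y => fderiv ℂ (fun y : Fin n → ℂ => y j - x j) y (Pi.single i 1)) =
      fun _ => if i = j then 1 else 0 := by
    funext y
    rw [fderiv_sub_const]
    have : HasFDerivAt (fun y : Fin n → ℂ => y j)
      (ContinuousLinearMap.proj (R := ℂ) (φ := fun _ : Fin n => ℂ) j) y :=
      (ContinuousLinearMap.proj (R := ℂ) (φ := fun _ : Fin n => ℂ) j).hasFDerivAt
    rw [this.fderiv]
    simp [Pi.single_apply, eq_comm]
  rw [this, germ_const]
  split_ifs <;> simp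

end Germs

/-! ### Convergent power series -/

section Series

open scoped ENNReal NNReal

variable {n : ℕ}

/-- The weight `∏ ρᵢ ^ αᵢ` of a multi-index. -/
def weight (ρ : Fin n → ℝ≥0) (α : Fin n →₀ ℕ) : ℝ≥0∞ := ∏ i, (ρ i : ℝ≥0∞) ^ α i

theorem weight_add (ρ : Fin n → ℝ≥0) (α β : Fin n →₀ ℕ) :
    weight ρ (α + β) = weight ρ α * weight ρ β := by
  simp [weight, pow_add, Finset.prod_mul_distrib]

theorem weight_ne_top (ρ : Fin n → ℝ≥0) (α : Fin n →₀ ℕ) : weight ρ α ≠ ∞ :=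
  ENNReal.prod_ne_top fun _ _ => ENNReal.pow_ne_top ENNReal.coe_ne_top

theorem weight_ne_zero {ρ : Fin n → ℝ≥0} (hρ : ∀ i, 0 < ρ i) (α : Fin n →₀ ℕ) :
    weight ρ α ≠ 0 :=
  Finset.prod_ne_zero_iff.2 fun i _ => pow_ne_zero _ (by simpa using (hρ i).ne')

theorem weight_mono {ρ ρ' : Fin n → ℝ≥0} (h : ∀ i, ρ i ≤ ρ' i) (α : Fin n →₀ ℕ) :
    weight ρ α ≤ weight ρ' α :=
  Finset.prod_le_prod' fun i _ => pow_le_pow_left' (ENNReal.coe_le_coe.2 (h i)) _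

/-- The weighted `ℓ¹`-norm `∑ |a_α| ρ ^ α` of a power series. -/
def seriesNorm (ρ : Fin n → ℝ≥0) (a : MvPowerSeries (Fin n) ℂ) : ℝ≥0∞ :=
  ∑' α, ‖MvPowerSeries.coeff α a‖ₑ * weight ρ α

theorem coeff_le_seriesNorm (ρ : Fin n → ℝ≥0) (a : MvPowerSeries (Fin n) ℂ) (α : Fin n →₀ ℕ) :
    ‖MvPowerSeries.coeff α a‖ₑ * weight ρ α ≤ seriesNorm ρ a :=
  ENNReal.le_tsum (f := fun α => ‖MvPowerSeries.coeff α a‖ₑ * weight ρ α) α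

theorem seriesNorm_add_le (ρ : Fin n → ℝ≥0) (a b : MvPowerSeries (Fin n) ℂ) :
    seriesNorm ρ (a + b) ≤ seriesNorm ρ a + seriesNorm ρ b := by
  rw [seriesNorm, seriesNorm, seriesNorm, ← ENNReal.tsum_add]
  refine ENNReal.tsum_le_tsum fun α => ?_
  rw [← add_mul, map_add]
  gcongr
  exact enorm_add_le _ _

theorem seriesNorm_neg (ρ : Fin n → ℝ≥0) (a : MvPowerSeries (Fin n) ℂ) :
    seriesNorm ρ (-a) = seriesNorm ρ a := by
  simp [seriesNorm]

theorem seriesNorm_mul_le (ρ : Fin n → ℝ≥0) (a b : MvPowerSeries (Fin n) ℂ) :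
    seriesNorm ρ (a * b) ≤ seriesNorm ρ a * seriesNorm ρ b := by
  classical
  have h1 : seriesNorm ρ a * seriesNorm ρ b = ∑' z : (Fin n →₀ ℕ) × (Fin n →₀ ℕ),
      (‖MvPowerSeries.coeff z.1 a‖ₑ * weight ρ z.1) *
        (‖MvPowerSeries.coeff z.2 b‖ₑ * weight ρ z.2) := by
    rw [ENNReal.tsum_prod', seriesNorm, ← ENNReal.tsum_mul_right]
    refine tsum_congr fun α => ?_
    exact ENNReal.tsum_mul_left.symm
  rw [h1, ← Finset.HasAntidiagonal.sigmaAntidiagonalEquivProd.tsum_eq, ENNReal.tsum_sigma']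
  refine ENNReal.tsum_le_tsum fun α => ?_
  rw [MvPowerSeries.coeff_mul, tsum_fintype, Finset.univ_eq_attach]
  refine le_trans ?_ (Finset.sum_attach (Finset.HasAntidiagonal.antidiagonal α) (fun z =>
      (‖MvPowerSeries.coeff z.1 a‖ₑ * weight ρ z.1) *
        (‖MvPowerSeries.coeff z.2 b‖ₑ * weight ρ z.2))).ge
  refine (mul_le_mul_left (enorm_sum_le _ _) _).trans ?_
  rw [Finset.sum_mul]
  refine Finset.sum_le_sum fun z hz => ?_
  rw [← Finset.HasAntidiagonal.mem_antidiagonal.1 hz, weight_add, enorm_mul]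
  exact le_of_eq (by ring)

theorem seriesNorm_C_mul (ρ : Fin n → ℝ≥0) (c : ℂ) (a : MvPowerSeries (Fin n) ℂ) :
    seriesNorm ρ (MvPowerSeries.C c * a) = ‖c‖ₑ * seriesNorm ρ a := by
  rw [seriesNorm, seriesNorm, ← ENNReal.tsum_mul_left]
  refine tsum_congr fun α => ?_
  rw [MvPowerSeries.coeff_C_mul, enorm_mul, mul_assoc]

/-- If all the monomials of a series shrink by the factor `s` under a change of weights, then so
does its norm. -/
theorem seriesNorm_le_mul {ρ ρ' : Fin n → ℝ≥0} {s : ℝ≥0∞} {a : MvPowerSeries (Fin n) ℂ}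
    (h : ∀ α, MvPowerSeries.coeff α a ≠ 0 → weight ρ' α ≤ s * weight ρ α) :
    seriesNorm ρ' a ≤ s * seriesNorm ρ a := by
  rw [seriesNorm, seriesNorm, ← ENNReal.tsum_mul_left]
  refine ENNReal.tsum_le_tsum fun α => ?_
  by_cases h0 : MvPowerSeries.coeff α a = 0
  · simp [h0]
  · rw [mul_left_comm]
    gcongr
    exact h α h0

theorem seriesNorm_mono {ρ ρ' : Fin n → ℝ≥0} (h : ∀ i, ρ' i ≤ ρ i)
    (a : MvPowerSeries (Fin n) ℂ) : seriesNorm ρ' a ≤ seriesNorm ρ a := by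
  simpa using seriesNorm_le_mul (s := 1) (ρ := ρ) (ρ' := ρ') (a := a) fun α _ => by
    simpa using weight_mono h α

/-- A power series is convergent if its norm is finite for some positive polyradius. -/
def Convergent (a : MvPowerSeries (Fin n) ℂ) : Prop :=
  ∃ ρ : Fin n → ℝ≥0, (∀ i, 0 < ρ i) ∧ seriesNorm ρ a ≠ ∞

/-- The power series `a` converges to the function `F` near `0`. -/
def Represents (a : MvPowerSeries (Fin n) ℂ) (F : (Fin n → ℂ) → ℂ) : Prop :=
  ∀ᶠ x in 𝓝 (0 : Fin n → ℂ), HasSum (fun α => MvPowerSeries.coeff α a * ∏ i, x i ^ α i) (F x)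

theorem Represents.mul {a b : MvPowerSeries (Fin n) ℂ} {F G : (Fin n → ℂ) → ℂ}
    (ha : Represents a F) (hb : Represents b G) : Represents (a * b) (fun x => F x * G x) := by
  classical
  filter_upwards [ha, hb] with x hx hy
  set u : (Fin n →₀ ℕ) → ℂ := fun α => MvPowerSeries.coeff α a * ∏ i, x i ^ α i with hu
  set v : (Fin n →₀ ℕ) → ℂ := fun α => MvPowerSeries.coeff α b * ∏ i, x i ^ α i with hv
  have hs : Summable fun z : (Fin n →₀ ℕ) × (Fin n →₀ ℕ) => u z.1 * v z.2 :=
    summable_mul_of_summable_norm hx.summable.norm hy.summable.norm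
  have h1 := hx.summable.tsum_mul_tsum_eq_tsum_sum_antidiagonal hy.summable hs
  have h2 := summable_sum_mul_antidiagonal_of_summable_mul hs
  rw [hx.tsum_eq, hy.tsum_eq] at h1
  rw [h1]
  refine h2.hasSum.congr_fun fun α => ?_
  rw [MvPowerSeries.coeff_mul, Finset.sum_mul]
  refine Finset.sum_congr rfl fun z hz => ?_
  rw [← Finset.HasAntidiagonal.mem_antidiagonal.1 hz]
  simp only [hu, hv, Finsupp.add_apply, pow_add, Finset.prod_mul_distrib]
  ring

theorem Represents.add {a b : MvPowerSeries (Fin n) ℂ} {F G : (Fin n → ℂ) → ℂ}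
    (ha : Represents a F) (hb : Represents b G) : Represents (a + b) (fun x => F x + G x) := by
  filter_upwards [ha, hb] with x hx hy
  simpa [add_mul] using hx.add hy

/-! ### Words and monomials -/

/-- The multi-index counting the letters of a word. -/
def content (w : Σ k, Fin k → Fin n) : Fin n →₀ ℕ := ∑ j, Finsupp.single (w.2 j) 1

theorem prod_pow_content {M : Type*} [CommMonoid M] (w : Σ k, Fin k → Fin n) (x : Fin n → M) :
    ∏ i, x i ^ content w i = ∏ j, x (w.2 j) := by
  simp only [content, Finsupp.finsetSum_apply]
  simp_rw [← Finset.prod_pow_eq_pow_sum]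
  rw [Finset.prod_comm]
  refine Finset.prod_congr rfl fun j _ => ?_
  rw [Finset.prod_eq_single (w.2 j)]
  · simp
  · intro b _ hb
    rw [Finsupp.single_eq_of_ne hb, pow_zero]
  · simp

theorem content_surjective : Function.Surjective (content (n := n)) := by
  intro α
  induction α using Finsupp.induction_linear with
  | zero => exact ⟨⟨0, Fin.elim0⟩, by simp [content]⟩
  | add a b ha hb =>
    obtain ⟨⟨k, w⟩, rfl⟩ := ha
    obtain ⟨⟨l, v⟩, rfl⟩ := hb
    exact ⟨⟨k + l, Fin.append w v⟩, by simp [content, Fin.sum_univ_add]⟩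
  | single i k =>
    exact ⟨⟨k, fun _ => i⟩, by simp [content, Finsupp.smul_single]⟩

/-- The formal multilinear series of a family of coefficients indexed by words. -/
def wordSeries (b : (Σ k, Fin k → Fin n) → ℂ) : FormalMultilinearSeries ℂ (Fin n → ℂ) ℂ := fun k =>
  ∑ w : Fin k → Fin n, b ⟨k, w⟩ •
    (ContinuousMultilinearMap.mkPiAlgebra ℂ (Fin k) ℂ).compContinuousLinearMap
      fun j => ContinuousLinearMap.proj (R := ℂ) (φ := fun _ : Fin n => ℂ) (w j)

theorem wordSeries_apply (b : (Σ k, Fin k → Fin n) → ℂ) (k : ℕ) (x : Fin n → ℂ) :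
    wordSeries b k (fun _ => x) = ∑ w : Fin k → Fin n, b ⟨k, w⟩ * ∏ j, x (w j) := by
  simp [wordSeries]

theorem norm_wordSeries_le (b : (Σ k, Fin k → Fin n) → ℂ) (k : ℕ) :
    ‖wordSeries b k‖ ≤ ∑ w : Fin k → Fin n, ‖b ⟨k, w⟩‖ := by
  refine ContinuousMultilinearMap.opNorm_le_bound (by positivity) fun v => ?_
  simp only [wordSeries, _root_.sum_apply, _root_.smul_apply,
    ContinuousMultilinearMap.compContinuousLinearMap_apply,
    ContinuousMultilinearMap.mkPiAlgebra_apply, ContinuousLinearMap.proj_apply]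
  refine (norm_sum_le _ _).trans ?_
  rw [Finset.sum_mul]
  refine Finset.sum_le_sum fun w _ => ?_
  rw [norm_smul, norm_prod]
  gcongr with j
  exact norm_le_pi_norm _ _

/-- A family of coefficients indexed by words, of at most exponential growth, sums to an analytic
function. -/
theorem exists_analyticAt_of_words (b : (Σ k, Fin k → Fin n) → ℂ) {r : ℝ≥0} (hr : 0 < r)
    (hb : ∑' w, ‖b w‖ₑ * (r : ℝ≥0∞) ^ w.1 ≠ ∞) :
    ∃ F : (Fin n → ℂ) → ℂ, AnalyticAt ℂ F 0 ∧
      ∀ᶠ x in 𝓝 (0 : Fin n → ℂ), HasSum (fun w => b w * ∏ j, x (w.2 j)) (F x) := by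
  set p := wordSeries b with hp
  have hsum : Summable fun w => ‖b w‖ * (r : ℝ) ^ w.1 := by
    have h := ENNReal.summable_toReal hb
    simpa using h
  have hrad : (r : ℝ≥0∞) ≤ p.radius := by
    refine p.le_radius_of_summable (Summable.of_nonneg_of_le (fun k => by positivity)
      (fun k => ?_) hsum.sigma)
    rw [tsum_fintype]
    refine (mul_le_mul_of_nonneg_right (norm_wordSeries_le b k) (by positivity)).trans ?_
    rw [Finset.sum_mul]
  have hpos : 0 < p.radius := lt_of_lt_of_le (by simpa using hr) hrad
  have hF := p.hasFPowerSeriesOnBall hpos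
  refine ⟨p.sum, hF.analyticAt, ?_⟩
  filter_upwards [Metric.ball_mem_nhds (0 : Fin n → ℂ) (NNReal.coe_pos.2 hr)] with x hx
  have hx' : ‖x‖ < r := by simpa using hx
  have hs : Summable fun w : Σ k, Fin k → Fin n => b w * ∏ j, x (w.2 j) := by
    refine Summable.of_norm_bounded hsum fun w => ?_
    rw [norm_mul, norm_prod]
    gcongr
    calc ∏ j, ‖x (w.2 j)‖ ≤ ∏ _j : Fin w.1, (r : ℝ) :=
          Finset.prod_le_prod (fun _ _ => norm_nonneg _) fun j _ =>
            (norm_le_pi_norm x _).trans hx'.le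
      _ = r ^ w.1 := by simp
  have h1 := hs.hasSum.sigma fun k => hasSum_fintype _
  have h2 := hF.hasSum (y := x) (by
    refine Metric.eball_subset_eball hrad ?_
    rw [Metric.mem_eball, edist_zero_right, enorm_eq_nnnorm]
    exact_mod_cast hx')
  rw [zero_add] at h2
  have h3 : p.sum x = ∑' w : Σ k, Fin k → Fin n, b w * ∏ j, x (w.2 j) := by
    refine h2.unique (h1.congr_fun fun k => ?_)
    rw [hp, wordSeries_apply]
  rw [h3]
  exact hs.hasSum

/-- Choosing one word for every monomial turns the power series into a formal multilinear series
with positive radius of convergence, whose sum is analytic. -/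
theorem Convergent.exists_represents {a : MvPowerSeries (Fin n) ℂ} (ha : Convergent a) :
    ∃ F : (Fin n → ℂ) → ℂ, AnalyticAt ℂ F 0 ∧ Represents a F := by
  classical
  obtain ⟨ρ, hρ, hfin⟩ := ha
  obtain ⟨r, hr, hrρ⟩ : ∃ r : ℝ≥0, 0 < r ∧ ∀ i, r ≤ ρ i := by
    rcases isEmpty_or_nonempty (Fin n) with h | h
    · exact ⟨1, one_pos, fun i => h.elim i⟩
    · exact ⟨Finset.univ.inf' Finset.univ_nonempty ρ, by simpa using hρ,
        fun i => Finset.inf'_le _ (Finset.mem_univ i)⟩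
  have hW : Function.RightInverse (Function.surjInv content_surjective) (content (n := n)) :=
    Function.rightInverse_surjInv content_surjective
  set W := Function.surjInv (content_surjective (n := n))
  have hWinj : Function.Injective W := hW.injective
  set b : (Σ k, Fin k → Fin n) → ℂ := fun w =>
    if W (content w) = w then MvPowerSeries.coeff (content w) a else 0 with hb
  have hbW : ∀ α, b (W α) = MvPowerSeries.coeff α a := fun α => by simp [hb, hW α]
  have hb0 : ∀ w, w ∉ Set.range W → b w = 0 := fun w hw => by
    simp only [hb, ite_eq_right_iff]
    exact fun h => (hw ⟨_, h⟩).elim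
  have hwt : ∀ w : Σ k, Fin k → Fin n, weight (fun _ => r) (content w) = (r : ℝ≥0∞) ^ w.1 :=
    fun w => by rw [weight, prod_pow_content w fun _ => (r : ℝ≥0∞)]; simp
  obtain ⟨F, hF, hs⟩ := exists_analyticAt_of_words b hr (by
    have : ∑' w, ‖b w‖ₑ * (r : ℝ≥0∞) ^ w.1 = seriesNorm (fun _ => r) a := by
      rw [seriesNorm, ← hWinj.tsum_eq]
      · refine tsum_congr fun α => ?_
        rw [hbW, ← hwt, hW α]
      · intro w hw
        by_contra h
        exact hw (by simp [hb0 w h])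
    rw [this]
    exact ne_top_of_le_ne_top hfin (seriesNorm_mono hrρ a))
  refine ⟨F, hF, ?_⟩
  filter_upwards [hs] with x hx
  rw [← hWinj.hasSum_iff fun w hw => by simp [hb0 w hw]] at hx
  refine hx.congr_fun fun α => ?_
  rw [Function.comp_apply, hbW, ← prod_pow_content, hW α]

/-- The coefficient of a monomial is the sum of the values of the multilinear coefficients over all
words with that content. There are `n ^ k` words of length `k`; the radius `s / (n + 1)`
compensates for their number. -/
theorem exists_convergent_represents {F : (Fin n → ℂ) → ℂ} (hF : AnalyticAt ℂ F 0) :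
    ∃ a : MvPowerSeries (Fin n) ℂ, Convergent a ∧ Represents a F := by
  classical
  obtain ⟨p, R, hp⟩ := hF
  obtain ⟨s, hs0, hs⟩ : ∃ s : ℝ≥0, 0 < s ∧ (s : ℝ≥0∞) < p.radius := by
    obtain ⟨s, h1, h2⟩ := ENNReal.lt_iff_exists_nnreal_btwn.1 (hp.r_pos.trans_le hp.r_le)
    exact ⟨s, by simpa using h1, h2⟩
  set r : ℝ≥0 := s / (n + 1) with hr
  have hr0 : 0 < r := by positivity
  set c : (Σ k, Fin k → Fin n) → ℂ := fun w => p w.1 fun j => Pi.single (w.2 j) 1 with hc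
  have hcn : ∀ w, ‖c w‖ₑ ≤ ‖p w.1‖ₑ := fun w => by
    have := (p w.1).le_opNorm fun j => Pi.single (w.2 j) (1 : ℂ)
    simp only [Pi.norm_single, norm_one, Finset.prod_const_one, mul_one] at this
    exact enorm_le_iff_norm_le.2 this
  have hcsum : ∑' w, ‖c w‖ₑ * (r : ℝ≥0∞) ^ w.1 ≠ ∞ := by
    have h1 : ∑' k, ‖p k‖ₑ * (s : ℝ≥0∞) ^ k ≠ ∞ := by
      have := (p.summable_nnnorm_mul_pow hs)
      have h2 := ENNReal.tsum_coe_ne_top_iff_summable.2 this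
      simpa [enorm_eq_nnnorm] using h2
    refine ne_top_of_le_ne_top h1 ?_
    rw [ENNReal.tsum_sigma']
    refine ENNReal.tsum_le_tsum fun k => ?_
    rw [tsum_fintype]
    calc ∑ w : Fin k → Fin n, ‖c ⟨k, w⟩‖ₑ * (r : ℝ≥0∞) ^ k
        ≤ ∑ _w : Fin k → Fin n, ‖p k‖ₑ * (r : ℝ≥0∞) ^ k := by
          gcongr with w
          exact hcn ⟨k, w⟩
      _ = ‖p k‖ₑ * (n * r : ℝ≥0∞) ^ k := by
          simp [mul_pow]; ring
      _ ≤ ‖p k‖ₑ * (s : ℝ≥0∞) ^ k := by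
          gcongr
          have : (n : ℝ≥0) * r ≤ s := by
            rw [hr, mul_div_assoc', div_le_iff₀ (by positivity), mul_comm]
            gcongr
            exact le_add_of_nonneg_right zero_le_one
          exact_mod_cast this
  have hcs : Summable fun w => ‖c w‖ * (r : ℝ) ^ w.1 := by
    have h := ENNReal.summable_toReal hcsum
    simpa using h
  set a : MvPowerSeries (Fin n) ℂ := fun α => ∑' w : {w // content w = α}, c w with ha
  have hcoeff : ∀ α, MvPowerSeries.coeff α a = ∑' w : {w // content w = α}, c w := fun _ => rfl
  have hwt : ∀ w : Σ k, Fin k → Fin n, weight (fun _ => r) (content w) = (r : ℝ≥0∞) ^ w.1 :=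
    fun w => by rw [weight, prod_pow_content w fun _ => (r : ℝ≥0∞)]; simp
  refine ⟨a, ⟨fun _ => r, fun _ => hr0, ne_top_of_le_ne_top hcsum ?_⟩, ?_⟩
  · rw [← (Equiv.sigmaFiberEquiv (content (n := n))).tsum_eq, ENNReal.tsum_sigma']
    refine ENNReal.tsum_le_tsum fun α => ?_
    rw [hcoeff]
    refine (mul_le_mul_left enorm_tsum_le_tsum_enorm _).trans ?_
    rw [← ENNReal.tsum_mul_right]
    refine ENNReal.tsum_le_tsum fun w => ?_
    simp only [Equiv.sigmaFiberEquiv, Equiv.coe_fn_mk]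
    rw [← hwt, w.2]
  · filter_upwards [Metric.ball_mem_nhds (0 : Fin n → ℂ) (NNReal.coe_pos.2 hr0),
      Metric.eball_mem_nhds (0 : Fin n → ℂ) hp.r_pos] with x hx hxR
    have hx' : ‖x‖ < r := by simpa using hx
    have hsm : Summable fun w : Σ k, Fin k → Fin n => c w * ∏ j, x (w.2 j) := by
      refine Summable.of_norm_bounded hcs fun w => ?_
      rw [norm_mul, norm_prod]
      gcongr
      calc ∏ j, ‖x (w.2 j)‖ ≤ ∏ _j : Fin w.1, (r : ℝ) :=
            Finset.prod_le_prod (fun _ _ => norm_nonneg _) fun j _ =>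
              (norm_le_pi_norm x _).trans hx'.le
        _ = r ^ w.1 := by simp
    have h1 := hsm.hasSum.sigma fun k => hasSum_fintype _
    have h2 := hp.hasSum hxR
    rw [zero_add] at h2
    have h3 : F x = ∑' w : Σ k, Fin k → Fin n, c w * ∏ j, x (w.2 j) := by
      refine h2.unique (h1.congr_fun fun k => ?_)
      have hx0 : x = ∑ i, x i • (Pi.single i (1 : ℂ) : Fin n → ℂ) := pi_eq_sum_univ' x
      conv_lhs => rw [hx0]
      rw [ContinuousMultilinearMap.map_sum]
      refine Finset.sum_congr rfl fun w _ => ?_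
      rw [ContinuousMultilinearMap.map_smul_univ, smul_eq_mul, mul_comm]
    rw [h3]
    have h4 : HasSum (fun w => c w * ∏ j, x (w.2 j)) _ := hsm.hasSum
    rw [← (Equiv.sigmaFiberEquiv (content (n := n))).hasSum_iff] at h4
    have h5 := h4.sigma fun α => (h4.summable.sigma_factor α).hasSum
    refine h5.congr_fun fun α => ?_
    rw [hcoeff, ← tsum_mul_right]
    refine tsum_congr fun w => ?_
    simp only [Function.comp_apply, Equiv.sigmaFiberEquiv, Equiv.coe_fn_mk]
    rw [← prod_pow_content, w.2]

end Series

/-! ### Weierstrass division -/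

section Division

open scoped ENNReal NNReal

variable {n : ℕ}

/-- The quotient of a power series by `X₀ ^ d`. -/
def quoX (d : ℕ) (a : MvPowerSeries (Fin (n + 1)) ℂ) : MvPowerSeries (Fin (n + 1)) ℂ :=
  fun α => MvPowerSeries.coeff (α + Finsupp.single 0 d) a

/-- The part of degree less than `d` in `X₀` of a power series. -/
def remX (d : ℕ) (a : MvPowerSeries (Fin (n + 1)) ℂ) : MvPowerSeries (Fin (n + 1)) ℂ :=
  fun α => if α 0 < d then MvPowerSeries.coeff α a else 0

theorem coeff_quoX (d : ℕ) (a : MvPowerSeries (Fin (n + 1)) ℂ) (α : Fin (n + 1) →₀ ℕ) :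
    MvPowerSeries.coeff α (quoX d a) = MvPowerSeries.coeff (α + Finsupp.single 0 d) a := rfl

theorem coeff_remX (d : ℕ) (a : MvPowerSeries (Fin (n + 1)) ℂ) (α : Fin (n + 1) →₀ ℕ) :
    MvPowerSeries.coeff α (remX d a) = if α 0 < d then MvPowerSeries.coeff α a else 0 := rfl

theorem X_pow_mul_quoX_add_remX (d : ℕ) (a : MvPowerSeries (Fin (n + 1)) ℂ) :
    MvPowerSeries.monomial (Finsupp.single 0 d) 1 * quoX d a + remX d a = a := by
  classical
  ext α
  rw [map_add, MvPowerSeries.coeff_monomial_mul, one_mul, coeff_quoX, coeff_remX]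
  have h : Finsupp.single 0 d ≤ α ↔ ¬ α 0 < d := by
    rw [Finsupp.single_le_iff, not_lt]
  by_cases h' : α 0 < d
  · rw [if_neg (by rw [h]; exact not_not.2 h'), if_pos h', zero_add]
  · rw [if_pos (h.2 h'), if_neg h', add_zero, tsub_add_cancel_of_le (h.2 h')]

theorem weight_single (ρ : Fin (n + 1) → ℝ≥0) (d : ℕ) :
    weight ρ (Finsupp.single 0 d) = (ρ 0 : ℝ≥0∞) ^ d := by
  rw [weight, Finset.prod_eq_single 0]
  · simp
  · intro b _ hb
    rw [Finsupp.single_eq_of_ne hb, pow_zero]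
  · simp

theorem seriesNorm_quoX_mul_le (ρ : Fin (n + 1) → ℝ≥0) (d : ℕ)
    (a : MvPowerSeries (Fin (n + 1)) ℂ) :
    seriesNorm ρ (quoX d a) * (ρ 0 : ℝ≥0∞) ^ d ≤ seriesNorm ρ a := by
  rw [seriesNorm, ← ENNReal.tsum_mul_right, ← weight_single]
  refine le_trans (le_of_eq (tsum_congr fun α => ?_))
    (ENNReal.tsum_comp_le_tsum_of_injective (add_left_injective (Finsupp.single 0 d))
      fun α => ‖MvPowerSeries.coeff α a‖ₑ * weight ρ α)
  rw [coeff_quoX, mul_assoc, ← weight_add]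

theorem seriesNorm_remX_le (ρ : Fin (n + 1) → ℝ≥0) (d : ℕ)
    (a : MvPowerSeries (Fin (n + 1)) ℂ) : seriesNorm ρ (remX d a) ≤ seriesNorm ρ a := by
  refine ENNReal.tsum_le_tsum fun α => ?_
  rw [coeff_remX]
  split_ifs <;> simp

/-- The equation `G + quoX d G * k = g` has a convergent solution if `k` is small: the
alternating iterates of `g ↦ quoX d g * k` form a geometrically convergent series. -/
theorem exists_add_quoX_mul_eq {ρ : Fin (n + 1) → ℝ≥0} (hρ : ∀ i, 0 < ρ i) {d : ℕ}
    {k g : MvPowerSeries (Fin (n + 1)) ℂ} (hk : seriesNorm ρ k ≤ 2⁻¹ * (ρ 0 : ℝ≥0∞) ^ d)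
    (hg : seriesNorm ρ g ≠ ∞) :
    ∃ G : MvPowerSeries (Fin (n + 1)) ℂ, seriesNorm ρ G ≠ ∞ ∧ G + quoX d G * k = g := by
  classical
  set t : ℕ → MvPowerSeries (Fin (n + 1)) ℂ := fun i => (fun a => -(quoX d a * k))^[i] g with ht
  have ht0 : t 0 = g := rfl
  have hts : ∀ i, t (i + 1) = -(quoX d (t i) * k) := fun i => by
    simp only [ht, Function.iterate_succ_apply']
  have hstep : ∀ a, seriesNorm ρ (-(quoX d a * k)) ≤ 2⁻¹ * seriesNorm ρ a := fun a => by
    rw [seriesNorm_neg]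
    calc seriesNorm ρ (quoX d a * k) ≤ seriesNorm ρ (quoX d a) * seriesNorm ρ k :=
          seriesNorm_mul_le _ _ _
      _ ≤ seriesNorm ρ (quoX d a) * (2⁻¹ * (ρ 0 : ℝ≥0∞) ^ d) := by gcongr
      _ = 2⁻¹ * (seriesNorm ρ (quoX d a) * (ρ 0 : ℝ≥0∞) ^ d) := by ring
      _ ≤ 2⁻¹ * seriesNorm ρ a := by gcongr; exact seriesNorm_quoX_mul_le _ _ _
  have hnorm : ∀ i, seriesNorm ρ (t i) ≤ 2⁻¹ ^ i * seriesNorm ρ g := by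
    intro i
    induction i with
    | zero => simp [ht0]
    | succ i ih =>
      rw [hts, pow_succ', mul_assoc]
      exact (hstep _).trans (by gcongr)
  have hsum : ∑' i, seriesNorm ρ (t i) ≠ ∞ := by
    refine ne_top_of_le_ne_top ?_ (ENNReal.tsum_le_tsum hnorm)
    rw [ENNReal.tsum_mul_right, ENNReal.tsum_geometric]
    refine ENNReal.mul_ne_top ?_ hg
    simp
  have hcoeff : ∀ α, Summable fun i => MvPowerSeries.coeff α (t i) := fun α => by
    have h1 : ∑' i, ‖MvPowerSeries.coeff α (t i)‖ₑ * weight ρ α ≠ ∞ :=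
      ne_top_of_le_ne_top hsum (ENNReal.tsum_le_tsum fun i => coeff_le_seriesNorm ρ (t i) α)
    rw [ENNReal.tsum_mul_right] at h1
    have h2 : ∑' i, ‖MvPowerSeries.coeff α (t i)‖ₑ ≠ ∞ := fun h => by
      rw [h, ENNReal.top_mul (weight_ne_zero hρ α)] at h1
      exact h1 rfl
    refine Summable.of_norm ?_
    have h3 := ENNReal.summable_toReal h2
    simpa using h3
  set G : MvPowerSeries (Fin (n + 1)) ℂ := fun α => ∑' i, MvPowerSeries.coeff α (t i) with hG
  have hGc : ∀ α, MvPowerSeries.coeff α G = ∑' i, MvPowerSeries.coeff α (t i) := fun _ => rfl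
  refine ⟨G, ne_top_of_le_ne_top hsum ?_, ?_⟩
  · calc seriesNorm ρ G ≤ ∑' α, ∑' i, ‖MvPowerSeries.coeff α (t i)‖ₑ * weight ρ α := by
          refine ENNReal.tsum_le_tsum fun α => ?_
          rw [ENNReal.tsum_mul_right, hGc]
          gcongr
          exact enorm_tsum_le_tsum_enorm
      _ = ∑' i, seriesNorm ρ (t i) := ENNReal.tsum_comm
  · ext α
    rw [map_add, MvPowerSeries.coeff_mul]
    have h1 : ∑ p ∈ Finset.HasAntidiagonal.antidiagonal α,
        MvPowerSeries.coeff p.1 (quoX d G) * MvPowerSeries.coeff p.2 k =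
        ∑' i, MvPowerSeries.coeff α (quoX d (t i) * k) := by
      simp only [MvPowerSeries.coeff_mul, coeff_quoX, hGc]
      rw [Summable.tsum_finsetSum fun p _ => (hcoeff _).mul_right _]
      simp only [tsum_mul_right]
    rw [h1, hGc, (hcoeff α).tsum_eq_zero_add, ht0]
    simp only [hts, map_neg, tsum_neg]
    ring

/-- Weierstrass division by a convergent series `h` that is regular of order `d` in `X₀`: with
`c * h = X₀ ^ d + k`, the series `k` is small for a suitable polyradius, which is chosen first in
the direction of `X₀` and then in the other directions. -/
theorem weierstrass_division {h g : MvPowerSeries (Fin (n + 1)) ℂ} (hh : Convergent h)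
    (hg : Convergent g) {d : ℕ} (hd : MvPowerSeries.coeff (Finsupp.single 0 d) h ≠ 0)
    (hlt : ∀ j < d, MvPowerSeries.coeff (Finsupp.single 0 j) h = 0) :
    ∃ q r : MvPowerSeries (Fin (n + 1)) ℂ, Convergent q ∧ Convergent r ∧ g = q * h + r ∧
      ∀ α, d ≤ α 0 → MvPowerSeries.coeff α r = 0 := by
  classical
  obtain ⟨ρh, hρh, hh⟩ := hh
  obtain ⟨ρg, hρg, hg⟩ := hg
  set c : ℂ := (MvPowerSeries.coeff (Finsupp.single 0 d) h)⁻¹ with hc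
  set u : MvPowerSeries (Fin (n + 1)) ℂ := MvPowerSeries.C c * quoX d h - 1 with hu
  set v : MvPowerSeries (Fin (n + 1)) ℂ := MvPowerSeries.C c * remX d h with hv
  have hu0 : MvPowerSeries.coeff 0 u = 0 := by
    rw [hu, map_sub, MvPowerSeries.coeff_C_mul, coeff_quoX, zero_add, hc, inv_mul_cancel₀ hd,
      MvPowerSeries.coeff_zero_one, sub_self]
  have hv0 : ∀ α : Fin (n + 1) →₀ ℕ, MvPowerSeries.coeff α v ≠ 0 → ∃ i : Fin n, α i.succ ≠ 0 := by
    intro α hα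
    by_contra! hcon
    have hαs : α = Finsupp.single 0 (α 0) := by
      ext i
      refine Fin.cases ?_ (fun i => ?_) i
      · simp
      · rw [hcon i, Finsupp.single_eq_of_ne (Fin.succ_ne_zero i)]
    rw [hv, MvPowerSeries.coeff_C_mul, coeff_remX] at hα
    split_ifs at hα with hlt'
    · rw [hαs, hlt _ hlt', mul_zero] at hα
      exact hα rfl
    · exact hα (mul_zero _)
  have hch : MvPowerSeries.C c * h =
      MvPowerSeries.monomial (Finsupp.single 0 d) 1 + (MvPowerSeries.monomial (Finsupp.single 0 d) 1 * u + v) := by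
    conv_lhs => rw [← X_pow_mul_quoX_add_remX d h]
    rw [hu, hv]
    ring
  set ρ₁ : Fin (n + 1) → ℝ≥0 := fun i => min (ρh i) (ρg i) with hρ₁
  have hρ₁pos : ∀ i, 0 < ρ₁ i := fun i => lt_min (hρh i) (hρg i)
  have hh₁ : seriesNorm ρ₁ h ≠ ∞ :=
    ne_top_of_le_ne_top hh (seriesNorm_mono (fun i => min_le_left _ _) h)
  have hg₁ : seriesNorm ρ₁ g ≠ ∞ :=
    ne_top_of_le_ne_top hg (seriesNorm_mono (fun i => min_le_right _ _) g)
  have hu₁ : seriesNorm ρ₁ u ≠ ∞ := by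
    have h1 : seriesNorm ρ₁ (quoX d h) ≠ ∞ := by
      intro h2
      have h3 := seriesNorm_quoX_mul_le ρ₁ d h
      rw [h2, ENNReal.top_mul (pow_ne_zero _ (by simpa using (hρ₁pos 0).ne'))] at h3
      exact hh₁ (top_le_iff.1 h3)
    have h4 : seriesNorm ρ₁ (1 : MvPowerSeries (Fin (n + 1)) ℂ) ≠ ∞ := by
      rw [seriesNorm, tsum_eq_single 0]
      · exact ENNReal.mul_ne_top (by simp) (weight_ne_top _ _)
      · intro α hα
        rw [MvPowerSeries.coeff_one, if_neg hα]
        simp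
    rw [hu, sub_eq_add_neg]
    refine ne_top_of_le_ne_top (ENNReal.add_ne_top.2 ⟨?_, ?_⟩) (seriesNorm_add_le _ _ _)
    · rw [seriesNorm_C_mul]
      exact ENNReal.mul_ne_top enorm_ne_top h1
    · rwa [seriesNorm_neg]
  -- a scaling factor that makes `u` small
  obtain ⟨s, hs0, hs1, hs⟩ : ∃ s : ℝ≥0, 0 < s ∧ s ≤ 1 ∧ s * seriesNorm ρ₁ u ≤ 4⁻¹ := by
    lift seriesNorm ρ₁ u to ℝ≥0 using hu₁ with N
    refine ⟨(4 * (N + 1))⁻¹, by positivity, ?_, ?_⟩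
    · exact inv_le_one_of_one_le₀ (by nlinarith [zero_le (a := N)])
    · have : (4 * (N + 1))⁻¹ * N ≤ (4 : ℝ≥0)⁻¹ := by
        rw [mul_inv, mul_assoc]
        refine mul_le_of_le_one_right (by positivity) ?_
        rw [inv_mul_le_iff₀ (by positivity)]
        simp
      calc (((4 * (N + 1))⁻¹ : ℝ≥0) : ℝ≥0∞) * N = (((4 * (N + 1))⁻¹ * N : ℝ≥0) : ℝ≥0∞) := by
            push_cast; rfl
        _ ≤ ((4 : ℝ≥0)⁻¹ : ℝ≥0) := by exact_mod_cast this
        _ = 4⁻¹ := by rw [ENNReal.coe_inv (by norm_num)]; rfl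
  set ρ₂ : Fin (n + 1) → ℝ≥0 := fun i => s * ρ₁ i with hρ₂
  have hρ₂pos : ∀ i, 0 < ρ₂ i := fun i => mul_pos hs0 (hρ₁pos i)
  have hρ₂le : ∀ i, ρ₂ i ≤ ρ₁ i := fun i => mul_le_of_le_one_left (zero_le) hs1
  have hu₂ : seriesNorm ρ₂ u ≤ 4⁻¹ := by
    refine le_trans (seriesNorm_le_mul fun α hα => ?_) hs
    obtain ⟨i, hi⟩ : ∃ i, α i ≠ 0 := by
      by_contra! hcon
      refine hα ?_
      rw [show α = 0 from Finsupp.ext hcon, hu0]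
    rw [weight, weight]
    simp only [hρ₂, ENNReal.coe_mul, mul_pow, Finset.prod_mul_distrib]
    gcongr
    have hle : ∀ j, (s : ℝ≥0∞) ^ α j ≤ 1 := fun j => pow_le_one' (by exact_mod_cast hs1) _
    calc ∏ j, (s : ℝ≥0∞) ^ α j ≤ (s : ℝ≥0∞) ^ α i := by
          rw [← Finset.mul_prod_erase _ _ (Finset.mem_univ i)]
          exact mul_le_of_le_one_right' (Finset.prod_le_one' fun j _ => hle j)
      _ ≤ s := (pow_le_pow_right_of_le_one' (by exact_mod_cast hs1)
          (Nat.one_le_iff_ne_zero.2 hi)).trans_eq (pow_one _)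
  have hv₂ : seriesNorm ρ₂ v ≠ ∞ := by
    rw [hv, seriesNorm_C_mul]
    exact ENNReal.mul_ne_top enorm_ne_top (ne_top_of_le_ne_top hh₁
      ((seriesNorm_remX_le _ _ _).trans (seriesNorm_mono hρ₂le h)))
  -- a second scaling, of the other variables only, that makes `v` small
  obtain ⟨t, ht0, ht1, ht⟩ : ∃ t : ℝ≥0, 0 < t ∧ t ≤ 1 ∧
      t * seriesNorm ρ₂ v ≤ 4⁻¹ * (ρ₂ 0 : ℝ≥0∞) ^ d := by
    lift seriesNorm ρ₂ v to ℝ≥0 using hv₂ with N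
    set e : ℝ≥0 := 4⁻¹ * ρ₂ 0 ^ d with he
    have he0 : 0 < e := by have := hρ₂pos 0; positivity
    refine ⟨min 1 (e / (N + 1)), lt_min one_pos (by positivity), min_le_left _ _, ?_⟩
    have h1 : min 1 (e / (N + 1)) * N ≤ e := by
      calc min 1 (e / (N + 1)) * N ≤ e / (N + 1) * (N + 1) := by
            gcongr
            · exact min_le_right _ _
            · simp
        _ = e := div_mul_cancel₀ _ (by positivity)
    calc ((min 1 (e / (N + 1)) : ℝ≥0) : ℝ≥0∞) * N = ((min 1 (e / (N + 1)) * N : ℝ≥0) : ℝ≥0∞) := by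
          rw [ENNReal.coe_mul]
      _ ≤ (e : ℝ≥0∞) := by exact_mod_cast h1
      _ = 4⁻¹ * (ρ₂ 0 : ℝ≥0∞) ^ d := by
          rw [he, ENNReal.coe_mul, ENNReal.coe_pow, ENNReal.coe_inv (by norm_num)]; rfl
  set ρ : Fin (n + 1) → ℝ≥0 := Fin.cons (ρ₂ 0) fun i => t * ρ₂ i.succ with hρ
  have hρ0 : ρ 0 = ρ₂ 0 := rfl
  have hρs : ∀ i : Fin n, ρ i.succ = t * ρ₂ i.succ := fun _ => rfl
  have hρpos : ∀ i, 0 < ρ i := fun i =>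
    Fin.cases (hρ₂pos 0) (fun i => mul_pos ht0 (hρ₂pos i.succ)) i
  have hρle : ∀ i, ρ i ≤ ρ₂ i := fun i =>
    Fin.cases le_rfl (fun i => mul_le_of_le_one_left zero_le ht1) i
  have hv₃ : seriesNorm ρ v ≤ 4⁻¹ * (ρ 0 : ℝ≥0∞) ^ d := by
    refine le_trans (seriesNorm_le_mul fun α hα => ?_) ht
    obtain ⟨i, hi⟩ := hv0 α hα
    rw [weight, weight, Fin.prod_univ_succ, Fin.prod_univ_succ]
    simp only [hρ0, hρs, ENNReal.coe_mul, mul_pow, Finset.prod_mul_distrib]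
    rw [mul_left_comm]
    gcongr
    have hle : ∀ j : Fin n, (t : ℝ≥0∞) ^ α j.succ ≤ 1 :=
      fun j => pow_le_one' (by exact_mod_cast ht1) _
    calc ∏ j : Fin n, (t : ℝ≥0∞) ^ α j.succ ≤ (t : ℝ≥0∞) ^ α i.succ := by
          rw [← Finset.mul_prod_erase _ _ (Finset.mem_univ i)]
          exact mul_le_of_le_one_right' (Finset.prod_le_one' fun j _ => hle j)
      _ ≤ t := (pow_le_pow_right_of_le_one' (by exact_mod_cast ht1)
          (Nat.one_le_iff_ne_zero.2 hi)).trans_eq (pow_one _)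
  have hmono : seriesNorm ρ (MvPowerSeries.monomial (Finsupp.single 0 d) (1 : ℂ)) =
      (ρ 0 : ℝ≥0∞) ^ d := by
    rw [seriesNorm, tsum_eq_single (Finsupp.single 0 d)]
    · rw [MvPowerSeries.coeff_monomial_same, weight_single]
      simp
    · intro α hα
      rw [MvPowerSeries.coeff_monomial_ne hα]
      simp
  have hk : seriesNorm ρ (MvPowerSeries.monomial (Finsupp.single 0 d) 1 * u + v) ≤
      2⁻¹ * (ρ 0 : ℝ≥0∞) ^ d := by
    calc seriesNorm ρ (MvPowerSeries.monomial (Finsupp.single 0 d) 1 * u + v)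
        ≤ (ρ 0 : ℝ≥0∞) ^ d * 4⁻¹ + 4⁻¹ * (ρ 0 : ℝ≥0∞) ^ d := by
          refine (seriesNorm_add_le _ _ _).trans (add_le_add ?_ hv₃)
          refine (seriesNorm_mul_le _ _ _).trans ?_
          rw [hmono]
          gcongr
          exact (seriesNorm_mono hρle u).trans hu₂
      _ = (4⁻¹ + 4⁻¹) * (ρ 0 : ℝ≥0∞) ^ d := by ring
      _ = 2⁻¹ * (ρ 0 : ℝ≥0∞) ^ d := by
          congr 1
          rw [← two_mul, show (4 : ℝ≥0∞) = 2 * 2 by norm_num,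
            ENNReal.mul_inv (by simp) (by simp), ← mul_assoc,
            ENNReal.mul_inv_cancel (by simp) (by simp), one_mul]
  have hgρ : seriesNorm ρ g ≠ ∞ := ne_top_of_le_ne_top hg₁
    (seriesNorm_mono (fun i => (hρle i).trans (hρ₂le i)) g)
  obtain ⟨G, hG, hGg⟩ := exists_add_quoX_mul_eq hρpos hk hgρ
  refine ⟨quoX d G * MvPowerSeries.C c, remX d G, ⟨ρ, hρpos, ?_⟩, ⟨ρ, hρpos, ?_⟩, ?_, ?_⟩
  · rw [mul_comm, seriesNorm_C_mul]
    refine ENNReal.mul_ne_top enorm_ne_top fun h2 => ?_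
    have h3 := seriesNorm_quoX_mul_le ρ d G
    rw [h2, ENNReal.top_mul (pow_ne_zero _ (by simpa using (hρpos 0).ne'))] at h3
    exact hG (top_le_iff.1 h3)
  · exact ne_top_of_le_ne_top hG (seriesNorm_remX_le ρ d G)
  · rw [mul_assoc, hch, ← hGg]
    linear_combination -X_pow_mul_quoX_add_remX d G
  · intro α hα
    rw [coeff_remX, if_neg (not_lt.2 hα)]

end Division

/-! ### The local rings of germs are noetherian -/

section Noetherian

open scoped ENNReal NNReal

variable {n : ℕ}

/-- The coefficients of `X₀ ^ j`, as a power series in the other variables. -/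
def sliceX (j : ℕ) (a : MvPowerSeries (Fin (n + 1)) ℂ) : MvPowerSeries (Fin n) ℂ :=
  fun β => MvPowerSeries.coeff (Finsupp.cons j β) a

theorem coeff_sliceX (j : ℕ) (a : MvPowerSeries (Fin (n + 1)) ℂ) (β : Fin n →₀ ℕ) :
    MvPowerSeries.coeff β (sliceX j a) = MvPowerSeries.coeff (Finsupp.cons j β) a := rfl

theorem Convergent.sliceX {a : MvPowerSeries (Fin (n + 1)) ℂ} (ha : Convergent a) (j : ℕ) :
    Convergent (sliceX j a) := by
  obtain ⟨ρ, hρ, h⟩ := ha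
  refine ⟨fun i => ρ i.succ, fun i => hρ _, fun htop => h ?_⟩
  have h1 : seriesNorm (fun i => ρ i.succ) (FreeDivisor.sliceX j a) * (ρ 0 : ℝ≥0∞) ^ j ≤
      seriesNorm ρ a := by
    rw [seriesNorm, ← ENNReal.tsum_mul_right]
    refine le_trans (le_of_eq (tsum_congr fun β => ?_))
      (ENNReal.tsum_comp_le_tsum_of_injective (f := Finsupp.cons j)
        (fun β γ hβ => (Finsupp.cons_injective2 hβ).2)
        fun α => ‖MvPowerSeries.coeff α a‖ₑ * weight ρ α)
    rw [coeff_sliceX, weight, weight, Fin.prod_univ_succ, Finsupp.cons_zero]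
    simp only [Finsupp.cons_succ]
    ring
  rw [htop, ENNReal.top_mul (pow_ne_zero _ (by simpa using (hρ 0).ne'))] at h1
  exact top_le_iff.1 h1

/-- Multi-indices split into the first exponent and the other ones. -/
def consEquiv (n : ℕ) : ℕ × (Fin n →₀ ℕ) ≃ (Fin (n + 1) →₀ ℕ) where
  toFun p := Finsupp.cons p.1 p.2
  invFun α := (α 0, Finsupp.tail α)
  left_inv p := by simp
  right_inv α := Finsupp.cons_tail α

/-- Forgetting the first coordinate. -/
def dropFirst (n : ℕ) : (Fin (n + 1) → ℂ) →L[ℂ] (Fin n → ℂ) :=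
  ContinuousLinearMap.pi fun i =>
    ContinuousLinearMap.proj (R := ℂ) (φ := fun _ : Fin (n + 1) => ℂ) i.succ

/-- The inclusion of the germs that do not depend on the first coordinate. -/
def inflate (n : ℕ) : Stalk (0 : Fin n → ℂ) →ₐ[ℂ] Stalk (0 : Fin (n + 1) → ℂ) :=
  pull (dropFirst n) ((dropFirst n).analyticAt 0) (map_zero _)

/-- A function represented by a series of degree less than `d` in the first variable is near `0` a
polynomial in that variable, with the functions represented by the slices as coefficients. -/
theorem represents_of_degree_lt {r : MvPowerSeries (Fin (n + 1)) ℂ} {d : ℕ}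
    (hr : ∀ α, d ≤ α 0 → MvPowerSeries.coeff α r = 0) {F : (Fin (n + 1) → ℂ) → ℂ}
    (hF : Represents r F) {G : ℕ → (Fin n → ℂ) → ℂ} (hG : ∀ j, Represents (sliceX j r) (G j)) :
    ∀ᶠ x in 𝓝 0, F x = ∑ j ∈ Finset.range d, x 0 ^ j * G j (dropFirst n x) := by
  have hG' : ∀ᶠ x in 𝓝 (0 : Fin (n + 1) → ℂ), ∀ j ∈ Finset.range d,
      HasSum (fun β => MvPowerSeries.coeff β (sliceX j r) * ∏ i, (dropFirst n x) i ^ β i)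
        (G j (dropFirst n x)) := by
    rw [Filter.eventually_all_finset]
    intro j _
    have h0 : Tendsto (dropFirst n) (𝓝 0) (𝓝 0) := by
      simpa using (dropFirst n).continuous.tendsto 0
    exact h0.eventually (hG j)
  filter_upwards [hF, hG'] with x hx hGx
  rw [← (consEquiv n).hasSum_iff] at hx
  have hterm : ∀ j β, MvPowerSeries.coeff (Finsupp.cons j β) r *
      ∏ i, x i ^ (Finsupp.cons j β : Fin (n + 1) →₀ ℕ) i =
      x 0 ^ j * (MvPowerSeries.coeff β (sliceX j r) * ∏ i, (dropFirst n x) i ^ β i) := by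
    intro j β
    rw [coeff_sliceX, Fin.prod_univ_succ, Finsupp.cons_zero]
    simp only [Finsupp.cons_succ]
    rw [mul_left_comm]
    rfl
  have h1 := hx.prod_fiberwise (g := fun j => if j ∈ Finset.range d then
      x 0 ^ j * G j (dropFirst n x) else 0) (fun j => by
    simp only [Function.comp_apply, consEquiv, Equiv.coe_fn_mk]
    split_ifs with hj
    · simp only [hterm]
      exact (hGx j hj).mul_left _
    · have : ∀ β : Fin n →₀ ℕ, MvPowerSeries.coeff (Finsupp.cons j β) r = 0 := fun β =>
        hr _ (by simpa using hj)
      simp only [this, zero_mul]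
      exact hasSum_zero)
  rw [h1.unique (hasSum_sum_of_ne_finset_zero (s := Finset.range d) fun j hj => if_neg hj)]
  exact Finset.sum_congr rfl fun j hj => if_pos hj

/-- The quotient by a function that is regular in the first coordinate is finite over the germs in
the other coordinates. -/
theorem exists_division {F : (Fin (n + 1) → ℂ) → ℂ} (hF : AnalyticAt ℂ F 0)
    (hreg : ¬ ∀ᶠ t in 𝓝 (0 : ℂ), F (t • Pi.single 0 1) = 0) :
    ∃ d : ℕ, ∀ g : Stalk (0 : Fin (n + 1) → ℂ), ∃ (q : Stalk (0 : Fin (n + 1) → ℂ))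
      (r : ℕ → Stalk (0 : Fin n → ℂ)),
      g = q * germ F 0 + ∑ j ∈ Finset.range d, inflate n (r j) * coord 0 0 ^ j := by
  classical
  obtain ⟨h, hh, hhF⟩ := exists_convergent_represents hF
  have hex : ∃ d, MvPowerSeries.coeff (Finsupp.single 0 d) h ≠ 0 := by
    by_contra! hcon
    refine hreg ?_
    have h0 : Tendsto (fun t : ℂ => t • (Pi.single 0 1 : Fin (n + 1) → ℂ)) (𝓝 0) (𝓝 0) := by
      have : Continuous fun t : ℂ => t • (Pi.single 0 1 : Fin (n + 1) → ℂ) := by fun_prop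
      simpa using this.tendsto 0
    filter_upwards [h0.eventually hhF] with t ht
    refine ht.unique ?_
    convert hasSum_zero with α
    by_cases hα : ∃ i : Fin n, α i.succ ≠ 0
    · obtain ⟨i, hi⟩ := hα
      rw [Finset.prod_eq_zero (Finset.mem_univ i.succ), mul_zero]
      simp [hi]
    · push Not at hα
      have : α = Finsupp.single 0 (α 0) := by
        ext i
        refine Fin.cases ?_ (fun i => ?_) i
        · simp
        · rw [hα i, Finsupp.single_eq_of_ne (Fin.succ_ne_zero i)]
      rw [this, hcon, zero_mul]
  refine ⟨Nat.find hex, fun g => ?_⟩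
  obtain ⟨g, hg, rfl⟩ := exists_germ_eq g
  obtain ⟨a, ha, hag⟩ := exists_convergent_represents hg
  obtain ⟨q, r, hq, hr, hqr, hr0⟩ := weierstrass_division hh ha (Nat.find_spec hex)
    (fun j hj => not_not.1 (Nat.find_min hex hj))
  obtain ⟨Q, hQ, hqQ⟩ := hq.exists_represents
  obtain ⟨P, hP, hrP⟩ := hr.exists_represents
  choose G hG hrG using fun j => (hr.sliceX j).exists_represents
  refine ⟨germ Q 0, fun j => germ (G j) 0, ?_⟩
  have e1 : ∀ j, inflate n (germ (G j) 0) * coord 0 0 ^ j =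
      germ (fun x => x 0 ^ j * G j (dropFirst n x)) 0 := fun j => by
    have hc : coord (0 : Fin (n + 1) → ℂ) 0 ^ j = germ (fun x => x 0 ^ j) 0 := by
      induction j with
      | zero => simp [germ_one]
      | succ j ih =>
        simp only [pow_succ]
        rw [ih, germ_mul ((analyticAt_apply 0 0).fun_pow j) (analyticAt_apply 0 0)]
        simp [coord]
    have h1 : AnalyticAt ℂ (fun x => G j (dropFirst n x)) 0 :=
      AnalyticAt.fun_comp (g := G j) (by simpa using hG j) ((dropFirst n).analyticAt 0)
    rw [inflate, pull_germ _ _ (hG j), hc, mul_comm,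
      germ_mul ((analyticAt_apply 0 0).fun_pow j) h1]
  have hterm : ∀ j, AnalyticAt ℂ (fun x : Fin (n + 1) → ℂ => x 0 ^ j * G j (dropFirst n x)) 0 :=
    fun j => ((analyticAt_apply 0 0).fun_pow j).fun_mul
      (AnalyticAt.fun_comp (g := G j) (by simpa using hG j) ((dropFirst n).analyticAt 0))
  simp only [e1]
  rw [← germ_sum _ fun j _ => hterm j, ← germ_mul hQ hF, ← germ_add (hQ.fun_mul hF)
    (Finset.analyticAt_fun_sum _ fun j _ => hterm j)]
  refine germ_congr hg ?_
  have h2 := (hqQ.mul hhF).add hrP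
  rw [← hqr] at h2
  filter_upwards [h2, hag, represents_of_degree_lt hr0 hrP hrG] with x h3 h4 h5
  rw [← h5]
  exact h4.unique h3

/-- If an ideal contains the germ of a function that is regular in the first coordinate, then by
division its quotient by that germ is a submodule of a finite module over the germs in one variable
fewer, hence finitely generated. -/
theorem fg_of_regular_mem [IsNoetherianRing (Stalk (0 : Fin n → ℂ))]
    {I : Ideal (Stalk (0 : Fin (n + 1) → ℂ))}
    {F : (Fin (n + 1) → ℂ) → ℂ} (hF : AnalyticAt ℂ F 0) (hFI : germ F 0 ∈ I)
    (hreg : ¬ ∀ᶠ t in 𝓝 (0 : ℂ), F (t • Pi.single 0 1) = 0) : I.FG := by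
  obtain ⟨d, hd⟩ := exists_division hF hreg
  classical
  let _ : Algebra (Stalk (0 : Fin n → ℂ)) (Stalk (0 : Fin (n + 1) → ℂ)) :=
    (inflate n).toRingHom.toAlgebra
  set J : Ideal (Stalk (0 : Fin (n + 1) → ℂ)) := Ideal.span {germ F 0}
  have hfin : Module.Finite (Stalk (0 : Fin n → ℂ)) (Stalk (0 : Fin (n + 1) → ℂ) ⧸ J) := by
    refine Module.Finite.of_fg_top ⟨(Finset.range d).image fun j =>
      Ideal.Quotient.mk J (coord 0 0 ^ j), ?_⟩
    rw [eq_top_iff]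
    rintro z -
    obtain ⟨g, rfl⟩ := Ideal.Quotient.mk_surjective z
    obtain ⟨q, r, rfl⟩ := hd g
    rw [map_add, Ideal.Quotient.eq_zero_iff_mem.2 (Ideal.mul_mem_left _ _
      (Ideal.mem_span_singleton_self _)), zero_add, map_sum]
    refine Submodule.sum_mem _ fun j hj => ?_
    have : Ideal.Quotient.mk J (inflate n (r j) * coord 0 0 ^ j) =
        r j • Ideal.Quotient.mk J (coord 0 0 ^ j) := rfl
    rw [this]
    exact Submodule.smul_mem _ _ (Submodule.subset_span
      (Finset.mem_coe.2 (Finset.mem_image_of_mem _ hj)))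
  have hN : IsNoetherian (Stalk (0 : Fin (n + 1) → ℂ)) (Stalk (0 : Fin (n + 1) → ℂ) ⧸ J) :=
    isNoetherian_of_tower (Stalk (0 : Fin n → ℂ)) (isNoetherian_of_isNoetherianRing_of_finite _ _)
  refine Submodule.fg_of_fg_map_of_fg_inf_ker (Submodule.mkQ J) (hN.noetherian _) ?_
  rw [Submodule.ker_mkQ, inf_eq_right.2]
  · exact ⟨{germ F 0}, by simp [J, Ideal.span]⟩
  · exact (Ideal.span_singleton_le_iff_mem I).2 hFI

/-- The one-variable identity theorem, applied along every line through the origin. -/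
theorem exists_line_not_eventually_zero {F : (Fin n → ℂ) → ℂ} (hF : AnalyticAt ℂ F 0)
    (h0 : germ F 0 ≠ 0) : ∃ v : Fin n → ℂ, ¬ ∀ᶠ t in 𝓝 (0 : ℂ), F (t • v) = 0 := by
  by_contra! hcon
  refine h0 ?_
  rw [← germ_zero, germ_eq_germ_iff hF analyticAt_const]
  obtain ⟨ε, hε, hball⟩ := Metric.eventually_nhds_iff_ball.1 hF.eventually_analyticAt
  refine eventually_of_mem (Metric.ball_mem_nhds 0 hε) fun y hy => ?_
  have hlin : ∀ t : ℂ, AnalyticAt ℂ (fun t : ℂ => t • y) t := fun t =>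
    (ContinuousLinearMap.analyticAt ((ContinuousLinearMap.id ℂ ℂ).smulRight y) t)
  set Z : Set ℂ := (fun t : ℂ => t • y) ⁻¹' Metric.ball 0 ε
  have hZ : Convex ℝ Z := (convex_ball (0 : Fin n → ℂ) ε).is_linear_preimage
    (IsLinearMap.mk (fun a b => add_smul a b y) fun c a => smul_assoc c a y)
  have h1 := AnalyticOnNhd.eqOn_zero_of_preconnected_of_eventuallyEq_zero
    (f := fun t => F (t • y)) (U := Z) (fun t ht => AnalyticAt.fun_comp (g := F) (f := fun t : ℂ => t • y) (hball _ ht) (hlin t))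
    hZ.isPreconnected (z₀ := 0) (by simpa [Z] using hε) (hcon y)
  have h2 := h1 (x := 1) (by simpa [Z] using hy)
  simpa using h2

/-- Rückert's basis theorem, by induction on the number of variables: a linear change of coordinates
makes a nonzero element of the ideal regular in the first coordinate. -/
theorem isNoetherianRing_stalk_zero (n : ℕ) : IsNoetherianRing (Stalk (0 : Fin n → ℂ)) := by
  induction n with
  | zero =>
    have hfield : IsField (Stalk (0 : Fin 0 → ℂ)) := by
      rw [IsLocalRing.isField_iff_maximalIdeal_eq, maximalIdeal_eq_span_coord]
      simp
    let _ := hfield.toField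
    infer_instance
  | succ n ih =>
    rw [isNoetherianRing_iff_ideal_fg]
    intro I
    rcases eq_or_ne I ⊥ with rfl | hI
    · exact Submodule.fg_bot
    obtain ⟨h, hhI, hh0⟩ := Submodule.exists_mem_ne_zero_of_ne_bot hI
    obtain ⟨F, hF, rfl⟩ := exists_germ_eq h
    obtain ⟨v, hv⟩ : ∃ v : Fin (n + 1) → ℂ, v ≠ 0 ∧ ¬ ∀ᶠ t in 𝓝 (0 : ℂ), F (t • v) = 0 := by
      obtain ⟨v, hv⟩ := exists_line_not_eventually_zero hF hh0
      by_cases hv0 : v = 0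
      · refine ⟨Pi.single 0 1, by simp, fun hcon => hv ?_⟩
        have h1 := hcon.self_of_nhds
        subst hv0
        simpa using h1
      · exact ⟨v, hv0, hv⟩
    obtain ⟨A, hA⟩ := SeparatingDual.exists_continuousLinearEquiv_apply_eq (R := ℂ)
      (x := (Pi.single 0 1 : Fin (n + 1) → ℂ)) (y := v) (by simp) hv.1
    set e := pull (x := (0 : Fin (n + 1) → ℂ)) (y := 0) A
      (A.analyticAt 0) (map_zero A)
    set e' := pull (x := (0 : Fin (n + 1) → ℂ)) (y := 0) A.symm
      (A.symm.analyticAt 0) (map_zero A.symm)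
    have hee : ∀ r, e' (e r) = r := fun r => by
      rw [pull_pull (ω := id) _ _ _ _ analyticAt_id rfl (by simp), pull_id _ _ (by simp)]
    have heF : e (germ F 0) = germ (fun z => F (A z)) 0 := pull_germ _ _ hF
    have hfg : (I.map e).FG := fg_of_regular_mem (F := fun z => F (A z))
      (AnalyticAt.fun_comp (g := F) (by simpa using hF)
        (A.analyticAt 0))
      (heF ▸ Ideal.mem_map_of_mem e hhI) (by simpa [hA] using hv.2)
    have h2 : (I.map e).map e' = I := by
      refine le_antisymm ?_ fun r hr => ?_
      · rw [Ideal.map_le_iff_le_comap, Ideal.map_le_iff_le_comap]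
        intro r hr
        simpa [hee] using hr
      · rw [← hee r]
        exact Ideal.mem_map_of_mem _ (Ideal.mem_map_of_mem _ hr)
    rw [← h2]
    exact hfg.map e'.toRingHom

instance (x : Fin n → ℂ) : IsNoetherianRing (Stalk x) := by
  have := isNoetherianRing_stalk_zero n
  have h1 : AnalyticAt ℂ (fun z : Fin n → ℂ => z - x) x := analyticAt_id.fun_sub analyticAt_const
  have h2 : AnalyticAt ℂ (fun z : Fin n → ℂ => z + x) 0 := analyticAt_id.fun_add analyticAt_const
  refine isNoetherianRing_of_surjective (Stalk (0 : Fin n → ℂ)) (Stalk x)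
    (pull (fun z => z - x) h1 (sub_self x)).toRingHom fun r =>
    ⟨pull (fun z => z + x) h2 (zero_add x) r, ?_⟩
  change pull _ h1 _ (pull _ h2 _ r) = r
  rw [pull_pull (ω := id) _ _ _ _ analyticAt_id rfl (by simp), pull_id _ _ (by simp)]

end Noetherian

/-! ### Polynomial approximation and derivations -/

section Approximation

variable {n : ℕ} {x : Fin n → ℂ}

open IsLocalRing

theorem coord_mem_maximalIdeal (i : Fin n) : coord x i ∈ maximalIdeal (Stalk x) :=
  (mem_maximalIdeal_iff _).2 (value_coord i)

theorem exists_polynomial_sub_mem_of_mem_pow (k : ℕ) :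
    ∀ z ∈ maximalIdeal (Stalk x) ^ k, ∃ p ∈ Algebra.adjoin ℂ (Set.range (coord x)),
      z - p ∈ maximalIdeal (Stalk x) ^ (k + 1) := by
  induction k with
  | zero =>
    intro z _
    refine ⟨algebraMap ℂ _ (value x z), Subalgebra.algebraMap_mem _ _, ?_⟩
    rw [zero_add, pow_one, mem_maximalIdeal_iff, map_sub, AlgHom.commutes]
    exact sub_self _
  | succ k ih =>
    intro z hz
    rw [pow_succ'] at hz
    refine Submodule.mul_induction_on hz (fun m hm w hw => ?_) (fun a b ha hb => ?_)
    · rw [maximalIdeal_eq_span_coord, Ideal.mem_span_range_iff_exists_fun] at hm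
      obtain ⟨c, rfl⟩ := hm
      choose p hp hpw using fun i => ih (c i * w) (Ideal.mul_mem_left _ _ hw)
      refine ⟨∑ i, coord x i * p i, Subalgebra.sum_mem _ fun i _ =>
        Subalgebra.mul_mem _ (Algebra.subset_adjoin ⟨i, rfl⟩) (hp i), ?_⟩
      rw [Finset.sum_mul, ← Finset.sum_sub_distrib]
      refine Ideal.sum_mem _ fun i _ => ?_
      rw [show c i * coord x i * w - coord x i * p i = coord x i * (c i * w - p i) by ring,
        pow_succ' _ (k + 1)]
      exact Ideal.mul_mem_mul (coord_mem_maximalIdeal i) (hpw i)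
    · obtain ⟨p, hp, hap⟩ := ha
      obtain ⟨q, hq, hbq⟩ := hb
      exact ⟨p + q, Subalgebra.add_mem _ hp hq, by
        rw [add_sub_add_comm]
        exact Ideal.add_mem _ hap hbq⟩

/-- Every germ is a polynomial in the coordinates up to terms of high order. -/
theorem exists_polynomial_sub_mem (k : ℕ) (r : Stalk x) :
    ∃ p ∈ Algebra.adjoin ℂ (Set.range (coord x)), r - p ∈ maximalIdeal (Stalk x) ^ k := by
  induction k with
  | zero => exact ⟨0, Subalgebra.zero_mem _, by simp⟩
  | succ k ih =>
    obtain ⟨p, hp, hrp⟩ := ih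
    obtain ⟨q, hq, hq'⟩ := exists_polynomial_sub_mem_of_mem_pow k _ hrp
    exact ⟨p + q, Subalgebra.add_mem _ hp hq, by rwa [← sub_sub]⟩

/-- Local homomorphisms to noetherian local algebras are determined by the images of the
coordinates. -/
theorem algHom_ext_of_coord {B : Type*} [CommRing B] [Algebra ℂ B] [IsNoetherianRing B]
    [IsLocalRing B] {φ χ : Stalk x →ₐ[ℂ] B} (h : ∀ i, φ (coord x i) = χ (coord x i))
    (hφ : ∀ i, φ (coord x i) ∈ maximalIdeal B) : φ = χ := by
  have hle : ∀ ψ : Stalk x →ₐ[ℂ] B, (∀ i, ψ (coord x i) ∈ maximalIdeal B) → ∀ k,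
      ∀ r ∈ maximalIdeal (Stalk x) ^ k, ψ r ∈ maximalIdeal B ^ k := by
    intro ψ hψ k r hr
    have h1 : (maximalIdeal (Stalk x)).map ψ ≤ maximalIdeal B := by
      rw [maximalIdeal_eq_span_coord, Ideal.map_span, Ideal.span_le]
      rintro _ ⟨_, ⟨i, rfl⟩, rfl⟩
      exact hψ i
    have h2 := Ideal.mem_map_of_mem ψ hr
    rw [Ideal.map_pow] at h2
    exact Ideal.pow_right_mono h1 k h2
  ext r
  rw [← sub_eq_zero]
  have hbot := Ideal.iInf_pow_eq_bot_of_isLocalRing (maximalIdeal B) Ideal.IsPrime.ne_top'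
  rw [← Ideal.mem_bot, ← hbot, Ideal.mem_iInf]
  intro k
  obtain ⟨p, hp, hrp⟩ := exists_polynomial_sub_mem k r
  have hpe : φ p = χ p := by
    have h1 : Set.EqOn φ χ (Set.range (coord x)) := by
      rintro _ ⟨i, rfl⟩
      exact h i
    exact AlgHom.eqOn_adjoin_iff.2 h1 hp
  have h3 : φ r - χ r = φ (r - p) - χ (r - p) := by
    rw [map_sub, map_sub, hpe]
    ring
  rw [h3]
  exact Ideal.sub_mem _ (hle φ hφ k _ hrp) (hle χ (fun i => h i ▸ hφ i) k _ hrp)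

theorem derivation_mem_pow_smul {M : Type*} [AddCommGroup M] [Module ℂ M] [Module (Stalk x) M]
    [IsScalarTower ℂ (Stalk x) M]
    (D : Derivation ℂ (Stalk x) M) (I : Ideal (Stalk x)) (k : ℕ) :
    ∀ r ∈ I ^ (k + 1), D r ∈ (I ^ k • ⊤ : Submodule (Stalk x) M) := by
  induction k with
  | zero => intro r _; simp
  | succ k ih =>
    intro r hr
    rw [pow_succ'] at hr
    refine Submodule.mul_induction_on hr (fun a ha b hb => ?_) (fun a b ha hb => ?_)
    · rw [D.leibniz]
      refine Submodule.add_mem _ ?_ (Submodule.smul_mem_smul hb Submodule.mem_top)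
      rw [pow_succ', ← smul_eq_mul, Submodule.smul_assoc]
      exact Submodule.smul_mem_smul ha (ih b hb)
    · rw [map_add]
      exact Submodule.add_mem _ ha hb

/-- Derivations with values in a finite module are determined by the images of the coordinates. -/
theorem derivation_eq_zero_of_coord {M : Type*} [AddCommGroup M] [Module ℂ M] [Module (Stalk x) M]
    [IsScalarTower ℂ (Stalk x) M] [Module.Finite (Stalk x) M]
    {D : Derivation ℂ (Stalk x) M} (h : ∀ i, D (coord x i) = 0) : D = 0 := by
  ext r
  have hbot := (maximalIdeal (Stalk x)).iInf_pow_smul_eq_bot_of_isLocalRing (M := M)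
    Ideal.IsPrime.ne_top'
  rw [Derivation.zero_apply, ← Submodule.mem_bot (Stalk x), ← hbot, Submodule.mem_iInf]
  intro k
  obtain ⟨p, hp, hrp⟩ := exists_polynomial_sub_mem (k + 1) r
  have hDp : D p = 0 := by
    refine Derivation.eqOn_adjoin (D1 := D) (D2 := 0) (s := Set.range (coord x)) ?_ hp
    rintro _ ⟨i, rfl⟩
    exact h i
  have h1 : D r = D (r - p) := by rw [map_sub, hDp, sub_zero]
  rw [h1]
  exact derivation_mem_pow_smul D _ k _ hrp

theorem derivation_sum_apply {k R M ι : Type*} [CommRing k] [CommRing R] [Algebra k R]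
    [AddCommGroup M] [Module k M] [Module R M] (s : Finset ι) (D : ι → Derivation k R M) (r : R) :
    (∑ i ∈ s, D i) r = ∑ i ∈ s, D i r := by
  have h := map_sum (Derivation.coeFnAddMonoidHom (R := k) (A := R) (M := M)) D s
  have h1 := congrFun h r
  rwa [Finset.sum_apply] at h1

theorem der_eq_sum (δ : Der x) : δ = ∑ i, δ (coord x i) • coordField x i := by
  rw [← sub_eq_zero]
  refine derivation_eq_zero_of_coord fun j => ?_
  simp only [Derivation.coe_sub, Pi.sub_apply, derivation_sum_apply, Derivation.coe_smul, Pi.smul_apply, coordField_coord, smul_eq_mul, mul_ite, mul_one, mul_zero,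
    Finset.sum_ite_eq', Finset.mem_univ, if_true, sub_self]

theorem sum_coordField_coord (c : Fin n → Stalk x) (j : Fin n) :
    (∑ i, c i • coordField x i) (coord x j) = c j := by
  simp [derivation_sum_apply, coordField_coord]

/-- Derivations to a quotient of the local ring lift to vector fields. -/
theorem exists_lift_derivation (I : Ideal (Stalk x)) (D : Derivation ℂ (Stalk x) (Stalk x ⧸ I)) :
    ∃ δ : Der x, ∀ r, D r = Ideal.Quotient.mk I (δ r) := by
  choose c hc using fun i => Ideal.Quotient.mk_surjective (D (coord x i))
  set δ : Der x := ∑ i, c i • coordField x i with hδ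
  have h0 : D - (I.mkQ).compDer δ = 0 := by
    refine derivation_eq_zero_of_coord fun i => ?_
    rw [Derivation.coe_sub, Pi.sub_apply, ← hc i]
    have h1 : (I.mkQ).compDer δ (coord x i) = Ideal.Quotient.mk I (δ (coord x i)) := rfl
    rw [h1, hδ, sum_coordField_coord]
    exact sub_self _
  refine ⟨δ, fun r => ?_⟩
  have h1 := congrArg (fun E : Derivation ℂ (Stalk x) (Stalk x ⧸ I) => E r) h0
  exact sub_eq_zero.1 h1

end Approximation

/-! ### Lifting surjections onto the local ring of a hypersurface -/

section LiftAutomorphism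

variable {n : ℕ}

open IsLocalRing

/-- The differential at `0` of a germ, as a vector. -/
def grad (r : Stalk (0 : Fin n → ℂ)) : Fin n → ℂ := fun i => value 0 (coordField 0 i r)

theorem grad_add (r s : Stalk (0 : Fin n → ℂ)) : grad (r + s) = grad r + grad s := by
  ext i
  simp [grad]

theorem grad_mul (r s : Stalk (0 : Fin n → ℂ)) :
    grad (r * s) = value 0 r • grad s + value 0 s • grad r := by
  ext i
  simp [grad]

theorem grad_algebraMap (c : ℂ) : grad (algebraMap ℂ (Stalk (0 : Fin n → ℂ)) c) = 0 := by
  ext i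
  simp [grad]

theorem grad_coord (i : Fin n) : grad (coord (0 : Fin n → ℂ) i) = Pi.single i 1 := by
  ext j
  rw [grad, coordField_coord, Pi.single_apply]
  split_ifs <;> simp

theorem grad_sum {ι : Type*} (s : Finset ι) (r : ι → Stalk (0 : Fin n → ℂ)) :
    grad (∑ i ∈ s, r i) = ∑ i ∈ s, grad (r i) := by
  ext j
  simp [grad]

/-- Germs vanishing at `0` whose differentials are linearly independent are the coordinates of an
automorphism: this is the inverse function theorem. -/
theorem exists_algEquiv_coord (y : Fin n → Stalk (0 : Fin n → ℂ)) (h0 : ∀ i, value 0 (y i) = 0)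
    (hli : LinearIndependent ℂ fun i => grad (y i)) :
    ∃ θ : Stalk (0 : Fin n → ℂ) ≃ₐ[ℂ] Stalk (0 : Fin n → ℂ), ∀ i, θ (coord 0 i) = y i := by
  choose F hF hFy using fun i => exists_germ_eq (y i)
  set φ : (Fin n → ℂ) → (Fin n → ℂ) := fun z i => F i z with hφdef
  have hφ : AnalyticAt ℂ φ 0 := analyticAt_pi_iff.2 hF
  have hφ0 : φ 0 = 0 := funext fun i => by
    rw [hφdef, Pi.zero_apply, ← h0 i, ← hFy i, value_germ (hF i)]
  have hgrad : ∀ i j, fderiv ℂ φ 0 (Pi.single j 1) i = grad (y i) j := by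
    intro i j
    rw [grad, ← hFy i, coordField_germ (hF i), value_germ (analyticAt_partial (hF i) j)]
    rw [hφdef, fderiv_pi fun i => (hF i).differentiableAt]
    rfl
  have hinj : Function.Injective (fderiv ℂ φ 0) := by
    have hsurj : Function.Surjective (fderiv ℂ φ 0) := by
      have h1 : (fderiv ℂ φ 0 : (Fin n → ℂ) →ₗ[ℂ] (Fin n → ℂ)) =
          Matrix.toLin' (Matrix.of fun i j => grad (y i) j) := by
        refine LinearMap.pi_ext' fun j => LinearMap.ext_ring ?_
        ext i
        simpa using hgrad i j
      have h2 : IsUnit (Matrix.of fun i j => grad (y i) j) :=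
        Matrix.linearIndependent_rows_iff_isUnit.1 hli
      have h3 : Function.Surjective (fderiv ℂ φ 0 : (Fin n → ℂ) →ₗ[ℂ] (Fin n → ℂ)) := by
        rw [h1]
        intro v
        obtain ⟨w, hw⟩ := Matrix.mulVec_surjective_iff_isUnit.2 h2 v
        exact ⟨w, by rw [Matrix.toLin'_apply, hw]⟩
      exact h3
    exact LinearMap.injective_iff_surjective.2 hsurj
  set i : (Fin n → ℂ) ≃L[ℂ] (Fin n → ℂ) :=
    (LinearEquiv.ofInjectiveEndo (fderiv ℂ φ 0 : (Fin n → ℂ) →ₗ[ℂ] (Fin n → ℂ))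
      hinj).toContinuousLinearEquiv with hi
  have hfi : fderiv ℂ φ 0 = i := by
    ext v
    rfl
  have hstrict : HasStrictFDerivAt φ (i : (Fin n → ℂ) →L[ℂ] (Fin n → ℂ)) 0 :=
    hfi ▸ hφ.hasStrictFDerivAt
  set P := hstrict.toOpenPartialHomeomorph φ
  have hP : ∀ z, P z = φ z := fun _ => rfl
  have hmem : (0 : Fin n → ℂ) ∈ P.source := hstrict.mem_toOpenPartialHomeomorph_source
  have hψ : AnalyticAt ℂ P.symm 0 := by
    have := P.analyticAt_symm' hmem hφ hfi
    rwa [hP, hφ0] at this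
  have hψ0 : P.symm 0 = 0 := by
    have := P.left_inv hmem
    rwa [hP, hφ0] at this
  have hl : ∀ᶠ z in 𝓝 0, P.symm (φ z) = z := P.eventually_left_inverse hmem
  have hr : ∀ᶠ z in 𝓝 0, φ (P.symm z) = z := by
    have := P.eventually_right_inverse' hmem
    rwa [hP, hφ0] at this
  refine ⟨AlgEquiv.ofAlgHom (pull φ hφ hφ0) (pull P.symm hψ hψ0) ?_ ?_, fun j => ?_⟩
  · ext r
    simp only [AlgHom.comp_apply, AlgHom.id_apply]
    rw [pull_pull (ω := id) _ _ _ _ analyticAt_id rfl hl, pull_id _ _ (by simp)]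
  · ext r
    simp only [AlgHom.comp_apply, AlgHom.id_apply]
    rw [pull_pull (ω := id) _ _ _ _ analyticAt_id rfl hr, pull_id _ _ (by simp)]
  · change pull φ hφ hφ0 (coord 0 j) = y j
    rw [coord, pull_germ _ _ (analyticAt_coord 0 j _), ← hFy j]
    simp [hφdef]

/-- If the range of an endomorphism `Y` and the vector `u` span, then some `v ↦ Y v + c v • u` is
bijective: take `c` to be nonzero on a vector of the kernel. -/
theorem exists_surjective_add_smul {W : Type*} [AddCommGroup W] [Module ℂ W]
    [FiniteDimensional ℂ W] (Y : W →ₗ[ℂ] W) (u : W) (h : LinearMap.range Y ⊔ ℂ ∙ u = ⊤) :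
    ∃ c : W →ₗ[ℂ] ℂ, Function.Surjective (Y + c.smulRight u) := by
  by_cases hY : Function.Injective Y
  · exact ⟨0, by simpa using LinearMap.injective_iff_surjective.1 hY⟩
  · obtain ⟨a, ha, ha0⟩ : ∃ a, Y a = 0 ∧ a ≠ 0 := by
      rw [injective_iff_map_eq_zero] at hY
      push Not at hY
      exact hY
    obtain ⟨c, hc⟩ : ∃ c : W →ₗ[ℂ] ℂ, c a = 1 :=
      Module.Projective.exists_dual_eq_one ℂ ha0
    refine ⟨c, LinearMap.range_eq_top.1 (eq_top_iff.2 ?_)⟩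
    have hu : u ∈ LinearMap.range (Y + c.smulRight u) := ⟨a, by simp [ha, hc]⟩
    rw [← h]
    refine sup_le ?_ ((Submodule.span_singleton_le_iff_mem _ _).2 hu)
    rintro _ ⟨v, rfl⟩
    have h1 : Y v = (Y + c.smulRight u) v - c v • u := by simp
    rw [h1]
    exact Submodule.sub_mem _ ⟨v, rfl⟩ (Submodule.smul_mem _ _ hu)

/-- A surjection onto the local ring of a hypersurface germ lifts to an automorphism of the ambient
local ring. -/
theorem exists_algEquiv_lift {h : Stalk (0 : Fin n → ℂ)} (hh : value 0 h = 0)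
    {I : Ideal (Stalk (0 : Fin n → ℂ))} (hI : I = Ideal.span {h})
    (e : Stalk (0 : Fin n → ℂ) →ₐ[ℂ] Stalk (0 : Fin n → ℂ) ⧸ I) (he : Function.Surjective e) :
    ∃ θ : Stalk (0 : Fin n → ℂ) ≃ₐ[ℂ] Stalk (0 : Fin n → ℂ), ∀ r, Ideal.Quotient.mk I (θ r) = e r := by
  have hval : ∀ r ∈ I, value 0 r = 0 := by
    intro r hr
    obtain ⟨a, rfl⟩ := Ideal.mem_span_singleton'.1 (hI ▸ hr)
    rw [map_mul, hh, mul_zero]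
  have hIne : I ≠ ⊤ := fun htop => by
    have := hval 1 (htop ▸ Submodule.mem_top)
    rw [map_one] at this
    exact one_ne_zero this
  have : Nontrivial (Stalk (0 : Fin n → ℂ) ⧸ I) := Ideal.Quotient.nontrivial_iff.2 hIne
  have : IsLocalRing (Stalk (0 : Fin n → ℂ) ⧸ I) :=
    IsLocalRing.of_surjective' (Ideal.Quotient.mk I) Ideal.Quotient.mk_surjective
  have hmk : ∀ r, Ideal.Quotient.mk I r ∈ maximalIdeal (Stalk (0 : Fin n → ℂ) ⧸ I) ↔
      value 0 r = 0 := by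
    intro r
    rw [mem_maximalIdeal, mem_nonunits_iff, not_iff_comm, ← ne_eq, ← isUnit_iff_value_ne_zero]
    refine ⟨fun hr => hr.map _, fun hr => ?_⟩
    obtain ⟨s, hs⟩ := hr.exists_right_inv
    obtain ⟨s, rfl⟩ := Ideal.Quotient.mk_surjective s
    rw [← map_mul, ← map_one (Ideal.Quotient.mk I), Ideal.Quotient.eq] at hs
    have := hval _ hs
    rw [map_sub, map_mul, map_one, sub_eq_zero] at this
    rw [isUnit_iff_value_ne_zero]
    exact left_ne_zero_of_mul_eq_one this
  choose y hy using fun i => Ideal.Quotient.mk_surjective (e (coord 0 i))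
  have hy0 : ∀ i, value 0 (y i) = 0 := by
    intro i
    by_contra hne
    have h1 : IsUnit (coord (0 : Fin n → ℂ) i - algebraMap ℂ _ (value 0 (y i))) := by
      rw [isUnit_iff_value_ne_zero, map_sub, value_coord, AlgHom.commutes, zero_sub]
      exact neg_ne_zero.2 hne
    have h2 := h1.map e
    rw [map_sub, AlgHom.commutes, ← hy i] at h2
    have h3 : Ideal.Quotient.mk I (y i) - algebraMap ℂ _ (value 0 (y i)) =
        Ideal.Quotient.mk I (y i - algebraMap ℂ _ (value 0 (y i))) := rfl
    rw [h3] at h2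
    have h4 := (hmk (y i - algebraMap ℂ _ (value 0 (y i)))).2 (by
      rw [map_sub, AlgHom.commutes]
      exact sub_self _)
    exact (mem_maximalIdeal _).1 h4 h2
  set Y : (Fin n → ℂ) →ₗ[ℂ] (Fin n → ℂ) := Fintype.linearCombination ℂ fun i => grad (y i)
  -- surjectivity of `e` makes the coordinates combinations of the `y i` and of `h`
  have hspan : LinearMap.range Y ⊔ ℂ ∙ grad h = ⊤ := by
    rw [eq_top_iff, ← (Pi.basisFun ℂ (Fin n)).span_eq, Submodule.span_le]
    rintro _ ⟨j, rfl⟩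
    rw [Pi.basisFun_apply]
    obtain ⟨r, hr⟩ := he (Ideal.Quotient.mk I (coord 0 j))
    have hrm : r - algebraMap ℂ _ (value 0 r) ∈ maximalIdeal (Stalk (0 : Fin n → ℂ)) := by
      rw [mem_maximalIdeal_iff, map_sub, AlgHom.commutes]
      exact sub_self _
    rw [maximalIdeal_eq_span_coord, Ideal.mem_span_range_iff_exists_fun] at hrm
    obtain ⟨c, hc⟩ := hrm
    choose s hs using fun i => Ideal.Quotient.mk_surjective (e (c i))
    have hc' := congrArg e hc
    rw [map_sub, AlgHom.commutes, hr, map_sum] at hc'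
    have h1 : Ideal.Quotient.mk I (coord 0 j) = Ideal.Quotient.mk I
        (algebraMap ℂ _ (value 0 r) + ∑ i, s i * y i) := by
      rw [sub_eq_iff_eq_add'.1 hc'.symm, map_add, map_sum]
      simp only [map_mul, hs, hy]
      rfl
    obtain ⟨t, ht⟩ := Ideal.mem_span_singleton'.1 (hI ▸ Ideal.Quotient.eq.1 h1)
    have h2 := congrArg grad (sub_eq_iff_eq_add.1 ht.symm)
    simp only [grad_add, grad_mul, grad_sum, grad_coord, grad_algebraMap, hy0, hh, zero_smul,
      add_zero, zero_add] at h2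
    rw [h2]
    refine Submodule.add_mem _ (Submodule.mem_sup_right (Submodule.smul_mem _ _
      (Submodule.mem_span_singleton_self _))) (Submodule.mem_sup_left ⟨fun i => value 0 (s i), ?_⟩)
    rw [Fintype.linearCombination_apply]
  obtain ⟨c, hc⟩ := exists_surjective_add_smul Y (grad h) hspan
  set y' : Fin n → Stalk (0 : Fin n → ℂ) := fun i =>
    y i + algebraMap ℂ _ (c (Pi.single i 1)) * h with hy'
  have hgrad' : ∀ i, grad (y' i) = (Y + c.smulRight (grad h)) (Pi.single i 1) := by
    intro i
    rw [hy', grad_add, grad_mul, grad_algebraMap, hh, zero_smul, add_zero, AlgHom.commutes]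
    simp [Y]
  have hli : LinearIndependent ℂ fun i => grad (y' i) := by
    have h1 : LinearMap.ker (Y + c.smulRight (grad h)) = ⊥ :=
      LinearMap.ker_eq_bot.2 (LinearMap.injective_iff_surjective.2 hc)
    have h2 := (Pi.basisFun ℂ (Fin n)).linearIndependent.map' _ h1
    have h3 : (fun i => grad (y' i)) =
        (Y + c.smulRight (grad h)) ∘ Pi.basisFun ℂ (Fin n) := by
      funext i
      rw [hgrad' i, Function.comp_apply, Pi.basisFun_apply]
    rw [h3]
    exact h2
  obtain ⟨θ, hθ⟩ := exists_algEquiv_coord y' (fun i => by rw [hy', map_add, map_mul, hy0, hh]; simp)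
    hli
  have hext : (Ideal.Quotient.mkₐ ℂ I).comp (θ : Stalk (0 : Fin n → ℂ) →ₐ[ℂ] _) = e := by
    refine algHom_ext_of_coord (fun i => ?_) fun i => ?_
    · change Ideal.Quotient.mk I (θ (coord 0 i)) = _
      rw [hθ, ← hy i, Ideal.Quotient.eq, hy', add_sub_cancel_left]
      exact Ideal.mul_mem_left _ _ (hI ▸ Ideal.mem_span_singleton_self h)
    · change Ideal.Quotient.mk I (θ (coord 0 i)) ∈ _
      rw [hmk, hθ, hy', map_add, map_mul, hy0, hh, mul_zero, add_zero]
  exact ⟨θ, fun r => DFunLike.congr_fun hext r⟩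

end LiftAutomorphism

/-! ### Reduced equations -/

section Reduced

open IsLocalRing

variable {n : ℕ}

/-- The Euler vector field `∑ xᵢ ∂/∂xᵢ`. -/
def euler (n : ℕ) : Der (0 : Fin n → ℂ) := ∑ i, coord 0 i • coordField 0 i

theorem euler_apply (r : Stalk (0 : Fin n → ℂ)) :
    euler n r = ∑ i, coord 0 i * coordField 0 i r := by
  rw [euler, derivation_sum_apply]
  rfl

theorem euler_mem (r : Stalk (0 : Fin n → ℂ)) : euler n r ∈ maximalIdeal (Stalk (0 : Fin n → ℂ)) := by
  rw [euler_apply]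
  exact Ideal.sum_mem _ fun i _ => Ideal.mul_mem_right _ _ (coord_mem_maximalIdeal i)

/-- Euler's formula, modulo terms of higher order. -/
theorem euler_sub_mem (k : ℕ) : ∀ g ∈ maximalIdeal (Stalk (0 : Fin n → ℂ)) ^ k,
    euler n g - k * g ∈ maximalIdeal (Stalk (0 : Fin n → ℂ)) ^ (k + 1) := by
  induction k with
  | zero => intro g _; simpa using euler_mem g
  | succ k ih =>
    intro g hg
    rw [pow_succ'] at hg
    refine Submodule.mul_induction_on hg (fun a ha w hw => ?_) (fun a b ha hb => ?_)
    · have h1 : euler n a - a ∈ maximalIdeal (Stalk (0 : Fin n → ℂ)) ^ 2 := by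
        rw [maximalIdeal_eq_span_coord, Ideal.mem_span_range_iff_exists_fun] at ha
        obtain ⟨c, rfl⟩ := ha
        have hx : ∀ i, euler n (coord 0 i) = coord 0 i := fun i => by
          rw [euler, sum_coordField_coord]
        rw [map_sum, ← Finset.sum_sub_distrib]
        refine Ideal.sum_mem _ fun i _ => ?_
        rw [Derivation.leibniz, smul_eq_mul, smul_eq_mul, hx, add_sub_cancel_left, pow_two]
        exact Ideal.mul_mem_mul (coord_mem_maximalIdeal i) (euler_mem _)
      have h2 : euler n (a * w) - ((k + 1 : ℕ) : Stalk (0 : Fin n → ℂ)) * (a * w) =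
          a * (euler n w - k * w) + (euler n a - a) * w := by
        rw [Derivation.leibniz, smul_eq_mul, smul_eq_mul]
        push_cast
        ring
      rw [h2]
      refine Ideal.add_mem _ ?_ ?_
      · rw [pow_succ' _ (k + 1)]
        exact Ideal.mul_mem_mul ha (ih w hw)
      · rw [show k + 1 + 1 = 2 + k by ring, pow_add]
        exact Ideal.mul_mem_mul h1 hw
    · rw [map_add, mul_add, add_sub_add_comm]
      exact Ideal.add_mem _ ha hb

/-- A proper ideal that is stable under all vector fields is zero. -/
theorem eq_bot_of_coordField_mem {P : Ideal (Stalk (0 : Fin n → ℂ))} (hP : P ≠ ⊤)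
    (h : ∀ i, ∀ p ∈ P, coordField 0 i p ∈ P) : P = ⊥ := by
  have hk : ∀ k, P ≤ maximalIdeal (Stalk (0 : Fin n → ℂ)) ^ k := by
    intro k
    induction k with
    | zero => simp
    | succ k ih =>
      rcases Nat.eq_zero_or_pos k with rfl | hk
      · simpa using le_maximalIdeal hP
      intro p hp
      have h1 : euler n p ∈ maximalIdeal (Stalk (0 : Fin n → ℂ)) ^ (k + 1) := by
        rw [euler_apply, pow_succ']
        exact Ideal.sum_mem _ fun i _ => Ideal.mul_mem_mul (coord_mem_maximalIdeal i)
          (ih (h i p hp))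
      have h2 := Ideal.sub_mem _ h1 (euler_sub_mem k p (ih hp))
      rw [sub_sub_cancel] at h2
      have h3 : IsUnit ((k : ℕ) : Stalk (0 : Fin n → ℂ)) := by
        rw [isUnit_iff_value_ne_zero, map_natCast]
        exact_mod_cast hk.ne'
      exact (Ideal.unit_mul_mem_iff_mem _ h3).1 h2
  have hbot := Ideal.iInf_pow_eq_bot_of_isLocalRing (maximalIdeal (Stalk (0 : Fin n → ℂ)))
    Ideal.IsPrime.ne_top'
  rw [eq_bot_iff, ← hbot]
  exact le_iInf hk

/-- The localization of a reduced ring at a minimal prime is a field, so every element of the prime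
becomes zero there. -/
theorem exists_notMem_mul_mem_of_minimalPrimes {R : Type*} [CommRing R] {I : Ideal R}
    [IsReduced (R ⧸ I)] {P : Ideal R} (hP : P ∈ I.minimalPrimes) {p : R} (hp : p ∈ P) :
    ∃ s ∉ P, s * p ∈ I := by
  have := hP.isPrime
  have hdisj : ¬ Disjoint (I : Set R) ((Submonoid.powers p ⊔ P.primeCompl : Submonoid R) : Set R) := by
    intro hd
    obtain ⟨Q, hQ, hIQ, hQd⟩ := Ideal.exists_le_prime_disjoint I _ hd
    have hQP : Q ≤ P := fun q hq => by
      by_contra hqP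
      exact Set.disjoint_left.1 hQd hq ((le_sup_right : P.primeCompl ≤ _) hqP)
    exact Set.disjoint_left.1 hQd (hP.2 ⟨hQ, hIQ⟩ hQP hp)
      ((le_sup_left : Submonoid.powers p ≤ _) (Submonoid.mem_powers p))
  rw [Set.not_disjoint_iff] at hdisj
  obtain ⟨z, hzI, hz⟩ := hdisj
  obtain ⟨_, ⟨k, rfl⟩, s, hs, rfl⟩ := Submonoid.mem_sup.1 hz
  refine ⟨s, hs, ?_⟩
  have h1 : (s * p) ^ (k + 1) ∈ I := by
    have : (s * p) ^ (k + 1) = s ^ k * p * (p ^ k * s) := by ring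
    rw [this]
    exact I.mul_mem_left _ hzI
  rw [← Ideal.Quotient.eq_zero_iff_mem] at h1 ⊢
  rw [map_pow] at h1
  exact eq_zero_of_pow_eq_zero h1

variable {h : Stalk (0 : Fin n → ℂ)}

/-- No component of a reduced divisor is contained in its singular locus: the ideal of such a
component would be stable under all vector fields. -/
theorem exists_coordField_notMem (hh : h ≠ 0) [IsReduced (Stalk (0 : Fin n → ℂ) ⧸ Ideal.span {h})]
    {P : Ideal (Stalk (0 : Fin n → ℂ))} (hP : P ∈ (Ideal.span {h}).minimalPrimes) :
    ∃ i, coordField 0 i h ∉ P := by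
  have hprime := hP.isPrime
  have hhP : h ∈ P := hP.le (Ideal.mem_span_singleton_self h)
  by_contra! hcon
  have hbot : P = ⊥ := by
    refine eq_bot_of_coordField_mem hprime.ne_top fun i p hp => ?_
    obtain ⟨s, hs, hsp⟩ := exists_notMem_mul_mem_of_minimalPrimes hP hp
    obtain ⟨c, hc⟩ := Ideal.mem_span_singleton'.1 hsp
    have h1 := congrArg (coordField 0 i) hc
    rw [Derivation.leibniz, Derivation.leibniz, smul_eq_mul, smul_eq_mul, smul_eq_mul,
      smul_eq_mul] at h1
    have h2 : s * coordField 0 i p ∈ P := by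
      have h3 : s * coordField 0 i p =
          c * coordField 0 i h + h * coordField 0 i c - p * coordField 0 i s := by
        rw [h1]
        ring
      rw [h3]
      exact P.sub_mem (P.add_mem (P.mul_mem_left _ (hcon i)) (P.mul_mem_right _ hhP))
        (P.mul_mem_right _ hp)
    exact (hprime.mem_or_mem h2).resolve_left hs
  rw [hbot] at hhP
  exact hh hhP

theorem mem_span_of_mul_coordField_mem (hh : h ≠ 0)
    [IsReduced (Stalk (0 : Fin n → ℂ) ⧸ Ideal.span {h})] {g : Stalk (0 : Fin n → ℂ)}
    (hg : ∀ i, g * coordField 0 i h ∈ Ideal.span {h}) : g ∈ Ideal.span {h} := by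
  have hrad : (Ideal.span {h}).radical = Ideal.span {h} :=
    ((Ideal.isRadical_iff_quotient_reduced _).2 inferInstance).radical
  rw [← hrad, ← Ideal.sInf_minimalPrimes, Ideal.mem_sInf]
  intro P hP
  obtain ⟨i, hi⟩ := exists_coordField_notMem hh hP
  exact (hP.isPrime.mem_or_mem (hP.le (hg i))).resolve_right hi

end Reduced

/-! ### Saito's criterion -/

section Saito

variable {n : ℕ} {h : Stalk (0 : Fin n → ℂ)}

/-- Vector fields as columns of coefficients. -/
def derEquivFun (n : ℕ) :
    Der (0 : Fin n → ℂ) ≃ₗ[Stalk (0 : Fin n → ℂ)] (Fin n → Stalk (0 : Fin n → ℂ)) where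
  toFun δ i := δ (coord 0 i)
  invFun c := ∑ i, c i • coordField 0 i
  map_add' _ _ := rfl
  map_smul' _ _ := rfl
  left_inv δ := (der_eq_sum δ).symm
  right_inv c := funext fun j => sum_coordField_coord c j

theorem smul_mem_logDer (δ : Der (0 : Fin n → ℂ)) : h • δ ∈ logDer ℂ (Ideal.span {h}) := by
  rw [mem_logDer_span_singleton]
  exact Ideal.mul_mem_right _ _ (Ideal.mem_span_singleton_self h)

/-- Logarithmic fields have full rank, because `h ∂ᵢ` is logarithmic for every `i`. -/
theorem card_eq_of_basis_logDer (hh : h ≠ 0) {r : ℕ} {v : Fin r → Der (0 : Fin n → ℂ)}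
    (hli : LinearIndependent (Stalk (0 : Fin n → ℂ)) v)
    (hspan : Submodule.span (Stalk (0 : Fin n → ℂ)) (Set.range v) = logDer ℂ (Ideal.span {h})) :
    r = n := by
  have hfree : Module.Free (Stalk (0 : Fin n → ℂ)) (Der (0 : Fin n → ℂ)) :=
    Module.Free.of_equiv (derEquivFun n).symm
  have hfin : Module.Finite (Stalk (0 : Fin n → ℂ)) (Der (0 : Fin n → ℂ)) :=
    Module.Finite.equiv (derEquivFun n).symm
  have hrank : Module.finrank (Stalk (0 : Fin n → ℂ)) (Der (0 : Fin n → ℂ)) = n := by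
    rw [(derEquivFun n).finrank_eq, Module.finrank_fin_fun]
  refine le_antisymm ?_ ?_
  · have := hli.fintype_card_le_finrank
    rwa [hrank, Fintype.card_fin] at this
  · have h1 : Module.finrank (Stalk (0 : Fin n → ℂ)) (Submodule.span (Stalk (0 : Fin n → ℂ))
        (Set.range v)) = r := by
      rw [finrank_span_eq_card hli, Fintype.card_fin]
    have hmem : ∀ i, h • coordField 0 i ∈ Submodule.span (Stalk (0 : Fin n → ℂ)) (Set.range v) :=
      fun i => hspan ▸ smul_mem_logDer _
    have h2 : LinearIndependent (Stalk (0 : Fin n → ℂ))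
        (fun i => (⟨h • coordField 0 i, hmem i⟩ :
          Submodule.span (Stalk (0 : Fin n → ℂ)) (Set.range v))) := by
      rw [Fintype.linearIndependent_iff]
      intro c hc i
      have h3 := congrArg (fun δ : Submodule.span (Stalk (0 : Fin n → ℂ)) (Set.range v) =>
        (δ : Der (0 : Fin n → ℂ)) (coord 0 i)) hc
      simp only [Submodule.coe_sum, Submodule.coe_smul, ← mul_smul, sum_coordField_coord,
        Submodule.coe_zero, Derivation.zero_apply] at h3
      exact (mul_eq_zero.1 h3).resolve_right hh
    have h4 := h2.fintype_card_le_finrank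
    rwa [h1, Fintype.card_fin] at h4

/-- Saito's criterion: the determinant of a basis of the logarithmic vector fields is an equation
of the divisor. Reducedness makes the determinant a multiple `w * h`; comparison with the
logarithmic fields `h ∂ᵢ` and `hᵢ ∂ⱼ - hⱼ ∂ᵢ`, where `hᵢ = ∂ᵢ h`, shows that `w` divides powers of
`h` and of all `hᵢ`, which for a nonunit is excluded by the principal ideal theorem. -/
theorem span_det_eq_span (hh : h ≠ 0) [IsReduced (Stalk (0 : Fin n → ℂ) ⧸ Ideal.span {h})]
    {v : Fin n → Der (0 : Fin n → ℂ)}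
    (hspan : Submodule.span (Stalk (0 : Fin n → ℂ)) (Set.range v) = logDer ℂ (Ideal.span {h})) :
    Ideal.span {(Matrix.of fun k l => v k (coord 0 l)).det} = Ideal.span {h} := by
  set M : Matrix (Fin n) (Fin n) (Stalk (0 : Fin n → ℂ)) := Matrix.of fun k l => v k (coord 0 l)
    with hM
  set p : Fin n → Stalk (0 : Fin n → ℂ) := fun i => coordField 0 i h with hp
  have hv : ∀ k, v k h ∈ Ideal.span {h} := fun k =>
    (mem_logDer_span_singleton h (v k)).1 (hspan ▸ Submodule.subset_span ⟨k, rfl⟩)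
  have happ : ∀ δ : Der (0 : Fin n → ℂ), δ h = ∑ l, δ (coord 0 l) * p l := fun δ => by
    conv_lhs => rw [der_eq_sum δ]
    rw [derivation_sum_apply]
    rfl
  have hMp : ∀ k, (M.mulVec p) k ∈ Ideal.span {h} := fun k => by
    have h1 := hv k
    rwa [happ] at h1
  have hdet : M.det ∈ Ideal.span {h} := by
    refine mem_span_of_mul_coordField_mem hh fun i => ?_
    have h1 : M.det * p i = (M.adjugate.mulVec (M.mulVec p)) i := by
      rw [Matrix.mulVec_mulVec, Matrix.adjugate_mul, Matrix.smul_mulVec, Matrix.one_mulVec]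
      rfl
    change M.det * p i ∈ _
    rw [h1, Matrix.mulVec, dotProduct]
    exact Ideal.sum_mem _ fun k _ => Ideal.mul_mem_left _ _ (hMp k)
  obtain ⟨w, hw⟩ := Ideal.mem_span_singleton'.1 hdet
  -- the determinant divides the determinant of any family of logarithmic fields
  have hdvd : ∀ B : Matrix (Fin n) (Fin n) (Stalk (0 : Fin n → ℂ)),
      (∀ k, (B.mulVec p) k ∈ Ideal.span {h}) → M.det ∣ B.det := by
    intro B hB
    have h1 : ∀ k, ∃ c : Fin n → Stalk (0 : Fin n → ℂ), ∀ l, ∑ j, c j * M j l = B k l := by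
      intro k
      have h2 : (∑ l, B k l • coordField 0 l : Der (0 : Fin n → ℂ)) ∈
          Submodule.span (Stalk (0 : Fin n → ℂ)) (Set.range v) := by
        rw [hspan, mem_logDer_span_singleton, derivation_sum_apply]
        exact hB k
      obtain ⟨c, hc⟩ := (Submodule.mem_span_range_iff_exists_fun _).1 h2
      refine ⟨c, fun l => ?_⟩
      have h3 := DFunLike.congr_fun hc (coord 0 l)
      rw [sum_coordField_coord (B k), derivation_sum_apply] at h3
      exact h3
    choose C hC using h1
    have h2 : B = Matrix.of C * M := by
      ext k l
      rw [Matrix.mul_apply, ← hC k l]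
      rfl
    rw [h2, Matrix.det_mul]
    exact Dvd.intro_left _ rfl
  have hwh : w ∣ h ^ (n - 1) := by
    rcases Nat.eq_zero_or_pos n with rfl | hn
    · have h1 : M.det = 1 := Matrix.det_isEmpty
      exact (IsUnit.of_mul_eq_one _ (hw.trans h1)).dvd
    have h1 := hdvd (h • (1 : Matrix (Fin n) (Fin n) _)) fun k => by
      rw [Matrix.smul_mulVec, Matrix.one_mulVec]
      exact Ideal.mul_mem_right _ _ (Ideal.mem_span_singleton_self h)
    rw [Matrix.det_smul, Matrix.det_one, mul_one, Fintype.card_fin, ← hw] at h1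
    obtain ⟨k, rfl⟩ : ∃ k, n = k + 1 := ⟨n - 1, by omega⟩
    rw [pow_succ] at h1
    exact (mul_dvd_mul_iff_right hh).1 h1
  have hwp : ∀ i, w ∣ p i ^ (n - 1) := by
    intro i
    set b : Fin n → Stalk (0 : Fin n → ℂ) := fun j => if j = i then h else -p j with hb
    have h1 := hdvd ((p i • (1 : Matrix (Fin n) (Fin n) _)).updateCol i b) fun k => by
      rw [Matrix.mulVec, dotProduct, ← Finset.add_sum_erase _ _ (Finset.mem_univ i)]
      by_cases hki : k = i
      · subst hki
        rw [Finset.sum_eq_zero]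
        · simp only [Matrix.updateCol_self, hb, if_true, add_zero]
          exact Ideal.mul_mem_right _ _ (Ideal.mem_span_singleton_self h)
        · intro l hl
          have hlk := Finset.ne_of_mem_erase hl
          rw [Matrix.updateCol_ne hlk, Matrix.smul_apply, Matrix.one_apply_ne hlk.symm, smul_zero,
            zero_mul]
      · have h2 : ∑ l ∈ Finset.univ.erase i,
            ((p i • (1 : Matrix (Fin n) (Fin n) _)).updateCol i b) k l * p l = p i * p k := by
          rw [Finset.sum_eq_single k]
          · rw [Matrix.updateCol_ne hki, Matrix.smul_apply, Matrix.one_apply_eq, smul_eq_mul,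
              mul_one]
          · intro l hl hlk
            rw [Matrix.updateCol_ne (Finset.ne_of_mem_erase hl), Matrix.smul_apply,
              Matrix.one_apply_ne hlk.symm, smul_zero, zero_mul]
          · intro hk
            exact (hk (Finset.mem_erase.2 ⟨hki, Finset.mem_univ k⟩)).elim
        rw [h2, Matrix.updateCol_self]
        simp only [hb, if_neg hki]
        rw [show -p k * p i + p i * p k = 0 by ring]
        exact Ideal.zero_mem _
    rw [← Matrix.cramer_apply, Matrix.cramer_eq_adjugate_mulVec, Matrix.adjugate_smul,
      Matrix.adjugate_one, Matrix.smul_mulVec, Matrix.one_mulVec, Fintype.card_fin,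
      Pi.smul_apply, smul_eq_mul] at h1
    simp only [hb, if_true] at h1
    rw [← hw] at h1
    exact (mul_dvd_mul_iff_right hh).1 h1
  have hunit : IsUnit w := by
    by_contra hnu
    have hne : Ideal.span {w} ≠ ⊤ := by rwa [ne_eq, Ideal.span_singleton_eq_top]
    obtain ⟨P, hP⟩ := Ideal.nonempty_minimalPrimes hne
    have hprime := hP.isPrime
    have hwP : w ∈ P := hP.le (Ideal.mem_span_singleton_self w)
    have hhP : h ∈ P := hprime.mem_of_pow_mem _ (P.mem_of_dvd hwh hwP)
    have hheight := Ideal.height_le_one_of_isPrincipal_of_mem_minimalPrimes _ P hP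
    obtain ⟨Q, hQ, hQP⟩ := Ideal.exists_minimalPrimes_le
      ((Ideal.span_singleton_le_iff_mem P).2 hhP)
    have hQprime := hQ.isPrime
    have hQeq : Q = P := by
      by_contra hne
      have hlt : Q < P := lt_of_le_of_ne hQP hne
      have hbot : (⊥ : Ideal (Stalk (0 : Fin n → ℂ))) < Q := by
        rw [bot_lt_iff_ne_bot]
        rintro rfl
        exact hh (hQ.le (Ideal.mem_span_singleton_self h))
      have h1 : Q.height + 1 ≤ P.height := Ideal.height_add_one_le_of_lt_of_isPrime hlt
      have h2 : (⊥ : Ideal (Stalk (0 : Fin n → ℂ))).height + 1 ≤ Q.height :=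
        Ideal.height_add_one_le_of_lt_of_isPrime hbot
      have h3 : (1 : ℕ∞) + 1 ≤ 1 := by
        calc (1 : ℕ∞) + 1 ≤ Q.height + 1 := by
              gcongr
              exact le_trans (by simp) h2
          _ ≤ P.height := h1
          _ ≤ 1 := hheight
      exact absurd h3 (by decide)
    obtain ⟨i, hi⟩ := exists_coordField_notMem hh hQ
    exact hi (hQeq ▸ hprime.mem_of_pow_mem _ (P.mem_of_dvd (hwp i) hwP))
  rw [← hw, Ideal.span_singleton_mul_left_unit hunit]

end Saito

/-! ### Functions and vector fields over a first order base -/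

section FirstOrder

variable {n : ℕ} {V : Type} [AddCommGroup V] [Module ℂ V] [Module ℂᵐᵒᵖ V] [IsCentralScalar ℂ V]

/-- The function ring of `ℂⁿ × Spec (ℂ ⊕ V)`, with `V² = 0`. -/
abbrev FatStalk (n : ℕ) (V : Type) [AddCommGroup V] [Module ℂ V] [Module ℂᵐᵒᵖ V]
    [IsCentralScalar ℂ V] : Type :=
  RelStalk n (TrivSqZeroExt ℂ V)

/-- The component of a function in the direction of a linear form `l` on `V`. -/
def contract (l : V →ₗ[ℂ] ℂ) : FatStalk n V →ₗ[ℂ] Stalk (0 : Fin n → ℂ) :=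
  (TensorProduct.lid ℂ (Stalk (0 : Fin n → ℂ))).toLinearMap ∘ₗ
    LinearMap.rTensor (Stalk (0 : Fin n → ℂ)) (l ∘ₗ TrivSqZeroExt.sndHom ℂ V)

theorem contract_tmul (l : V →ₗ[ℂ] ℂ) (a : TrivSqZeroExt ℂ V) (r : Stalk (0 : Fin n → ℂ)) :
    contract l (a ⊗ₜ r) = l a.snd • r := by
  simp [contract]

theorem restrict_tmul {A : Type} [CommRing A] [Algebra ℂ A] (ρ : A →ₐ[ℂ] ℂ) (a : A)
    (r : Stalk (0 : Fin n → ℂ)) : restrict ρ (a ⊗ₜ r) = ρ a • r := by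
  rw [restrict, Algebra.TensorProduct.lift_tmul, AlgHom.comp_apply, Algebra.ofId_apply,
    Algebra.smul_def, AlgHom.id_apply]

theorem restrict_residue_tmul (a : TrivSqZeroExt ℂ V) (r : Stalk (0 : Fin n → ℂ)) :
    restrict (residue V) (a ⊗ₜ r) = a.fst • r :=
  restrict_tmul _ _ _

theorem contract_one_tmul (l : V →ₗ[ℂ] ℂ) (r : Stalk (0 : Fin n → ℂ)) :
    contract l ((1 : TrivSqZeroExt ℂ V) ⊗ₜ r) = 0 := by
  rw [contract_tmul, TrivSqZeroExt.snd_one, map_zero, zero_smul]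

theorem restrict_one_tmul {A : Type} [CommRing A] [Algebra ℂ A] (ρ : A →ₐ[ℂ] ℂ)
    (r : Stalk (0 : Fin n → ℂ)) : restrict ρ ((1 : A) ⊗ₜ r) = r := by
  rw [restrict_tmul, map_one, one_smul]

theorem contract_inr_tmul (l : V →ₗ[ℂ] ℂ) (v : V) (r : Stalk (0 : Fin n → ℂ)) :
    contract l ((TrivSqZeroExt.inr v : TrivSqZeroExt ℂ V) ⊗ₜ r) = l v • r := by
  rw [contract_tmul, TrivSqZeroExt.snd_inr]

theorem restrict_inr_tmul (v : V) (r : Stalk (0 : Fin n → ℂ)) :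
    restrict (residue V) ((TrivSqZeroExt.inr v : TrivSqZeroExt ℂ V) ⊗ₜ r) = 0 := by
  rw [restrict_residue_tmul, TrivSqZeroExt.fst_inr, zero_smul]

/-- The contraction is a derivation along the restriction to the central fibre. -/
theorem contract_mul (l : V →ₗ[ℂ] ℂ) (y z : FatStalk n V) :
    contract l (y * z) = restrict (residue V) y * contract l z +
      restrict (residue V) z * contract l y := by
  induction y using TensorProduct.induction_on with
  | zero => simp
  | add y y' hy hy' => rw [add_mul, map_add, hy, hy', map_add, map_add]; ring
  | tmul a r =>
    induction z using TensorProduct.induction_on with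
    | zero => simp
    | add z z' hz hz' => rw [mul_add, map_add, hz, hz', map_add, map_add]; ring
    | tmul b s =>
      rw [Algebra.TensorProduct.tmul_mul_tmul, contract_tmul, contract_tmul, contract_tmul,
        restrict_residue_tmul, restrict_residue_tmul, TrivSqZeroExt.snd_mul, map_add, map_smul,
        op_smul_eq_smul, map_smul, smul_mul_smul_comm, smul_mul_smul_comm, add_smul, smul_eq_mul,
        smul_eq_mul, mul_comm s r]

theorem contract_smul (l : V →ₗ[ℂ] ℂ) (a : TrivSqZeroExt ℂ V) (z : FatStalk n V) :
    contract l (a • z) = a.fst • contract l z + l a.snd • restrict (residue V) z := by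
  have h : a • z = (a ⊗ₜ[ℂ] (1 : Stalk (0 : Fin n → ℂ))) * z := by
    rw [Algebra.smul_def, Algebra.TensorProduct.algebraMap_apply]
    rfl
  rw [h, contract_mul, restrict_residue_tmul, contract_tmul, smul_mul_assoc, one_mul,
    mul_smul_comm, mul_one]

theorem restrict_smul {A : Type} [CommRing A] [Algebra ℂ A] (ρ : A →ₐ[ℂ] ℂ) (a : A)
    (z : RelStalk n A) : restrict ρ (a • z) = ρ a • restrict ρ z := by
  have h : a • z = (a ⊗ₜ[ℂ] (1 : Stalk (0 : Fin n → ℂ))) * z := by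
    rw [Algebra.smul_def, Algebra.TensorProduct.algebraMap_apply]
    rfl
  rw [h, map_mul, restrict_tmul, smul_mul_assoc, one_mul]

theorem contract_map {W : Type} [AddCommGroup W] [Module ℂ W] [Module ℂᵐᵒᵖ W] [IsCentralScalar ℂ W]
    (φ : V →ₗ[ℂ] W) (l : W →ₗ[ℂ] ℂ) (z : FatStalk n V) :
    contract l (Algebra.TensorProduct.map (TrivSqZeroExt.map φ)
      (AlgHom.id ℂ (Stalk (0 : Fin n → ℂ))) z) = contract (l ∘ₗ φ) z := by
  induction z using TensorProduct.induction_on with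
  | zero => simp
  | add y y' hy hy' => rw [map_add, map_add, hy, hy', map_add]
  | tmul a r =>
    rw [Algebra.TensorProduct.map_tmul, contract_tmul, contract_tmul, TrivSqZeroExt.snd_map]
    rfl

theorem restrict_map {W : Type} [AddCommGroup W] [Module ℂ W] [Module ℂᵐᵒᵖ W] [IsCentralScalar ℂ W]
    (φ : V →ₗ[ℂ] W) (z : FatStalk n V) :
    restrict (residue W) (Algebra.TensorProduct.map (TrivSqZeroExt.map φ)
      (AlgHom.id ℂ (Stalk (0 : Fin n → ℂ))) z) = restrict (residue V) z := by
  induction z using TensorProduct.induction_on with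
  | zero => simp
  | add y y' hy hy' => rw [map_add, map_add, hy, hy', map_add]
  | tmul a r =>
    rw [Algebra.TensorProduct.map_tmul, restrict_residue_tmul, restrict_residue_tmul,
      TrivSqZeroExt.fst_map]
    rfl

variable {ι : Type} [Fintype ι] (b : Module.Basis ι ℂ V)

/-- The function with restriction `r` and components `g i` with respect to a basis of `V`. -/
def fatMk (r : Stalk (0 : Fin n → ℂ)) (g : ι → Stalk (0 : Fin n → ℂ)) : FatStalk n V :=
  (1 : TrivSqZeroExt ℂ V) ⊗ₜ r + ∑ i, (TrivSqZeroExt.inr (b i) : TrivSqZeroExt ℂ V) ⊗ₜ g i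

theorem restrict_fatMk (r : Stalk (0 : Fin n → ℂ)) (g : ι → Stalk (0 : Fin n → ℂ)) :
    restrict (residue V) (fatMk b r g) = r := by
  simp [fatMk, map_sum, restrict_inr_tmul, restrict_one_tmul]

theorem contract_fatMk (l : V →ₗ[ℂ] ℂ) (r : Stalk (0 : Fin n → ℂ))
    (g : ι → Stalk (0 : Fin n → ℂ)) : contract l (fatMk b r g) = ∑ i, l (b i) • g i := by
  simp [fatMk, map_sum, contract_inr_tmul, contract_one_tmul]

theorem contract_coord_fatMk (j : ι) (r : Stalk (0 : Fin n → ℂ))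
    (g : ι → Stalk (0 : Fin n → ℂ)) : contract (b.coord j) (fatMk b r g) = g j := by
  classical
  rw [contract_fatMk, Finset.sum_eq_single j]
  · simp
  · intro i _ hij
    simp [Finsupp.single_eq_of_ne' hij]
  · simp

theorem fatMk_restrict_contract (z : FatStalk n V) :
    fatMk b (restrict (residue V) z) (fun i => contract (b.coord i) z) = z := by
  induction z using TensorProduct.induction_on with
  | zero => simp [fatMk]
  | add y y' hy hy' =>
    conv_rhs => rw [← hy, ← hy']
    simp only [fatMk, map_add, TensorProduct.tmul_add, Finset.sum_add_distrib]
    abel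
  | tmul a r =>
    simp only [fatMk, restrict_residue_tmul, contract_tmul, ← TensorProduct.smul_tmul]
    rw [← TensorProduct.sum_tmul, ← TensorProduct.add_tmul]
    congr 1
    refine TrivSqZeroExt.ext ?_ ?_
    · simp [TrivSqZeroExt.fst_sum]
    · rw [TrivSqZeroExt.snd_add, TrivSqZeroExt.snd_sum]
      simp [b.sum_repr]

theorem eq_sum_contract (l : V →ₗ[ℂ] ℂ) (z : FatStalk n V) :
    contract l z = ∑ i, l (b i) • contract (b.coord i) z := by
  conv_lhs => rw [← fatMk_restrict_contract b z]
  rw [contract_fatMk]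

theorem fatStalk_ext {y z : FatStalk n V} (h : restrict (residue V) y = restrict (residue V) z)
    (h' : ∀ i, contract (b.coord i) y = contract (b.coord i) z) : y = z := by
  rw [← fatMk_restrict_contract b y, ← fatMk_restrict_contract b z, h]
  simp only [h']

/-- Membership in the ideal of an equation. -/
theorem mem_span_singleton_iff_contract {h : Stalk (0 : Fin n → ℂ)} {H y : FatStalk n V}
    (hH : restrict (residue V) H = h) :
    y ∈ Ideal.span {H} ↔ ∃ a, restrict (residue V) y = a * h ∧
      ∀ i, contract (b.coord i) y - a * contract (b.coord i) H ∈ Ideal.span {h} := by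
  constructor
  · intro hy
    obtain ⟨z, rfl⟩ := Ideal.mem_span_singleton'.1 hy
    refine ⟨restrict (residue V) z, by rw [map_mul, hH], fun i => ?_⟩
    rw [contract_mul, add_sub_cancel_left, hH]
    exact Ideal.mul_mem_right _ _ (Ideal.mem_span_singleton_self h)
  · rintro ⟨a, ha, hc⟩
    choose k hk using fun i => Ideal.mem_span_singleton'.1 (hc i)
    refine Ideal.mem_span_singleton'.2 ⟨fatMk b a k, fatStalk_ext b ?_ fun i => ?_⟩
    · rw [map_mul, restrict_fatMk, hH, ha]
    · rw [contract_mul, restrict_fatMk, contract_coord_fatMk, hH, mul_comm h, hk]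
      ring

theorem ker_restrict_eq (b : Module.Basis ι ℂ V) : RingHom.ker (restrict (n := n) (residue V)) =
    (RingHom.ker (residue V)).map (algebraMap (TrivSqZeroExt ℂ V) (FatStalk n V)) := by
  apply le_antisymm
  · intro z hz
    rw [← fatMk_restrict_contract b z, (RingHom.mem_ker).1 hz, fatMk, TensorProduct.tmul_zero,
      zero_add]
    refine Ideal.sum_mem _ fun i _ => ?_
    have h : (TrivSqZeroExt.inr (b i) : TrivSqZeroExt ℂ V) ⊗ₜ[ℂ] contract (b.coord i) z =
        algebraMap (TrivSqZeroExt ℂ V) (FatStalk n V) (TrivSqZeroExt.inr (b i)) *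
          ((1 : TrivSqZeroExt ℂ V) ⊗ₜ contract (b.coord i) z) := by
      rw [Algebra.TensorProduct.algebraMap_apply]
      simp
    rw [h]
    exact Ideal.mul_mem_right _ _ (Ideal.mem_map_of_mem _ (TrivSqZeroExt.fst_inr ℂ (b i)))
  · rw [Ideal.map_le_iff_le_comap]
    intro a ha
    rw [Ideal.mem_comap, RingHom.mem_ker, Algebra.TensorProduct.algebraMap_apply]
    have h1 : a.fst = 0 := ha
    change restrict (residue V) (a ⊗ₜ 1) = 0
    rw [restrict_residue_tmul, h1, zero_smul]

/-! ### Relative vector fields -/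

/-- The component of a relative vector field in the direction of a linear form on `V`. -/
def contractDer (l : V →ₗ[ℂ] ℂ) (Δ : Derivation (TrivSqZeroExt ℂ V) (FatStalk n V) (FatStalk n V)) :
    Der (0 : Fin n → ℂ) :=
  Derivation.mk'
    { toFun := fun g => contract l (Δ (1 ⊗ₜ g))
      map_add' := fun g h => by rw [TensorProduct.tmul_add, map_add, map_add]
      map_smul' := fun c g => by
        rw [TensorProduct.tmul_smul, ← algebraMap_smul (TrivSqZeroExt ℂ V) c
          ((1 : TrivSqZeroExt ℂ V) ⊗ₜ[ℂ] g), Δ.map_smul,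
          algebraMap_smul, map_smul, RingHom.id_apply] }
    (fun g h => by
      have e : (1 : TrivSqZeroExt ℂ V) ⊗ₜ[ℂ] (g * h) = (1 ⊗ₜ g) * (1 ⊗ₜ h) := by simp
      change contract l (Δ (1 ⊗ₜ (g * h))) =
        g * contract l (Δ (1 ⊗ₜ h)) + h * contract l (Δ (1 ⊗ₜ g))
      rw [e, Δ.leibniz, smul_eq_mul, smul_eq_mul, map_add, contract_mul, contract_mul]
      simp only [contract_one_tmul, restrict_one_tmul]
      ring)

theorem contractDer_apply (l : V →ₗ[ℂ] ℂ)
    (Δ : Derivation (TrivSqZeroExt ℂ V) (FatStalk n V) (FatStalk n V)) (g : Stalk (0 : Fin n → ℂ)) :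
    contractDer l Δ g = contract l (Δ (1 ⊗ₜ g)) := rfl

theorem restrictDer_apply {A : Type} [CommRing A] [Algebra ℂ A] (ρ : A →ₐ[ℂ] ℂ)
    (Δ : Derivation A (RelStalk n A) (RelStalk n A)) (g : Stalk (0 : Fin n → ℂ)) :
    restrictDer ρ Δ g = restrict ρ (Δ (1 ⊗ₜ g)) := rfl

theorem tmul_eq_smul {A : Type} [CommRing A] [Algebra ℂ A] (a : A) (r : Stalk (0 : Fin n → ℂ)) :
    a ⊗ₜ[ℂ] r = a • ((1 : A) ⊗ₜ[ℂ] r) := by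
  rw [TensorProduct.smul_tmul', smul_eq_mul, mul_one]

theorem restrict_der {A : Type} [CommRing A] [Algebra ℂ A] (ρ : A →ₐ[ℂ] ℂ)
    (Δ : Derivation A (RelStalk n A) (RelStalk n A)) (z : RelStalk n A) :
    restrict ρ (Δ z) = restrictDer ρ Δ (restrict ρ z) := by
  induction z using TensorProduct.induction_on with
  | zero => simp
  | add y y' hy hy' => rw [map_add, map_add, hy, hy', map_add, map_add]
  | tmul a r =>
    rw [tmul_eq_smul, Δ.map_smul, restrict_smul, restrict_smul, restrict_one_tmul,
      Derivation.map_smul, restrictDer_apply]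

theorem contract_der (l : V →ₗ[ℂ] ℂ)
    (Δ : Derivation (TrivSqZeroExt ℂ V) (FatStalk n V) (FatStalk n V)) (z : FatStalk n V) :
    contract l (Δ z) = contractDer l Δ (restrict (residue V) z) +
      restrictDer (residue V) Δ (contract l z) := by
  induction z using TensorProduct.induction_on with
  | zero => simp
  | add y y' hy hy' => simp only [map_add, hy, hy']; abel
  | tmul a r =>
    rw [tmul_eq_smul, Δ.map_smul, contract_smul, restrict_smul, restrict_one_tmul, contract_smul,
      contract_one_tmul, restrict_one_tmul, smul_zero, zero_add, Derivation.map_smul,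
      Derivation.map_smul, contractDer_apply, restrictDer_apply]
    rfl

/-- The relative vector field that is constant along the base. -/
def constDer (A : Type) [CommRing A] [Algebra ℂ A] (δ : Der (0 : Fin n → ℂ)) :
    Derivation A (RelStalk n A) (RelStalk n A) :=
  Derivation.mk' (LinearMap.baseChange A (δ : Stalk (0 : Fin n → ℂ) →ₗ[ℂ] Stalk (0 : Fin n → ℂ)))
    (fun y z => by
      induction y using TensorProduct.induction_on with
      | zero => simp
      | add y y' hy hy' => simp only [add_mul, map_add, hy, hy', add_smul, smul_add]; abel
      | tmul a r =>
        induction z using TensorProduct.induction_on with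
        | zero => simp
        | add z z' hz hz' => simp only [mul_add, map_add, hz, hz', add_smul, smul_add]; abel
        | tmul b s =>
          simp only [Algebra.TensorProduct.tmul_mul_tmul, LinearMap.baseChange_tmul, smul_eq_mul,
            Derivation.coeFn_coe, Derivation.leibniz, TensorProduct.tmul_add, mul_comm b a])

theorem constDer_tmul {A : Type} [CommRing A] [Algebra ℂ A] (δ : Der (0 : Fin n → ℂ)) (a : A)
    (r : Stalk (0 : Fin n → ℂ)) : constDer A δ (a ⊗ₜ r) = a ⊗ₜ δ r := rfl

/-- The relative vector field with restriction `δ` and components `ν i`. -/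
def fatDer (δ : Der (0 : Fin n → ℂ)) (ν : ι → Der (0 : Fin n → ℂ)) :
    Derivation (TrivSqZeroExt ℂ V) (FatStalk n V) (FatStalk n V) :=
  constDer _ δ + ∑ i, (TrivSqZeroExt.inr (b i) : TrivSqZeroExt ℂ V) • constDer _ (ν i)

theorem fatDer_one_tmul (δ : Der (0 : Fin n → ℂ)) (ν : ι → Der (0 : Fin n → ℂ))
    (r : Stalk (0 : Fin n → ℂ)) :
    fatDer b δ ν (1 ⊗ₜ r) = fatMk b (δ r) fun i => ν i r := by
  rw [fatDer, Derivation.add_apply, derivation_sum_apply, fatMk, constDer_tmul]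
  congr 1
  refine Finset.sum_congr rfl fun i _ => ?_
  rw [Derivation.smul_apply, constDer_tmul, ← tmul_eq_smul]

theorem restrictDer_fatDer (δ : Der (0 : Fin n → ℂ)) (ν : ι → Der (0 : Fin n → ℂ)) :
    restrictDer (residue V) (fatDer b δ ν) = δ := by
  ext r
  rw [restrictDer_apply, fatDer_one_tmul, restrict_fatMk]

theorem contractDer_fatDer (δ : Der (0 : Fin n → ℂ)) (ν : ι → Der (0 : Fin n → ℂ)) (j : ι) :
    contractDer (b.coord j) (fatDer b δ ν) = ν j := by
  ext r
  rw [contractDer_apply, fatDer_one_tmul, contract_coord_fatMk]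

theorem relDer_ext {A : Type} [CommRing A] [Algebra ℂ A]
    {Δ Δ' : Derivation A (RelStalk n A) (RelStalk n A)}
    (h : ∀ r, Δ (1 ⊗ₜ r) = Δ' (1 ⊗ₜ r)) : Δ = Δ' := by
  ext z
  induction z using TensorProduct.induction_on with
  | zero => simp
  | add y y' hy hy' => rw [map_add, map_add, hy, hy']
  | tmul a r => rw [tmul_eq_smul, Δ.map_smul, Δ'.map_smul, h]

end FirstOrder

/-! ### Perturbations of an equation -/

section Perturbation

variable {n : ℕ}

/-- The ideal generated by an equation and its partial derivatives, written as the set of all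
`σ(h) + c h` for vector fields `σ` and functions `c`: the perturbations of `h` that are
infinitesimally trivial. -/
def tjurina (h : Stalk (0 : Fin n → ℂ)) : Ideal (Stalk (0 : Fin n → ℂ)) where
  carrier := {g | ∃ (σ : Der (0 : Fin n → ℂ)) (c : Stalk (0 : Fin n → ℂ)), g = σ h + c * h}
  add_mem' := by
    rintro _ _ ⟨σ, c, rfl⟩ ⟨σ', c', rfl⟩
    exact ⟨σ + σ', c + c', by rw [Derivation.add_apply]; ring⟩
  zero_mem' := ⟨0, 0, by simp⟩
  smul_mem' := by
    rintro a _ ⟨σ, c, rfl⟩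
    exact ⟨a • σ, a * c, by simp only [Derivation.smul_apply, smul_eq_mul]; ring⟩

theorem mem_tjurina {h g : Stalk (0 : Fin n → ℂ)} :
    g ∈ tjurina h ↔ ∃ (σ : Der (0 : Fin n → ℂ)) (c : Stalk (0 : Fin n → ℂ)), g = σ h + c * h :=
  Iff.rfl

theorem mem_tjurina_iff_sub_mem_span {h g : Stalk (0 : Fin n → ℂ)} :
    g ∈ tjurina h ↔ ∃ σ : Der (0 : Fin n → ℂ), g - σ h ∈ Ideal.span {h} := by
  rw [mem_tjurina]
  refine exists_congr fun σ => ?_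
  rw [Ideal.mem_span_singleton']
  exact exists_congr fun c => by rw [eq_sub_iff_add_eq', eq_comm]

/-- The perturbations `g` for which every logarithmic vector field `δ` of `h`, with `δ(h) = a h`,
extends to a logarithmic vector field `δ - ε σ` of `h + ε g`. -/
def admissiblePerturbation (h : Stalk (0 : Fin n → ℂ)) :
    Submodule ℂ (Stalk (0 : Fin n → ℂ)) where
  carrier := {g | ∀ (δ : Der (0 : Fin n → ℂ)) (a : Stalk (0 : Fin n → ℂ)), δ h = a * h →
    δ g - a * g ∈ tjurina h}
  add_mem' := fun {g g'} hg hg' δ a ha => by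
    have := (tjurina h).add_mem (hg δ a ha) (hg' δ a ha)
    rw [map_add, mul_add]
    convert this using 1
    ring
  zero_mem' := fun δ a _ => by simp
  smul_mem' := fun c g hg δ a ha => by
    rw [Derivation.map_smul, mul_smul_comm, ← smul_sub, Algebra.smul_def]
    exact Ideal.mul_mem_left _ _ (hg δ a ha)

theorem exists_mul_of_mem_logDer {h : Stalk (0 : Fin n → ℂ)} {δ : Der (0 : Fin n → ℂ)}
    (hδ : δ ∈ logDer ℂ (Ideal.span {h})) : ∃ a, δ h = a * h := by
  obtain ⟨a, ha⟩ := Ideal.mem_span_singleton'.1 ((mem_logDer_span_singleton h δ).1 hδ)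
  exact ⟨a, ha.symm⟩

theorem mem_logDer_of_mul {h a : Stalk (0 : Fin n → ℂ)} {δ : Der (0 : Fin n → ℂ)}
    (hδ : δ h = a * h) : δ ∈ logDer ℂ (Ideal.span {h}) :=
  (mem_logDer_span_singleton h δ).2 (Ideal.mem_span_singleton'.2 ⟨a, hδ.symm⟩)

end Perturbation

/-! ### Flatness over a first order base -/

section Flatness

variable {n : ℕ} {V : Type} [AddCommGroup V] [Module ℂ V] [Module ℂᵐᵒᵖ V] [IsCentralScalar ℂ V]
  {ι : Type} [Fintype ι]

theorem restrict_surjective {A : Type} [CommRing A] [Algebra ℂ A] (ρ : A →ₐ[ℂ] ℂ) :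
    Function.Surjective (restrict (n := n) ρ) := fun r => ⟨1 ⊗ₜ r, restrict_one_tmul ρ r⟩

/-- The equational criterion of flatness, applied to relations among the basis elements of `V`. -/
theorem mem_map_restrict_of_sum_mem (b : Module.Basis ι ℂ V) (J : Ideal (FatStalk n V))
    [Module.Flat (TrivSqZeroExt ℂ V) (FatStalk n V ⧸ J)] (x : ι → Stalk (0 : Fin n → ℂ))
    (hx : fatMk b 0 x ∈ J) (i : ι) : x i ∈ J.map (restrict (n := n) (residue V)) := by
  have h0 : ∑ i, (TrivSqZeroExt.inr (b i) : TrivSqZeroExt ℂ V) •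
      Ideal.Quotient.mk J ((1 : TrivSqZeroExt ℂ V) ⊗ₜ x i) = 0 := by
    rw [← Ideal.Quotient.eq_zero_iff_mem.2 hx, fatMk, TensorProduct.tmul_zero, zero_add, map_sum]
    refine Finset.sum_congr rfl fun i _ => ?_
    rw [tmul_eq_smul (TrivSqZeroExt.inr (b i) : TrivSqZeroExt ℂ V)]
    rfl
  obtain ⟨k, a, y, h1, h2⟩ := Module.Flat.isTrivialRelation_of_sum_smul_eq_zero h0
  choose Y hY using fun j => Ideal.Quotient.mk_surjective (y j)
  have h3 : ∀ i j, (a i j).fst = 0 := by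
    intro i j
    have h4 := congrArg TrivSqZeroExt.snd (h2 j)
    rw [TrivSqZeroExt.snd_sum, TrivSqZeroExt.snd_zero] at h4
    refine Fintype.linearIndependent_iff.1 b.linearIndependent (fun i => (a i j).fst) ?_ i
    rw [← h4]
    refine Finset.sum_congr rfl fun i _ => ?_
    rw [TrivSqZeroExt.snd_mul, TrivSqZeroExt.fst_inr, TrivSqZeroExt.snd_inr, zero_smul, zero_add,
      op_smul_eq_smul]
  have h5 : (1 : TrivSqZeroExt ℂ V) ⊗ₜ x i - ∑ j, a i j • Y j ∈ J := by
    rw [← Ideal.Quotient.eq]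
    refine (h1 i).trans ?_
    rw [map_sum]
    refine Finset.sum_congr rfl fun j _ => ?_
    rw [← hY]
    rfl
  have h6 := Ideal.mem_map_of_mem (restrict (n := n) (residue V)) h5
  rw [map_sub, restrict_one_tmul, map_sum] at h6
  rwa [Finset.sum_eq_zero, sub_zero] at h6
  intro j _
  rw [restrict_smul]
  have : residue V (a i j) = 0 := h3 i j
  rw [this, zero_smul]

/-- A flat deformation of a hypersurface is a hypersurface. -/
theorem exists_equation (b : Module.Basis ι ℂ V) (J : Ideal (FatStalk n V))
    [Module.Flat (TrivSqZeroExt ℂ V) (FatStalk n V ⧸ J)] {h : Stalk (0 : Fin n → ℂ)}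
    (hJ : J.map (restrict (n := n) (residue V)) = Ideal.span {h}) :
    ∃ H, restrict (residue V) H = h ∧ J = Ideal.span {H} := by
  have h1 : h ∈ J.map (restrict (n := n) (residue V)) :=
    hJ ▸ Ideal.mem_span_singleton_self h
  obtain ⟨H, hH, hHh⟩ := (Ideal.mem_map_iff_of_surjective _ (restrict_surjective _)).1 h1
  refine ⟨H, hHh, le_antisymm (fun y hy => ?_) ((Ideal.span_singleton_le_iff_mem J).2 hH)⟩
  have h2 := Ideal.mem_map_of_mem (restrict (n := n) (residue V)) hy
  rw [hJ] at h2
  obtain ⟨a, ha⟩ := Ideal.mem_span_singleton'.1 h2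
  refine (mem_span_singleton_iff_contract b hHh).2 ⟨a, ha.symm, fun i => ?_⟩
  rw [← hJ]
  refine mem_map_restrict_of_sum_mem b J
    (fun i => contract (b.coord i) y - a * contract (b.coord i) H) ?_ i
  have h3 : fatMk b 0 (fun i => contract (b.coord i) y - a * contract (b.coord i) H) =
      y - ((1 : TrivSqZeroExt ℂ V) ⊗ₜ a) * H := by
    refine fatStalk_ext b ?_ fun i => ?_
    · rw [restrict_fatMk, map_sub, map_mul, hHh, restrict_one_tmul]
      exact (sub_eq_zero.2 ha.symm).symm
    · rw [contract_coord_fatMk, map_sub, contract_mul, contract_one_tmul, restrict_one_tmul]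
      ring
  rw [h3]
  exact J.sub_mem hy (J.mul_mem_left _ hH)

/-- If `W` is a complement of `(h)` in the function ring of `ℂⁿ`, then the function ring of a
deformation of `V(h)` is `A ⊗ W`, which is free over `A`. -/
theorem flat_quotient_span (b : Module.Basis ι ℂ V) {h : Stalk (0 : Fin n → ℂ)} (hh : h ≠ 0)
    {H : FatStalk n V} (hH : restrict (residue V) H = h) :
    Module.Flat (TrivSqZeroExt ℂ V) (FatStalk n V ⧸ Ideal.span {H}) := by
  obtain ⟨W, hW⟩ := Submodule.exists_isCompl ((Ideal.span {h}).restrictScalars ℂ)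
  have hdis : ∀ r, r ∈ Ideal.span {h} → r ∈ W → r = 0 := fun r h1 h2 =>
    Submodule.disjoint_def.1 hW.disjoint r h1 h2
  set Ψ : TrivSqZeroExt ℂ V ⊗[ℂ] W →ₗ[TrivSqZeroExt ℂ V] FatStalk n V :=
    LinearMap.baseChange (TrivSqZeroExt ℂ V) W.subtype with hΨ
  have hr : ∀ z, restrict (residue V) (Ψ z) ∈ W := by
    intro z
    induction z using TensorProduct.induction_on with
    | zero => simp
    | add y y' hy hy' => rw [map_add, map_add]; exact W.add_mem hy hy'
    | tmul a r =>
      rw [hΨ, LinearMap.baseChange_tmul, restrict_tmul]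
      exact W.smul_mem _ r.2
  have hc : ∀ l z, contract l (Ψ z) ∈ W := by
    intro l z
    induction z using TensorProduct.induction_on with
    | zero => simp
    | add y y' hy hy' => rw [map_add, map_add]; exact W.add_mem hy hy'
    | tmul a r =>
      rw [hΨ, LinearMap.baseChange_tmul, contract_tmul]
      exact W.smul_mem _ r.2
  have hinj : Function.Injective Ψ :=
    Module.Flat.lTensor_preserves_injective_linearMap (M := TrivSqZeroExt ℂ V) W.subtype
      W.injective_subtype
  set Φ : TrivSqZeroExt ℂ V ⊗[ℂ] W →ₗ[TrivSqZeroExt ℂ V] FatStalk n V ⧸ Ideal.span {H} :=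
    (Ideal.Quotient.mkₐ (TrivSqZeroExt ℂ V) (Ideal.span {H})).toLinearMap ∘ₗ Ψ
  have hΦ : ∀ z, Φ z = Ideal.Quotient.mk _ (Ψ z) := fun _ => rfl
  refine Module.Flat.of_linearEquiv (LinearEquiv.ofBijective Φ ⟨?_, ?_⟩).symm
  · rw [← LinearMap.ker_eq_bot, LinearMap.ker_eq_bot']
    intro z hz
    rw [hΦ, Ideal.Quotient.eq_zero_iff_mem, mem_span_singleton_iff_contract b hH] at hz
    obtain ⟨a, ha, hza⟩ := hz
    have h0 := hdis _ (Ideal.mem_span_singleton'.2 ⟨a, ha.symm⟩) (hr z)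
    have ha0 : a = 0 := (mul_eq_zero.1 (ha.symm.trans h0)).resolve_right hh
    apply hinj
    rw [map_zero]
    refine fatStalk_ext b (h0.trans (map_zero _).symm) fun i => ?_
    have := hza i
    rw [ha0, zero_mul, sub_zero] at this
    rw [hdis _ this (hc _ z), map_zero]
  · intro y
    obtain ⟨y, rfl⟩ := Ideal.Quotient.mk_surjective y
    have hsplit : ∀ r : Stalk (0 : Fin n → ℂ), ∃ w : W, r - w ∈ Ideal.span {h} := by
      intro r
      have : r ∈ ((Ideal.span {h}).restrictScalars ℂ) ⊔ W := hW.sup_eq_top ▸ Submodule.mem_top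
      obtain ⟨s, hs, w, hw, rfl⟩ := Submodule.mem_sup.1 this
      exact ⟨⟨w, hw⟩, by simpa using hs⟩
    obtain ⟨w, hw⟩ := hsplit (restrict (residue V) y)
    obtain ⟨a, ha⟩ := Ideal.mem_span_singleton'.1 hw
    choose u hu using fun i => hsplit (contract (b.coord i) y - a * contract (b.coord i) H)
    refine ⟨(1 : TrivSqZeroExt ℂ V) ⊗ₜ w +
      ∑ i, (TrivSqZeroExt.inr (b i) : TrivSqZeroExt ℂ V) ⊗ₜ u i, ?_⟩
    have hm : Ψ ((1 : TrivSqZeroExt ℂ V) ⊗ₜ w +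
        ∑ i, (TrivSqZeroExt.inr (b i) : TrivSqZeroExt ℂ V) ⊗ₜ u i) =
        fatMk b (w : Stalk (0 : Fin n → ℂ)) fun i => u i := by
      rw [map_add, map_sum]
      rfl
    rw [hΦ, hm, eq_comm, Ideal.Quotient.eq, mem_span_singleton_iff_contract b hH]
    refine ⟨a, ?_, fun i => ?_⟩
    · rw [map_sub, restrict_fatMk, ha]
    · rw [map_sub, contract_coord_fatMk, sub_right_comm]
      exact hu i

theorem mem_logDer_span_iff (b : Module.Basis ι ℂ V) {h : Stalk (0 : Fin n → ℂ)}
    {H : FatStalk n V} (hH : restrict (residue V) H = h)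
    (Δ : Derivation (TrivSqZeroExt ℂ V) (FatStalk n V) (FatStalk n V)) :
    Δ ∈ logDer (TrivSqZeroExt ℂ V) (Ideal.span {H}) ↔
      ∃ a, restrictDer (residue V) Δ h = a * h ∧
        ∀ i, contractDer (b.coord i) Δ h + (restrictDer (residue V) Δ (contract (b.coord i) H) -
          a * contract (b.coord i) H) ∈ Ideal.span {h} := by
  rw [mem_logDer_span_singleton, mem_span_singleton_iff_contract b hH]
  simp only [restrict_der, contract_der, hH, add_sub_assoc]

theorem map_restrict_span {h : Stalk (0 : Fin n → ℂ)}
    {H : FatStalk n V} (hH : restrict (residue V) H = h) :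
    (Ideal.span {H}).map (restrict (n := n) (residue V)) = Ideal.span {h} := by
  rw [Ideal.map_span, Set.image_singleton, hH]

theorem restrict_mem_span {h : Stalk (0 : Fin n → ℂ)} {H z : FatStalk n V}
    (hH : restrict (residue V) H = h) (hz : z ∈ Ideal.span {H}) :
    restrict (residue V) z ∈ Ideal.span {h} := by
  rw [← map_restrict_span hH]
  exact Ideal.mem_map_of_mem _ hz

theorem contract_mem_of_basis (b : Module.Basis ι ℂ V) {H : FatStalk n V}
    {K : Submodule ℂ (Stalk (0 : Fin n → ℂ))} (hK : ∀ i, contract (b.coord i) H ∈ K)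
    (l : V →ₗ[ℂ] ℂ) : contract l H ∈ K := by
  rw [eq_sum_contract b]
  exact K.sum_mem fun i _ => K.smul_mem _ (hK i)

/-- Logarithmic vector fields extend to an admissible perturbation. -/
theorem exists_logDer_lift (b : Module.Basis ι ℂ V) {h : Stalk (0 : Fin n → ℂ)}
    {H : FatStalk n V} (hH : restrict (residue V) H = h)
    (hK : ∀ l, contract l H ∈ admissiblePerturbation h) {η : Der (0 : Fin n → ℂ)}
    (hη : η ∈ logDer ℂ (Ideal.span {h})) :
    ∃ Δ ∈ logDer (TrivSqZeroExt ℂ V) (Ideal.span {H}), restrictDer (residue V) Δ = η := by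
  obtain ⟨a, ha⟩ := exists_mul_of_mem_logDer hη
  choose σ hσ using fun i => mem_tjurina_iff_sub_mem_span.1 (hK (b.coord i) η a ha)
  refine ⟨fatDer b η fun i => -σ i, (mem_logDer_span_iff b hH _).2 ⟨a, ?_, fun i => ?_⟩,
    restrictDer_fatDer b _ _⟩
  · rw [restrictDer_fatDer, ha]
  · rw [restrictDer_fatDer, contractDer_fatDer, Derivation.neg_apply, neg_add_eq_sub]
    exact hσ i

/-- A relative logarithmic vector field that vanishes on the central fibre has logarithmic
components. -/
theorem mem_smul_logDer (b : Module.Basis ι ℂ V) {h : Stalk (0 : Fin n → ℂ)} (hh : h ≠ 0)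
    {H : FatStalk n V} (hH : restrict (residue V) H = h)
    (hK : ∀ l, contract l H ∈ admissiblePerturbation h)
    {Δ : Derivation (TrivSqZeroExt ℂ V) (FatStalk n V) (FatStalk n V)}
    (hΔ : Δ ∈ logDer (TrivSqZeroExt ℂ V) (Ideal.span {H}))
    (h0 : restrictDer (residue V) Δ = 0) :
    Δ ∈ (RingHom.ker (residue V)).map (algebraMap (TrivSqZeroExt ℂ V) (FatStalk n V)) •
      logDer (TrivSqZeroExt ℂ V) (Ideal.span {H}) := by
  obtain ⟨a, ha, hc⟩ := (mem_logDer_span_iff b hH _).1 hΔ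
  simp only [h0, Derivation.zero_apply] at ha hc
  have ha0 : a = 0 := (mul_eq_zero.1 ha.symm).resolve_right hh
  simp only [ha0, zero_mul, sub_zero, add_zero] at hc
  choose E hE hE' using fun i => exists_logDer_lift b hH hK
    ((mem_logDer_span_singleton h (contractDer (b.coord i) Δ)).2 (hc i))
  have hsum : Δ = ∑ i, (algebraMap (TrivSqZeroExt ℂ V) (FatStalk n V)
      (TrivSqZeroExt.inr (b i) : TrivSqZeroExt ℂ V)) • E i := by
    refine relDer_ext fun r => ?_
    rw [derivation_sum_apply]
    simp only [Derivation.smul_apply, algebraMap_smul]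
    classical
    refine fatStalk_ext b ?_ fun j => ?_
    · rw [← restrictDer_apply, h0, map_sum]
      simp only [restrict_smul, TrivSqZeroExt.fstHom_apply, TrivSqZeroExt.fst_inr, zero_smul,
        Finset.sum_const_zero, Derivation.zero_apply]
    · rw [map_sum]
      simp only [contract_smul, TrivSqZeroExt.fst_inr, zero_smul, zero_add, TrivSqZeroExt.snd_inr,
        ← restrictDer_apply, hE']
      rw [Finset.sum_eq_single j]
      · simp [contractDer_apply]
      · intro i _ hij
        simp [Finsupp.single_eq_of_ne' hij]
      · simp
  rw [hsum]
  exact Submodule.sum_mem _ fun i _ => Submodule.smul_mem_smul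
    (Ideal.mem_map_of_mem _ (TrivSqZeroExt.fst_inr ℂ (b i))) (hE i)

end Flatness

/-! ### The deformation defined by an equation -/

section OfEquation

variable {n : ℕ} {V : Type} [AddCommGroup V] [Module ℂ V] [Module ℂᵐᵒᵖ V] [IsCentralScalar ℂ V]
  [Module.Finite ℂ V] {f : (Fin n → ℂ) → ℂ}

/-- The deformation of `V(f)` with the equation `H`, with its standard embedding of `V(f)`. -/
def ofEquation (hf : germ f 0 ≠ 0) (H : FatStalk n V)
    (hH : restrict (residue V) H = germ f 0)
    (hK : ∀ l, contract l H ∈ admissiblePerturbation (germ f 0)) :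
    AdmissibleDeformation f (residue V) where
  ideal := Ideal.span {H}
  flat := flat_quotient_span (Module.finBasis ℂ V) hf hH
  emb := (Ideal.Quotient.mkₐ ℂ (Ideal.span {germ f 0})).comp (restrict (residue V))
  emb_surjective := Ideal.Quotient.mk_surjective.comp (restrict_surjective _)
  ker_emb := by
    rw [← ker_restrict_eq (Module.finBasis ℂ V)]
    apply le_antisymm
    · intro z hz
      obtain ⟨a, ha⟩ := Ideal.mem_span_singleton'.1
        (Ideal.Quotient.eq_zero_iff_mem.1 ((RingHom.mem_ker).1 hz))
      rw [← add_sub_cancel (((1 : TrivSqZeroExt ℂ V) ⊗ₜ a) * H) z]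
      refine Ideal.add_mem _ (Ideal.mem_sup_left
        (Ideal.mul_mem_left _ _ (Ideal.mem_span_singleton_self H))) (Ideal.mem_sup_right ?_)
      rw [RingHom.mem_ker, map_sub, map_mul, restrict_one_tmul, hH, ha]
      exact sub_self _
    · refine sup_le ?_ ?_
      · intro z hz
        exact Ideal.Quotient.eq_zero_iff_mem.2 (restrict_mem_span hH hz)
      · intro z hz
        refine Ideal.Quotient.eq_zero_iff_mem.2 ?_
        exact (RingHom.mem_ker.1 hz).symm ▸ Ideal.zero_mem (Ideal.span {germ f 0})
  image_logDer := fun η => by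
    rw [map_restrict_span hH]
    refine ⟨exists_logDer_lift (Module.finBasis ℂ V) hH hK, ?_⟩
    rintro ⟨Δ, hΔ, rfl⟩
    obtain ⟨a, ha, -⟩ := (mem_logDer_span_iff (Module.finBasis ℂ V) hH Δ).1 hΔ
    exact mem_logDer_of_mul ha
  ker_logDer := fun _ hΔ h0 => mem_smul_logDer (Module.finBasis ℂ V) hf hH hK hΔ h0

end OfEquation

/-! ### Normal form of a deformation -/

section NormalForm

variable {n : ℕ} {V : Type} [AddCommGroup V] [Module ℂ V] [Module ℂᵐᵒᵖ V] [IsCentralScalar ℂ V]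
  [Module.Finite ℂ V] {f : (Fin n → ℂ) → ℂ}

/-- Conjugation of a derivation by an automorphism. -/
def conjDer {k R : Type} [CommRing k] [CommRing R] [Algebra k R] (e : R ≃ₐ[k] R)
    (δ : Derivation k R R) : Derivation k R R :=
  Derivation.mk' (e.toLinearMap ∘ₗ (δ : R →ₗ[k] R) ∘ₗ e.symm.toLinearMap) (fun r s => by
    simp only [LinearMap.comp_apply, AlgEquiv.toLinearMap_apply, Derivation.coeFn_coe, map_mul,
      Derivation.leibniz, smul_eq_mul, map_add, AlgEquiv.apply_symm_apply])

theorem conjDer_apply {k R : Type} [CommRing k] [CommRing R] [Algebra k R] (e : R ≃ₐ[k] R)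
    (δ : Derivation k R R) (r : R) : conjDer e δ r = e (δ (e.symm r)) := rfl

theorem conjDer_mem_logDer {k R : Type} [CommRing k] [CommRing R] [Algebra k R] {e : R ≃ₐ[k] R}
    {δ : Derivation k R R} {I J : Ideal R} (hIJ : ∀ r, e r ∈ J ↔ r ∈ I) (hδ : δ ∈ logDer k I) :
    conjDer e δ ∈ logDer k J := fun r hr => by
  rw [conjDer_apply, hIJ]
  refine hδ _ ?_
  rwa [← hIJ, AlgEquiv.apply_symm_apply]

theorem mem_map_algEquiv_iff {k R : Type} [CommRing k] [CommRing R] [Algebra k R] (e : R ≃ₐ[k] R)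
    (I : Ideal R) (z : R) : z ∈ I.map (e : R →+* R) ↔ ∃ y ∈ I, e y = z :=
  Ideal.mem_map_iff_of_surjective (e : R →+* R) e.surjective

/-- The automorphism of `ℂⁿ × S` induced by an automorphism of `ℂⁿ`. -/
def fatEquiv (A : Type) [CommRing A] [Algebra ℂ A]
    (θ : Stalk (0 : Fin n → ℂ) ≃ₐ[ℂ] Stalk (0 : Fin n → ℂ)) : RelStalk n A ≃ₐ[A] RelStalk n A :=
  Algebra.TensorProduct.congr AlgEquiv.refl θ

theorem fatEquiv_tmul {A : Type} [CommRing A] [Algebra ℂ A]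
    (θ : Stalk (0 : Fin n → ℂ) ≃ₐ[ℂ] Stalk (0 : Fin n → ℂ)) (a : A) (r : Stalk (0 : Fin n → ℂ)) :
    fatEquiv A θ (a ⊗ₜ r) = a ⊗ₜ θ r := rfl

theorem restrict_fatEquiv {A : Type} [CommRing A] [Algebra ℂ A] (ρ : A →ₐ[ℂ] ℂ)
    (θ : Stalk (0 : Fin n → ℂ) ≃ₐ[ℂ] Stalk (0 : Fin n → ℂ)) (z : RelStalk n A) :
    restrict ρ (fatEquiv A θ z) = θ (restrict ρ z) := by
  induction z using TensorProduct.induction_on with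
  | zero => simp
  | add y y' hy hy' => rw [map_add, map_add, hy, hy', map_add, map_add]
  | tmul a r => rw [fatEquiv_tmul, restrict_tmul, restrict_tmul, map_smul]

theorem map_fatEquiv {A B : Type} [CommRing A] [Algebra ℂ A] [CommRing B] [Algebra ℂ B]
    (φ : A →ₐ[ℂ] B) (θ : Stalk (0 : Fin n → ℂ) ≃ₐ[ℂ] Stalk (0 : Fin n → ℂ)) (z : RelStalk n A) :
    fatEquiv B θ (Algebra.TensorProduct.map φ (AlgHom.id ℂ (Stalk (0 : Fin n → ℂ))) z) =
      Algebra.TensorProduct.map φ (AlgHom.id ℂ (Stalk (0 : Fin n → ℂ))) (fatEquiv A θ z) := by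
  induction z using TensorProduct.induction_on with
  | zero => simp
  | add y y' hy hy' => simp only [map_add, hy, hy']
  | tmul a r => rfl

theorem emb_eq_of_restrict (X : AdmissibleDeformation f (residue V)) (z : FatStalk n V) :
    X.emb z = X.emb (1 ⊗ₜ restrict (residue V) z) := by
  rw [← sub_eq_zero, ← map_sub, ← RingHom.mem_ker, X.ker_emb,
    ← ker_restrict_eq (Module.finBasis ℂ V)]
  refine Ideal.mem_sup_right ?_
  rw [RingHom.mem_ker, map_sub, restrict_one_tmul, sub_self]

/-- The automorphism `θ` of `ℂⁿ` lifts the embedding of `D` into `X`, and carries `X` to the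
deformation with the equation `H`. -/
structure IsNormalForm (X : AdmissibleDeformation f (residue V))
    (θ : Stalk (0 : Fin n → ℂ) ≃ₐ[ℂ] Stalk (0 : Fin n → ℂ)) (H : FatStalk n V) : Prop where
  mk_apply : ∀ r, Ideal.Quotient.mk (Ideal.span {germ f 0}) (θ r) = X.emb (1 ⊗ₜ r)
  restrict_eq : restrict (residue V) H = germ f 0
  mem_iff : ∀ z, fatEquiv _ θ z ∈ Ideal.span {H} ↔ z ∈ X.ideal

theorem mem_map_restrict_iff {X : AdmissibleDeformation f (residue V)}
    {θ : Stalk (0 : Fin n → ℂ) ≃ₐ[ℂ] Stalk (0 : Fin n → ℂ)}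
    (hθ : ∀ r, Ideal.Quotient.mk (Ideal.span {germ f 0}) (θ r) = X.emb (1 ⊗ₜ r))
    (r : Stalk (0 : Fin n → ℂ)) :
    θ r ∈ Ideal.span {germ f 0} ↔ r ∈ X.ideal.map (restrict (n := n) (residue V)) := by
  rw [← Ideal.Quotient.eq_zero_iff_mem, hθ, ← RingHom.mem_ker, X.ker_emb,
    ← ker_restrict_eq (Module.finBasis ℂ V), Ideal.mem_map_iff_of_surjective _
      (restrict_surjective _), Submodule.mem_sup]
  constructor
  · rintro ⟨y, hy, z, hz, hyz⟩
    refine ⟨y, hy, ?_⟩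
    have := congrArg (restrict (residue V)) hyz
    rwa [map_add, restrict_one_tmul, (RingHom.mem_ker).1 hz, add_zero] at this
  · rintro ⟨y, hy, hyr⟩
    refine ⟨y, hy, (1 : TrivSqZeroExt ℂ V) ⊗ₜ r - y, ?_, by abel⟩
    rw [RingHom.mem_ker, map_sub, restrict_one_tmul, hyr]
    exact sub_self r

theorem exists_isNormalForm (hf : value 0 (germ f 0) = 0)
    (X : AdmissibleDeformation f (residue V)) : ∃ θ H, IsNormalForm X θ H := by
  obtain ⟨θ, hθ⟩ := exists_algEquiv_lift hf rfl
    (X.emb.comp Algebra.TensorProduct.includeRight) (fun q => by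
      obtain ⟨z, rfl⟩ := X.emb_surjective q
      exact ⟨restrict (residue V) z, (emb_eq_of_restrict X z).symm⟩)
  replace hθ : ∀ r, Ideal.Quotient.mk (Ideal.span {germ f 0}) (θ r) = X.emb (1 ⊗ₜ r) := hθ
  set Θ := fatEquiv (TrivSqZeroExt ℂ V) θ with hΘ
  set J : Ideal (FatStalk n V) := X.ideal.map (Θ : FatStalk n V →+* FatStalk n V) with hJ
  have hmem : ∀ z, Θ z ∈ J ↔ z ∈ X.ideal := fun z => by
    rw [hJ, mem_map_algEquiv_iff]
    refine ⟨?_, fun hz => ⟨z, hz, rfl⟩⟩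
    rintro ⟨y, hy, hyz⟩
    rwa [← Θ.injective hyz]
  have hflat : Module.Flat (TrivSqZeroExt ℂ V) (FatStalk n V ⧸ J) :=
    have := X.flat
    Module.Flat.of_linearEquiv (Ideal.quotientEquivAlg X.ideal J Θ hJ).symm.toLinearEquiv
  have hmap : J.map (restrict (n := n) (residue V)) = Ideal.span {germ f 0} := by
    ext r
    rw [← θ.apply_symm_apply r, mem_map_restrict_iff hθ,
      Ideal.mem_map_iff_of_surjective _ (restrict_surjective _),
      Ideal.mem_map_iff_of_surjective _ (restrict_surjective _)]
    constructor
    · rintro ⟨y, hy, hyr⟩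
      refine ⟨Θ.symm y, (hmem _).1 (by rwa [AlgEquiv.apply_symm_apply]), θ.injective ?_⟩
      rw [← hyr, ← restrict_fatEquiv, ← hΘ, AlgEquiv.apply_symm_apply]
    · rintro ⟨y, hy, hyr⟩
      exact ⟨Θ y, (hmem _).2 hy, by rw [hΘ, restrict_fatEquiv, hyr]⟩
  obtain ⟨H, hH, hJH⟩ := exists_equation (Module.finBasis ℂ V) J hmap
  exact ⟨θ, H, hθ, hH, fun z => hJH ▸ hmem z⟩

theorem IsNormalForm.contract_mem {X : AdmissibleDeformation f (residue V)}
    {θ : Stalk (0 : Fin n → ℂ) ≃ₐ[ℂ] Stalk (0 : Fin n → ℂ)} {H : FatStalk n V}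
    (hX : IsNormalForm X θ H) (hf : germ f 0 ≠ 0) (l : V →ₗ[ℂ] ℂ) :
    contract l H ∈ admissiblePerturbation (germ f 0) := by
  refine contract_mem_of_basis (Module.finBasis ℂ V) (fun i => ?_) l
  intro δ a ha
  have h1 : conjDer θ.symm δ ∈ logDer ℂ (X.ideal.map (restrict (n := n) (residue V))) := by
    refine conjDer_mem_logDer (fun r => ?_) (mem_logDer_of_mul ha)
    rw [← mem_map_restrict_iff hX.mk_apply, AlgEquiv.apply_symm_apply]
  obtain ⟨Δ, hΔ, hr⟩ := (X.image_logDer _).1 h1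
  have h2 := conjDer_mem_logDer hX.mem_iff hΔ
  have h3 : restrictDer (residue V) (conjDer (fatEquiv _ θ) Δ) = δ := by
    ext r
    have h4 := DFunLike.congr_fun hr (θ.symm r)
    rw [restrictDer_apply, conjDer_apply, AlgEquiv.symm_symm, AlgEquiv.apply_symm_apply] at h4
    rw [restrictDer_apply, conjDer_apply, restrict_fatEquiv]
    refine (congrArg θ h4).trans ?_
    rw [AlgEquiv.apply_symm_apply]
  obtain ⟨a', ha', hc⟩ := (mem_logDer_span_iff (Module.finBasis ℂ V) hX.restrict_eq _).1 h2
  rw [h3] at ha' hc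
  rw [mul_right_cancel₀ hf (ha.symm.trans ha'), mem_tjurina_iff_sub_mem_span]
  refine ⟨-contractDer ((Module.finBasis ℂ V).coord i) (conjDer (fatEquiv _ θ) Δ), ?_⟩
  rw [Derivation.neg_apply, sub_neg_eq_add, add_comm]
  exact hc i

theorem IsNormalForm.mk_eq {X : AdmissibleDeformation f (residue V)}
    {θ : Stalk (0 : Fin n → ℂ) ≃ₐ[ℂ] Stalk (0 : Fin n → ℂ)} {H : FatStalk n V}
    (hX : IsNormalForm X θ H) (hf : germ f 0 ≠ 0) :
    (Quotient.mk (isoSetoid f (residue V)) X : FD f (residue V)) =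
      Quotient.mk _ (ofEquation hf H hX.restrict_eq (hX.contract_mem hf)) := by
  refine Quotient.sound ?_
  have hJ : Ideal.span {H} = X.ideal.map
      (fatEquiv (TrivSqZeroExt ℂ V) θ : FatStalk n V →+* FatStalk n V) := by
    ext z
    rw [mem_map_algEquiv_iff]
    constructor
    · intro hz
      exact ⟨(fatEquiv _ θ).symm z, by rwa [← hX.mem_iff, AlgEquiv.apply_symm_apply],
        AlgEquiv.apply_symm_apply _ z⟩
    · rintro ⟨y, hy, rfl⟩
      exact (hX.mem_iff y).2 hy
  refine ⟨Ideal.quotientEquivAlg X.ideal (Ideal.span {H}) (fatEquiv _ θ) hJ, fun r s hrs => ?_⟩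
  have h1 := (ofEquation hf H hX.restrict_eq (hX.contract_mem hf)).emb_eq
    (r := fatEquiv _ θ r) (s := s) hrs
  rw [← h1, emb_eq_of_restrict, ← hX.mk_apply, ← restrict_fatEquiv]
  rfl

end NormalForm

/-! ### Isomorphisms between deformations given by equations -/

section Isomorphism

variable {n : ℕ} {V : Type} [AddCommGroup V] [Module ℂ V] [Module ℂᵐᵒᵖ V] [IsCentralScalar ℂ V]
  [Module.Finite ℂ V] {f : (Fin n → ℂ) → ℂ}

theorem mul_eq_zero_of_restrict {y z : FatStalk n V} (hy : restrict (residue V) y = 0)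
    (hz : restrict (residue V) z = 0) : y * z = 0 := by
  refine fatStalk_ext (Module.finBasis ℂ V) ?_ fun i => ?_
  · rw [map_mul, hy, zero_mul, map_zero]
  · rw [contract_mul, hy, hz, zero_mul, zero_mul, add_zero, map_zero]

/-- The algebra endomorphism `1 + Δ`, for a relative vector field `Δ` that vanishes on the central
fibre. -/
def unipotentHom (Δ : Derivation (TrivSqZeroExt ℂ V) (FatStalk n V) (FatStalk n V))
    (hΔ : restrictDer (residue V) Δ = 0) : FatStalk n V →ₐ[TrivSqZeroExt ℂ V] FatStalk n V :=
  AlgHom.ofLinearMap (LinearMap.id + (Δ : FatStalk n V →ₗ[TrivSqZeroExt ℂ V] FatStalk n V))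
    (by simp) (fun y z => by
      have h : Δ y * Δ z = 0 := mul_eq_zero_of_restrict (by rw [restrict_der, hΔ]; rfl)
        (by rw [restrict_der, hΔ]; rfl)
      simp only [LinearMap.add_apply, LinearMap.id_apply, Derivation.coeFn_coe,
        Derivation.leibniz, smul_eq_mul]
      linear_combination -h)

theorem unipotentHom_apply (Δ : Derivation (TrivSqZeroExt ℂ V) (FatStalk n V) (FatStalk n V))
    (hΔ : restrictDer (residue V) Δ = 0) (z : FatStalk n V) : unipotentHom Δ hΔ z = z + Δ z := rfl

theorem der_der_eq_zero {Δ : Derivation (TrivSqZeroExt ℂ V) (FatStalk n V) (FatStalk n V)}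
    (hΔ : restrictDer (residue V) Δ = 0) (z : FatStalk n V) : Δ (Δ z) = 0 := by
  refine fatStalk_ext (Module.finBasis ℂ V) ?_ fun i => ?_
  · rw [restrict_der, hΔ, map_zero]; rfl
  · rw [contract_der, restrict_der, hΔ, map_zero]
    simp

/-- The automorphism `1 + Δ`, with inverse `1 - Δ`. -/
def unipotent (Δ : Derivation (TrivSqZeroExt ℂ V) (FatStalk n V) (FatStalk n V))
    (hΔ : restrictDer (residue V) Δ = 0) : FatStalk n V ≃ₐ[TrivSqZeroExt ℂ V] FatStalk n V :=
  AlgEquiv.ofAlgHom (unipotentHom Δ hΔ)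
    (unipotentHom (-Δ) (by
      ext r
      rw [restrictDer_apply, Derivation.neg_apply, map_neg, ← restrictDer_apply, hΔ]
      simp))
    (AlgHom.ext fun z => by
      rw [AlgHom.comp_apply, unipotentHom_apply, unipotentHom_apply, AlgHom.id_apply,
        Derivation.neg_apply, map_add, map_neg, der_der_eq_zero hΔ]
      abel)
    (AlgHom.ext fun z => by
      rw [AlgHom.comp_apply, unipotentHom_apply, unipotentHom_apply, AlgHom.id_apply,
        Derivation.neg_apply, map_add, der_der_eq_zero hΔ]
      abel)

theorem unipotent_apply (Δ : Derivation (TrivSqZeroExt ℂ V) (FatStalk n V) (FatStalk n V))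
    (hΔ : restrictDer (residue V) Δ = 0) (z : FatStalk n V) : unipotent Δ hΔ z = z + Δ z := rfl

theorem span_le_span_of_contract {h : Stalk (0 : Fin n → ℂ)} {H H' : FatStalk n V}
    (hH : restrict (residue V) H = h) (hH' : restrict (residue V) H' = h)
    (hc : ∀ i, contract ((Module.finBasis ℂ V).coord i) H -
      contract ((Module.finBasis ℂ V).coord i) H' ∈ Ideal.span {h}) :
    Ideal.span {H} ≤ Ideal.span {H'} := by
  rw [Ideal.span_singleton_le_iff_mem, mem_span_singleton_iff_contract (Module.finBasis ℂ V) hH']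
  exact ⟨1, by rw [hH, one_mul], fun i => by rw [one_mul]; exact hc i⟩

/-- An isomorphism of embedded deformations over the identity of `D` comes, to first order, from
a vector field on `ℂⁿ`. -/
theorem ofEquation_mk_eq_iff (hf : germ f 0 ≠ 0) {H H' : FatStalk n V}
    (hH : restrict (residue V) H = germ f 0)
    (hK : ∀ l, contract l H ∈ admissiblePerturbation (germ f 0))
    (hH' : restrict (residue V) H' = germ f 0)
    (hK' : ∀ l, contract l H' ∈ admissiblePerturbation (germ f 0)) :
    ((Quotient.mk _ (ofEquation hf H hH hK) : FD f (residue V)) =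
      Quotient.mk _ (ofEquation hf H' hH' hK')) ↔
      ∀ l, contract l H - contract l H' ∈ tjurina (germ f 0) := by
  set b := Module.finBasis ℂ V with hb
  constructor
  · intro he
    obtain ⟨τ, hτ⟩ := Quotient.exact he
    change (FatStalk n V ⧸ Ideal.span {H}) ≃ₐ[TrivSqZeroExt ℂ V]
      (FatStalk n V ⧸ Ideal.span {H'}) at τ
    -- every function on `ℂⁿ` has a preimage under the isomorphism with the same restriction
    have hex : ∀ r : Stalk (0 : Fin n → ℂ), ∃ y : FatStalk n V, restrict (residue V) y = r ∧
        τ (Ideal.Quotient.mk _ (1 ⊗ₜ r)) = Ideal.Quotient.mk _ y := by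
      intro r
      obtain ⟨y, hy⟩ := Ideal.Quotient.mk_surjective (τ (Ideal.Quotient.mk _ (1 ⊗ₜ r)))
      have h1 : Ideal.Quotient.mk (Ideal.span {germ f 0})
          (restrict (residue V) ((1 : TrivSqZeroExt ℂ V) ⊗ₜ r)) =
          Ideal.Quotient.mk (Ideal.span {germ f 0}) (restrict (residue V) y) :=
        hτ (1 ⊗ₜ r) y hy.symm
      rw [restrict_one_tmul, Ideal.Quotient.eq, Ideal.mem_span_singleton'] at h1
      obtain ⟨c, hc⟩ := h1
      refine ⟨y + ((1 : TrivSqZeroExt ℂ V) ⊗ₜ c) * H', ?_, ?_⟩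
      · rw [map_add, map_mul, restrict_one_tmul, hH', hc, add_sub_cancel]
      · rw [← hy, eq_comm, Ideal.Quotient.eq, add_sub_cancel_left]
        exact Ideal.mul_mem_left _ _ (Ideal.mem_span_singleton_self _)
    choose y hyr hyτ using hex
    have huniq : ∀ z z' : FatStalk n V, restrict (residue V) z = restrict (residue V) z' →
        Ideal.Quotient.mk (Ideal.span {H'}) z = Ideal.Quotient.mk (Ideal.span {H'}) z' → ∀ i,
        Ideal.Quotient.mk (Ideal.span {germ f 0}) (contract (b.coord i) z) =
          Ideal.Quotient.mk _ (contract (b.coord i) z') := by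
      intro z z' h1 h2 i
      rw [Ideal.Quotient.eq, mem_span_singleton_iff_contract b hH'] at h2
      obtain ⟨a, ha, hc⟩ := h2
      rw [map_sub, h1, sub_self] at ha
      have ha0 := (mul_eq_zero.1 ha.symm).resolve_right hf
      have := hc i
      rwa [ha0, zero_mul, sub_zero, map_sub, ← Ideal.Quotient.eq] at this
    have hD : ∀ i, ∃ δ : Der (0 : Fin n → ℂ), ∀ r, contract (b.coord i) (y r) - δ r ∈
        Ideal.span {germ f 0} := by
      intro i
      have hadd : ∀ r s, Ideal.Quotient.mk (Ideal.span {germ f 0}) (contract (b.coord i) (y (r + s)))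
          = Ideal.Quotient.mk _ (contract (b.coord i) (y r + y s)) := by
        refine fun r s => huniq _ _ ?_ ?_ i
        · rw [map_add, hyr, hyr, hyr]
        · rw [map_add, ← hyτ, ← hyτ, ← hyτ, ← map_add, ← map_add, TensorProduct.tmul_add]
      have hsmul : ∀ (c : ℂ) r, Ideal.Quotient.mk (Ideal.span {germ f 0})
          (contract (b.coord i) (y (c • r))) =
          Ideal.Quotient.mk _ (contract (b.coord i)
            (algebraMap ℂ (TrivSqZeroExt ℂ V) c • y r)) := by
        refine fun c r => huniq _ _ ?_ ?_ i
        · rw [restrict_smul, hyr, hyr, AlgHom.commutes]; rfl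
        · have h1 : Ideal.Quotient.mk (Ideal.span {H'}) (algebraMap ℂ (TrivSqZeroExt ℂ V) c • y r) =
              algebraMap ℂ (TrivSqZeroExt ℂ V) c • Ideal.Quotient.mk (Ideal.span {H'}) (y r) := rfl
          rw [h1, ← hyτ, ← hyτ, ← map_smul]
          congr 1
          rw [TensorProduct.tmul_smul, algebraMap_smul]
          rfl
      have hmul : ∀ r s, Ideal.Quotient.mk (Ideal.span {germ f 0}) (contract (b.coord i) (y (r * s)))
          = Ideal.Quotient.mk _ (contract (b.coord i) (y r * y s)) := by
        refine fun r s => huniq _ _ ?_ ?_ i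
        · rw [map_mul, hyr, hyr, hyr]
        · rw [map_mul, ← hyτ, ← hyτ, ← hyτ, ← map_mul, ← map_mul,
            Algebra.TensorProduct.tmul_mul_tmul, mul_one]
      obtain ⟨δ, hδ⟩ := exists_lift_derivation (Ideal.span {germ f 0})
        (Derivation.mk'
          { toFun := fun r => Ideal.Quotient.mk (Ideal.span {germ f 0}) (contract (b.coord i) (y r))
            map_add' := fun r s => by rw [hadd, map_add, map_add]
            map_smul' := fun c r => by
              rw [hsmul, algebraMap_smul, map_smul, RingHom.id_apply]
              rfl }
          (fun r s => by
            change Ideal.Quotient.mk (Ideal.span {germ f 0}) (contract (b.coord i) (y (r * s))) =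
              Ideal.Quotient.mk _ (r * contract (b.coord i) (y s)) +
              Ideal.Quotient.mk _ (s * contract (b.coord i) (y r))
            rw [hmul, contract_mul, hyr, hyr, map_add]))
      exact ⟨δ, fun r => Ideal.Quotient.eq.1 (hδ r)⟩
    choose δ hδ using hD
    -- apply the isomorphism to the equation `H = h + ∑ bᵢ gᵢ`
    have hH0 : y (germ f 0) + ∑ i, (TrivSqZeroExt.inr (b i) : TrivSqZeroExt ℂ V) •
        y (contract (b.coord i) H) ∈ Ideal.span {H'} := by
      have h1 : τ (Ideal.Quotient.mk _ H) = 0 := by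
        rw [Ideal.Quotient.eq_zero_iff_mem.2 (Ideal.mem_span_singleton_self H), map_zero]
      have h2 : ∀ i, Ideal.Quotient.mk (Ideal.span {H'})
          ((TrivSqZeroExt.inr (b i) : TrivSqZeroExt ℂ V) • y (contract (b.coord i) H)) =
          τ (Ideal.Quotient.mk _
            ((TrivSqZeroExt.inr (b i) : TrivSqZeroExt ℂ V) ⊗ₜ contract (b.coord i) H)) := by
        intro i
        have h3 : Ideal.Quotient.mk (Ideal.span {H'})
          ((TrivSqZeroExt.inr (b i) : TrivSqZeroExt ℂ V) • y (contract (b.coord i) H)) =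
          (TrivSqZeroExt.inr (b i) : TrivSqZeroExt ℂ V) • Ideal.Quotient.mk (Ideal.span {H'})
            (y (contract (b.coord i) H)) := rfl
        rw [h3, ← hyτ, ← map_smul, tmul_eq_smul (TrivSqZeroExt.inr (b i) : TrivSqZeroExt ℂ V)]
        rfl
      rw [← Ideal.Quotient.eq_zero_iff_mem, map_add, map_sum, ← hyτ]
      simp only [h2]
      rw [← map_sum, ← map_sum, ← map_add, ← map_add, ← h1]
      refine congrArg (fun z => τ (Ideal.Quotient.mk _ z)) (Eq.trans ?_
        (fatMk_restrict_contract b H))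
      rw [hH]
      rfl
    rw [mem_span_singleton_iff_contract b hH'] at hH0
    obtain ⟨a, ha, hc⟩ := hH0
    have ha1 : a = 1 := by
      rw [map_add, map_sum, hyr, Finset.sum_eq_zero, add_zero] at ha
      · exact (mul_right_cancel₀ hf ((one_mul _).trans ha)).symm
      · intro i _
        rw [restrict_smul]
        have : residue V (TrivSqZeroExt.inr (b i)) = 0 := TrivSqZeroExt.fst_inr ℂ (b i)
        rw [this, zero_smul]
    intro l
    rw [eq_sum_contract b l H, eq_sum_contract b l H', ← Finset.sum_sub_distrib]
    refine Ideal.sum_mem _ fun j _ => ?_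
    rw [← smul_sub]
    refine ((tjurina (germ f 0)).restrictScalars ℂ).smul_mem _ ?_
    rw [Submodule.restrictScalars_mem, mem_tjurina_iff_sub_mem_span]
    refine ⟨-δ j, ?_⟩
    have h4 := Ideal.sub_mem _ (hc j) (hδ j (germ f 0))
    classical
    rw [ha1, one_mul, map_add, map_sum, Finset.sum_eq_single j] at h4
    · rw [contract_smul, TrivSqZeroExt.fst_inr, zero_smul, zero_add, TrivSqZeroExt.snd_inr, hyr,
        Module.Basis.coord_apply, Module.Basis.repr_self, Finsupp.single_eq_same, one_smul] at h4
      rw [Derivation.neg_apply]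
      convert h4 using 1
      ring
    · intro i _ hij
      rw [contract_smul, TrivSqZeroExt.fst_inr, zero_smul, zero_add, TrivSqZeroExt.snd_inr,
        Module.Basis.coord_apply, Module.Basis.repr_self, Finsupp.single_eq_of_ne' hij, zero_smul]
    · simp
  · intro hT
    choose σ hσ using fun i => mem_tjurina_iff_sub_mem_span.1 (hT (b.coord i))
    have h0 : restrictDer (residue V) (fatDer b 0 fun i => -σ i) = 0 := restrictDer_fatDer b _ _
    set Θ := unipotent (fatDer b 0 fun i => -σ i) h0 with hΘ
    have hres : ∀ z, restrict (residue V) (Θ z) = restrict (residue V) z := by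
      intro z
      rw [hΘ, unipotent_apply, map_add, restrict_der, h0]
      simp
    have hc : ∀ i, contract (b.coord i) (Θ H) - contract (b.coord i) H' ∈
        Ideal.span {germ f 0} := by
      intro i
      rw [hΘ, unipotent_apply, map_add, contract_der, h0, contractDer_fatDer, hH]
      convert hσ i using 1
      rw [Derivation.neg_apply, Derivation.zero_apply]
      ring
    have hspan : Ideal.span {H'} = (Ideal.span {H}).map (Θ : FatStalk n V →+* FatStalk n V) := by
      rw [Ideal.map_span, Set.image_singleton]
      refine le_antisymm (span_le_span_of_contract hH' ((hres H).trans hH) fun i => ?_)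
        (span_le_span_of_contract ((hres H).trans hH) hH' hc)
      rw [← neg_sub, Ideal.neg_mem_iff]
      exact hc i
    refine Quotient.sound ⟨Ideal.quotientEquivAlg (Ideal.span {H}) (Ideal.span {H'}) Θ hspan,
      fun r s hrs => ?_⟩
    refine Eq.trans ?_ ((ofEquation hf H' hH' hK').emb_eq (r := Θ r) (s := s) hrs)
    exact congrArg (Ideal.Quotient.mk (Ideal.span {germ f 0})) (hres r).symm

end Isomorphism

/-! ### Base change of the normal form -/

section BaseChange

variable {n : ℕ} {V W : Type} [AddCommGroup V] [Module ℂ V] [Module ℂᵐᵒᵖ V] [IsCentralScalar ℂ V]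
  [AddCommGroup W] [Module ℂ W] [Module ℂᵐᵒᵖ W] [IsCentralScalar ℂ W] {f : (Fin n → ℂ) → ℂ}

/-- The base change of an equation along the map induced by a linear map `φ`. -/
abbrev fatMap (φ : V →ₗ[ℂ] W) : FatStalk n V →ₐ[ℂ] FatStalk n W :=
  Algebra.TensorProduct.map (TrivSqZeroExt.map φ) (AlgHom.id ℂ (Stalk (0 : Fin n → ℂ)))

theorem IsNormalForm.baseChange {φ : V →ₗ[ℂ] W} {X : AdmissibleDeformation f (residue V)}
    {Y : AdmissibleDeformation f (residue W)}
    {θ : Stalk (0 : Fin n → ℂ) ≃ₐ[ℂ] Stalk (0 : Fin n → ℂ)} {H : FatStalk n V}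
    (hX : IsNormalForm X θ H) (hY : Y.ideal = X.ideal.map (fatMap φ))
    (hemb : ∀ r, Y.emb (fatMap φ r) = X.emb r) : IsNormalForm Y θ (fatMap φ H) where
  mk_apply r := by
    rw [hX.mk_apply, ← hemb, Algebra.TensorProduct.map_tmul, map_one]
    rfl
  restrict_eq := by rw [restrict_map, hX.restrict_eq]
  mem_iff z := by
    have hmul : ∀ c, fatEquiv _ θ (c * fatMap φ ((fatEquiv _ θ).symm H)) =
        fatEquiv _ θ c * fatMap φ H := fun c => by
      rw [map_mul, map_fatEquiv, AlgEquiv.apply_symm_apply]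
    have hideal : X.ideal = Ideal.span {(fatEquiv _ θ).symm H} := by
      ext y
      rw [← hX.mem_iff, Ideal.mem_span_singleton', Ideal.mem_span_singleton']
      constructor
      · rintro ⟨a, ha⟩
        refine ⟨(fatEquiv _ θ).symm a, ?_⟩
        rw [← map_mul, ha, AlgEquiv.symm_apply_apply]
      · rintro ⟨a, rfl⟩
        exact ⟨fatEquiv _ θ a, by rw [map_mul, AlgEquiv.apply_symm_apply]⟩
    rw [hY, hideal, Ideal.map_span, Set.image_singleton, Ideal.mem_span_singleton',
      Ideal.mem_span_singleton']
    constructor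
    · rintro ⟨a, ha⟩
      refine ⟨(fatEquiv _ θ).symm a, (fatEquiv _ θ).injective ?_⟩
      rw [hmul, AlgEquiv.apply_symm_apply, ha]
    · rintro ⟨a, rfl⟩
      exact ⟨fatEquiv _ θ a, (hmul a).symm⟩

end BaseChange

/-! ### Classification of first order deformations by their equations -/

section Classification

variable {n : ℕ} {V W : Type} [AddCommGroup V] [Module ℂ V] [Module ℂᵐᵒᵖ V] [IsCentralScalar ℂ V]
  [Module.Finite ℂ V] [AddCommGroup W] [Module ℂ W] [Module ℂᵐᵒᵖ W] [IsCentralScalar ℂ W]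
  [Module.Finite ℂ W] {f : (Fin n → ℂ) → ℂ}

/-- The isomorphism class `z` contains the deformation with the equation `H`. -/
def HasEquation (hf : germ f 0 ≠ 0) (z : FD f (residue V)) (H : FatStalk n V) : Prop :=
  ∃ (hH : restrict (residue V) H = germ f 0)
    (hK : ∀ l, contract l H ∈ admissiblePerturbation (germ f 0)),
    Quotient.mk _ (ofEquation hf H hH hK) = z

theorem exists_hasEquation (hf : germ f 0 ≠ 0) (hf0 : value 0 (germ f 0) = 0)
    (z : FD f (residue V)) : ∃ H, HasEquation hf z H := by
  obtain ⟨X, rfl⟩ := Quotient.exists_rep z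
  obtain ⟨θ, H, hX⟩ := exists_isNormalForm hf0 X
  exact ⟨H, hX.restrict_eq, hX.contract_mem hf, (hX.mk_eq hf).symm⟩

theorem HasEquation.eq_iff {hf : germ f 0 ≠ 0} {z w : FD f (residue V)} {H H' : FatStalk n V}
    (hz : HasEquation hf z H) (hw : HasEquation hf w H') :
    z = w ↔ ∀ l, contract l H - contract l H' ∈ tjurina (germ f 0) := by
  obtain ⟨hH, hK, rfl⟩ := hz
  obtain ⟨hH', hK', rfl⟩ := hw
  exact ofEquation_mk_eq_iff hf hH hK hH' hK'

theorem FDMaps.hasEquation {φ : V →ₗ[ℂ] W} (hf : germ f 0 ≠ 0) (hf0 : value 0 (germ f 0) = 0)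
    {z : FD f (residue V)} {w : FD f (residue W)} (h : FDMaps (TrivSqZeroExt.map φ) z w) :
    ∃ H, HasEquation hf z H ∧ HasEquation hf w (fatMap φ H) := by
  obtain ⟨X, Y, rfl, rfl, hY, hemb⟩ := h
  obtain ⟨θ, H, hX⟩ := exists_isNormalForm hf0 X
  have hY' := hX.baseChange hY hemb
  exact ⟨H, ⟨hX.restrict_eq, hX.contract_mem hf, (hX.mk_eq hf).symm⟩,
    ⟨hY'.restrict_eq, hY'.contract_mem hf, (hY'.mk_eq hf).symm⟩⟩

/-- Base change acts on equations by composition of the linear forms with `φ`. -/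
theorem HasEquation.fdMaps_iff {φ : V →ₗ[ℂ] W} {hf : germ f 0 ≠ 0}
    (hf0 : value 0 (germ f 0) = 0) {z : FD f (residue V)} {w : FD f (residue W)}
    {H : FatStalk n V} {H' : FatStalk n W} (hz : HasEquation hf z H) (hw : HasEquation hf w H') :
    FDMaps (TrivSqZeroExt.map φ) z w ↔
      ∀ l, contract l H' - contract (l ∘ₗ φ) H ∈ tjurina (germ f 0) := by
  constructor
  · intro h l
    obtain ⟨G, hG, hG'⟩ := h.hasEquation hf hf0
    have h1 := (hw.eq_iff hG').1 rfl l
    have h2 := (hG.eq_iff hz).1 rfl (l ∘ₗ φ)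
    rw [contract_map] at h1
    have := Ideal.add_mem _ h1 h2
    rwa [sub_add_sub_cancel] at this
  · intro h
    obtain ⟨hH, hK, rfl⟩ := hz
    have hHφ : restrict (residue W) (fatMap φ H) = germ f 0 := by rw [restrict_map, hH]
    have hKφ : ∀ l, contract l (fatMap φ H) ∈ admissiblePerturbation (germ f 0) := fun l => by
      rw [contract_map]
      exact hK _
    refine ⟨ofEquation hf H hH hK, ofEquation hf (fatMap φ H) hHφ hKφ, rfl, ?_, ?_, fun r => ?_⟩
    · refine (HasEquation.eq_iff (hf := hf) ⟨hHφ, hKφ, rfl⟩ hw).2 fun l => ?_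
      rw [contract_map, ← neg_sub, Ideal.neg_mem_iff]
      exact h l
    · change Ideal.span {fatMap φ H} = Ideal.map _ (Ideal.span {H})
      rw [Ideal.map_span, Set.image_singleton]
    · exact congrArg (Ideal.Quotient.mk (Ideal.span {germ f 0})) (restrict_map φ r)

/-- The equation `h + ε g`. -/
def dualEquation (h g : Stalk (0 : Fin n → ℂ)) : FatStalk n ℂ :=
  fatMk (Module.Basis.singleton Unit ℂ) h fun _ => g

theorem contract_dualEquation (l : ℂ →ₗ[ℂ] ℂ) (h g : Stalk (0 : Fin n → ℂ)) :
    contract l (dualEquation h g) = l 1 • g := by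
  rw [dualEquation, contract_fatMk]
  simp

/-- The equation `h + ε₁ g₁ + ε₂ g₂`. -/
def pairEquation (h g₁ g₂ : Stalk (0 : Fin n → ℂ)) : FatStalk n (ℂ × ℂ) :=
  fatMk (Module.Basis.finTwoProd ℂ) h ![g₁, g₂]

theorem contract_pairEquation (l : ℂ × ℂ →ₗ[ℂ] ℂ) (h g₁ g₂ : Stalk (0 : Fin n → ℂ)) :
    contract l (pairEquation h g₁ g₂) = l (1, 0) • g₁ + l (0, 1) • g₂ := by
  rw [pairEquation, contract_fatMk]
  simp

theorem smul_mem_tjurina {h g : Stalk (0 : Fin n → ℂ)} (c : ℂ) (hg : g ∈ tjurina h) :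
    c • g ∈ tjurina h :=
  ((tjurina h).restrictScalars ℂ).smul_mem c hg

theorem contract_add_left (l l' : V →ₗ[ℂ] ℂ) (z : FatStalk n V) :
    contract (l + l') z = contract l z + contract l' z := by
  rw [eq_sum_contract (Module.finBasis ℂ V) (l + l'), eq_sum_contract (Module.finBasis ℂ V) l,
    eq_sum_contract (Module.finBasis ℂ V) l', ← Finset.sum_add_distrib]
  exact Finset.sum_congr rfl fun i _ => by rw [LinearMap.add_apply, add_smul]

theorem contract_smul_left (c : ℂ) (l : V →ₗ[ℂ] ℂ) (z : FatStalk n V) :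
    contract (c • l) z = c • contract l z := by
  rw [eq_sum_contract (Module.finBasis ℂ V) (c • l), eq_sum_contract (Module.finBasis ℂ V) l,
    Finset.smul_sum]
  exact Finset.sum_congr rfl fun i _ => by rw [LinearMap.smul_apply, smul_assoc]

/-- The isomorphism class of the deformation `h + ε g`. -/
def dualClass (hf : germ f 0 ≠ 0) (g : admissiblePerturbation (germ f 0)) : FT1 f :=
  Quotient.mk _ (ofEquation hf (dualEquation (germ f 0) g.1) (restrict_fatMk _ _ _) fun l => by
    rw [contract_dualEquation]
    exact Submodule.smul_mem _ _ g.2)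

theorem hasEquation_dualClass (hf : germ f 0 ≠ 0) (g : admissiblePerturbation (germ f 0)) :
    HasEquation hf (dualClass hf g) (dualEquation (germ f 0) g.1) :=
  ⟨_, _, rfl⟩

theorem dualClass_eq_iff (hf : germ f 0 ≠ 0) (g g' : admissiblePerturbation (germ f 0)) :
    dualClass hf g = dualClass hf g' ↔ (g : Stalk (0 : Fin n → ℂ)) - g' ∈ tjurina (germ f 0) := by
  rw [(hasEquation_dualClass hf g).eq_iff (hasEquation_dualClass hf g')]
  simp only [contract_dualEquation, ← smul_sub]
  exact ⟨fun h => by simpa using h LinearMap.id, fun h l => smul_mem_tjurina _ h⟩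

theorem HasEquation.fdMaps_dualClass_iff {hf : germ f 0 ≠ 0} (hf0 : value 0 (germ f 0) = 0)
    {z : FD f (residue V)} {H : FatStalk n V} (hz : HasEquation hf z H) (φ : V →ₗ[ℂ] ℂ)
    (g : admissiblePerturbation (germ f 0)) :
    FDMaps (TrivSqZeroExt.map φ) z (dualClass hf g) ↔
      (g : Stalk (0 : Fin n → ℂ)) - contract φ H ∈ tjurina (germ f 0) := by
  rw [hz.fdMaps_iff hf0 (hasEquation_dualClass hf g)]
  have hl : ∀ l : ℂ →ₗ[ℂ] ℂ, l ∘ₗ φ = l 1 • φ := fun l => by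
    ext v
    rw [LinearMap.comp_apply, LinearMap.smul_apply, smul_eq_mul, mul_comm, ← smul_eq_mul,
      ← map_smul, smul_eq_mul, mul_one]
  simp only [contract_dualEquation, hl, contract_smul_left, ← smul_sub]
  exact ⟨fun h => by simpa using h LinearMap.id, fun h l => smul_mem_tjurina _ h⟩

theorem dualClass_surjective (hf : germ f 0 ≠ 0) (hf0 : value 0 (germ f 0) = 0) :
    Function.Surjective (dualClass (f := f) hf) := by
  intro z
  obtain ⟨H, hz⟩ := exists_hasEquation hf hf0 z
  have hK := hz.2.1
  refine ⟨⟨contract LinearMap.id H, hK _⟩, ?_⟩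
  rw [(hasEquation_dualClass hf _).eq_iff hz]
  intro l
  have hl : l = l 1 • LinearMap.id := by ext; simp
  rw [hl, contract_dualEquation, contract_smul_left]
  simp

/-- The tangent space condition for the functor of admissible deformations. -/
theorem existsUnique_fdMaps (hf : germ f 0 ≠ 0) (hf0 : value 0 (germ f 0) = 0) (a b : FT1 f) :
    ∃! z : FT1Pair f, FDMaps (TrivSqZeroExt.map (LinearMap.fst ℂ ℂ ℂ)) z a ∧
      FDMaps (TrivSqZeroExt.map (LinearMap.snd ℂ ℂ ℂ)) z b := by
  obtain ⟨g, rfl⟩ := dualClass_surjective hf hf0 a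
  obtain ⟨g', rfl⟩ := dualClass_surjective hf hf0 b
  have hK : ∀ l, contract l (pairEquation (germ f 0) g.1 g'.1) ∈
      admissiblePerturbation (germ f 0) := fun l => by
    rw [contract_pairEquation]
    exact Submodule.add_mem _ (Submodule.smul_mem _ _ g.2) (Submodule.smul_mem _ _ g'.2)
  have hz : HasEquation hf _ (pairEquation (germ f 0) g.1 g'.1) :=
    ⟨restrict_fatMk _ _ _, hK, rfl⟩
  refine ⟨_, ⟨(hz.fdMaps_dualClass_iff hf0 _ g).2 ?_, (hz.fdMaps_dualClass_iff hf0 _ g').2 ?_⟩,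
    ?_⟩
  · rw [contract_pairEquation]
    simp
  · rw [contract_pairEquation]
    simp
  · rintro w ⟨h1, h2⟩
    obtain ⟨H, hw⟩ := exists_hasEquation hf hf0 w
    rw [hw.fdMaps_dualClass_iff hf0] at h1 h2
    refine (hw.eq_iff hz).2 fun l => ?_
    have hl : l = l (1, 0) • LinearMap.fst ℂ ℂ ℂ + l (0, 1) • LinearMap.snd ℂ ℂ ℂ := by
      ext <;> simp
    have h3 : contract l H = l (1, 0) • contract (LinearMap.fst ℂ ℂ ℂ) H +
        l (0, 1) • contract (LinearMap.snd ℂ ℂ ℂ) H := by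
      conv_lhs => rw [hl]
      rw [contract_add_left, contract_smul_left, contract_smul_left]
    rw [h3, contract_pairEquation, ← neg_sub, Ideal.neg_mem_iff, add_sub_add_comm, ← smul_sub,
      ← smul_sub]
    exact Ideal.add_mem _ (smul_mem_tjurina _ h1) (smul_mem_tjurina _ h2)

theorem fdMaps_add (hf : germ f 0 ≠ 0) (hf0 : value 0 (germ f 0) = 0)
    (g g' : admissiblePerturbation (germ f 0)) (z : FT1Pair f)
    (h1 : FDMaps (TrivSqZeroExt.map (LinearMap.fst ℂ ℂ ℂ)) z (dualClass hf g))
    (h2 : FDMaps (TrivSqZeroExt.map (LinearMap.snd ℂ ℂ ℂ)) z (dualClass hf g')) :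
    FDMaps (TrivSqZeroExt.map (LinearMap.coprod LinearMap.id LinearMap.id)) z
      (dualClass hf (g + g')) := by
  obtain ⟨H, hz⟩ := exists_hasEquation hf hf0 z
  rw [hz.fdMaps_dualClass_iff hf0] at h1 h2 ⊢
  have hl : LinearMap.coprod LinearMap.id LinearMap.id =
      LinearMap.fst ℂ ℂ ℂ + LinearMap.snd ℂ ℂ ℂ := by
    ext <;> simp
  rw [hl, contract_add_left, Submodule.coe_add, add_sub_add_comm]
  exact Ideal.add_mem _ h1 h2

theorem fdMaps_smul (hf : germ f 0 ≠ 0) (hf0 : value 0 (germ f 0) = 0) (c : ℂ)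
    (g : admissiblePerturbation (germ f 0)) :
    FDMaps (TrivSqZeroExt.map (c • LinearMap.id)) (dualClass hf g) (dualClass hf (c • g)) := by
  rw [(hasEquation_dualClass hf g).fdMaps_dualClass_iff hf0, contract_dualEquation]
  simp

end Classification

/-! ### Cocycles and perturbations of the equation -/

section Match

variable {n : ℕ} {f : (Fin n → ℂ) → ℂ} {x : Fin n → ℂ}

theorem mkQ_eq_mkQ_iff {σ τ : Der x} :
    (LogDer f x).mkQ σ = (LogDer f x).mkQ τ ↔ σ (germ f x) - τ (germ f x) ∈
      Ideal.span {germ f x} := by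
  rw [← sub_eq_zero, ← map_sub, Submodule.mkQ_apply, Submodule.Quotient.mk_eq_zero,
    mem_logDer_span_singleton, Derivation.sub_apply]

/-- The logarithmic vector fields `δ` on which the cochain `ψ` is the infinitesimal obstruction to
extending `δ` to a logarithmic vector field of `h + ε g`: if `δ(h) = a h` and `σ` represents
`ψ(δ)`, then `(δ + ε σ)(h + ε g)` is a multiple of `h + ε g`. -/
def matchDomain (ψ : LogDer f x →ₗ[Stalk x] Normal f x) (g : Stalk x) :
    Submodule (Stalk x) (LogDer f x) where
  carrier := {δ | ∃ (a : Stalk x) (σ : Der x), (δ : Der x) (germ f x) = a * germ f x ∧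
    ψ δ = (LogDer f x).mkQ σ ∧
    σ (germ f x) + ((δ : Der x) g - a * g) ∈ Ideal.span {germ f x}}
  add_mem' := by
    rintro δ δ' ⟨a, σ, h1, h2, h3⟩ ⟨a', σ', h1', h2', h3'⟩
    refine ⟨a + a', σ + σ', ?_, ?_, ?_⟩
    · rw [Submodule.coe_add, Derivation.add_apply, h1, h1', add_mul]
    · rw [map_add, map_add, h2, h2']
    · convert Ideal.add_mem _ h3 h3' using 1
      rw [Submodule.coe_add, Derivation.add_apply, Derivation.add_apply]
      ring
  zero_mem' := ⟨0, 0, by simp⟩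
  smul_mem' := by
    rintro c δ ⟨a, σ, h1, h2, h3⟩
    refine ⟨c * a, c • σ, ?_, ?_, ?_⟩
    · rw [Submodule.coe_smul, Derivation.smul_apply, h1, smul_eq_mul, mul_assoc]
    · rw [map_smul, map_smul, h2]
    · convert Ideal.mul_mem_left _ c h3 using 1
      rw [Submodule.coe_smul, Derivation.smul_apply, Derivation.smul_apply, smul_eq_mul,
        smul_eq_mul]
      ring

/-- The cochain `ψ` is the obstruction class of the perturbation `h + ε g`. -/
def Matches (ψ : LogDer f x →ₗ[Stalk x] Normal f x) (g : Stalk x) : Prop :=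
  ∀ δ, δ ∈ matchDomain ψ g

theorem matches_of_span {ψ : LogDer f x →ₗ[Stalk x] Normal f x} {g : Stalk x} {ι : Type}
    [Fintype ι] {v : ι → Der x} (hv : ∀ k, v k ∈ LogDer f x)
    (hspan : Submodule.span (Stalk x) (Set.range v) = LogDer f x)
    (h : ∀ k, (⟨v k, hv k⟩ : LogDer f x) ∈ matchDomain ψ g) : Matches ψ g := by
  rintro ⟨δ, hδ⟩
  have hδ' := hδ
  rw [← hspan, Submodule.mem_span_range_iff_exists_fun] at hδ'
  obtain ⟨c, rfl⟩ := hδ'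
  have : (⟨∑ k, c k • v k, hδ⟩ : LogDer f x) = ∑ k, c k • ⟨v k, hv k⟩ := by
    refine Subtype.ext ?_
    simp
  rw [this]
  exact Submodule.sum_mem _ fun k _ => Submodule.smul_mem _ _ (h k)

theorem Matches.mem {ψ : LogDer f x →ₗ[Stalk x] Normal f x} {g : Stalk x} (h : Matches ψ g)
    (h0 : germ f x ≠ 0) {δ : LogDer f x} {a : Stalk x} {σ : Der x}
    (ha : (δ : Der x) (germ f x) = a * germ f x) (hσ : ψ δ = (LogDer f x).mkQ σ) :
    σ (germ f x) + ((δ : Der x) g - a * g) ∈ Ideal.span {germ f x} := by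
  obtain ⟨a', σ', h1, h2, h3⟩ := h δ
  rw [mul_right_cancel₀ h0 (ha.symm.trans h1)]
  convert Ideal.add_mem _ h3 (mkQ_eq_mkQ_iff.1 (hσ.symm.trans h2)) using 1
  ring

theorem Matches.add {ψ ψ' : LogDer f x →ₗ[Stalk x] Normal f x} {g g' : Stalk x}
    (h0 : germ f x ≠ 0) (h : Matches ψ g) (h' : Matches ψ' g') : Matches (ψ + ψ') (g + g') := by
  intro δ
  obtain ⟨a, σ, h1, h2, h3⟩ := h δ
  obtain ⟨a', σ', h1', h2', h3'⟩ := h' δ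
  obtain rfl := mul_right_cancel₀ h0 (h1.symm.trans h1')
  refine ⟨a, σ + σ', h1, ?_, ?_⟩
  · rw [LinearMap.add_apply, map_add, h2, h2']
  · convert Ideal.add_mem _ h3 h3' using 1
    rw [map_add, Derivation.add_apply]
    ring

theorem Matches.sub {ψ ψ' : LogDer f x →ₗ[Stalk x] Normal f x} {g g' : Stalk x}
    (h0 : germ f x ≠ 0) (h : Matches ψ g) (h' : Matches ψ' g') : Matches (ψ - ψ') (g - g') := by
  intro δ
  obtain ⟨a, σ, h1, h2, h3⟩ := h δ
  obtain ⟨a', σ', h1', h2', h3'⟩ := h' δ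
  obtain rfl := mul_right_cancel₀ h0 (h1.symm.trans h1')
  refine ⟨a, σ - σ', h1, ?_, ?_⟩
  · rw [LinearMap.sub_apply, map_sub, h2, h2']
  · convert Ideal.sub_mem _ h3 h3' using 1
    rw [map_sub, Derivation.sub_apply]
    ring

theorem Matches.smul {ψ : LogDer f x →ₗ[Stalk x] Normal f x} {g : Stalk x} (c : ℂ)
    (h : Matches ψ g) : Matches (c • ψ) (c • g) := by
  intro δ
  obtain ⟨a, σ, h1, h2, h3⟩ := h δ
  refine ⟨a, c • σ, h1, ?_, ?_⟩
  · rw [LinearMap.smul_apply, h2]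
    rfl
  · convert Ideal.mul_mem_left _ (algebraMap ℂ (Stalk x) c) h3 using 1
    rw [Derivation.map_smul, Derivation.smul_apply, mul_smul_comm, ← smul_sub, ← smul_add,
      Algebra.smul_def]

/-- The obstruction of a perturbation is closed, because extending `δ` is compatible with
brackets. -/
theorem Matches.d1_eq_zero {ψ : LogDer f x →ₗ[Stalk x] Normal f x} {g : Stalk x}
    (h0 : germ f x ≠ 0) (h : Matches ψ g) (δ δ' : LogDer f x) : d1 ψ δ δ' = 0 := by
  obtain ⟨a, σ, h1, h2, h3⟩ := h δ
  obtain ⟨a', σ', h1', h2', h3'⟩ := h δ'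
  obtain ⟨τ, hτ⟩ := (LogDer f x).mkQ_surjective (ψ (bracket δ δ'))
  have hb : ((bracket δ δ' : LogDer f x) : Der x) = ⁅(δ : Der x), (δ' : Der x)⁆ := rfl
  have h4 := h.mem h0 (δ := bracket δ δ') (a := (δ : Der x) a' - (δ' : Der x) a) (by
    rw [hb, Derivation.commutator_apply, h1, h1', Derivation.leibniz, Derivation.leibniz, h1, h1']
    simp only [smul_eq_mul]
    ring) hτ.symm
  rw [hb, Derivation.commutator_apply] at h4
  rw [d1, h2, h2', ← hτ, act_mk, act_mk, ← map_neg, ← map_add, ← map_add, Submodule.mkQ_apply,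
    Submodule.Quotient.mk_eq_zero, mem_logDer_span_singleton]
  obtain ⟨p, hp⟩ := Ideal.mem_span_singleton'.1 h3
  obtain ⟨p', hp'⟩ := Ideal.mem_span_singleton'.1 h3'
  obtain ⟨q, hq⟩ := Ideal.mem_span_singleton'.1 h4
  have e1 := congrArg (δ' : Der x) hp
  have e2 := congrArg (δ : Der x) hp'
  have e3 := congrArg σ h1'
  have e4 := congrArg σ' h1
  simp only [map_add, map_sub, Derivation.leibniz, smul_eq_mul, h1, h1'] at e1 e2
  simp only [Derivation.leibniz, smul_eq_mul] at e3 e4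
  simp only [Derivation.add_apply, Derivation.neg_apply, Derivation.commutator_apply]
  refine Ideal.mem_span_singleton'.2 ⟨q + σ' a - σ a' - (δ : Der x) p' - p' * a +
    (δ' : Der x) p + p * a' + a * p' - a' * p, ?_⟩
  rw [e3, e4]
  linear_combination hq - e2 + e1 + a * hp' - a' * hp

theorem Matches.mem_admissiblePerturbation {f : (Fin n → ℂ) → ℂ}
    {ψ : LogDer f (0 : Fin n → ℂ) →ₗ[Stalk (0 : Fin n → ℂ)] Normal f 0}
    {g : Stalk (0 : Fin n → ℂ)} (h0 : germ f 0 ≠ 0) (h : Matches ψ g) :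
    g ∈ admissiblePerturbation (germ f 0) := by
  intro δ a ha
  obtain ⟨σ, hσ⟩ := (LogDer f 0).mkQ_surjective (ψ ⟨δ, mem_logDer_of_mul ha⟩)
  have h1 := h.mem h0 (δ := ⟨δ, mem_logDer_of_mul ha⟩) ha hσ.symm
  rw [mem_tjurina_iff_sub_mem_span]
  refine ⟨-σ, ?_⟩
  rw [Derivation.neg_apply, sub_neg_eq_add, add_comm]
  exact h1

theorem d0_mkQ (σ : Der x) (δ : LogDer f x) :
    d0 ((LogDer f x).mkQ σ) δ = (LogDer f x).mkQ (-⁅(δ : Der x), σ⁆) := rfl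

/-- The obstruction class of an infinitesimally trivial perturbation is exact. -/
theorem Matches.eq_d0 {ψ : LogDer f x →ₗ[Stalk x] Normal f x} {σ : Der x} {c : Stalk x}
    (h : Matches ψ (σ (germ f x) + c * germ f x)) : ψ = d0 ((LogDer f x).mkQ σ) := by
  refine LinearMap.ext fun δ => ?_
  obtain ⟨a, τ, h1, h2, h3⟩ := h δ
  rw [h2, d0_mkQ, mkQ_eq_mkQ_iff]
  obtain ⟨p, hp⟩ := Ideal.mem_span_singleton'.1 h3
  have e1 := congrArg σ h1
  simp only [map_add, Derivation.leibniz, smul_eq_mul, h1] at hp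
  simp only [Derivation.leibniz, smul_eq_mul] at e1
  simp only [Derivation.neg_apply, Derivation.commutator_apply]
  refine Ideal.mem_span_singleton'.2 ⟨p - σ a - (δ : Der x) c, ?_⟩
  linear_combination hp + e1

theorem matches_d0 (σ : Der x) :
    Matches (d0 ((LogDer f x).mkQ σ)) (σ (germ f x)) := by
  intro δ
  obtain ⟨a, ha⟩ := Ideal.mem_span_singleton'.1 ((mem_logDer_span_singleton _ _).1 δ.2)
  refine ⟨a, _, ha.symm, d0_mkQ σ δ, Ideal.mem_span_singleton'.2 ⟨σ a, ?_⟩⟩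
  have e1 := congrArg σ ha
  simp only [Derivation.leibniz, smul_eq_mul] at e1
  simp only [Derivation.neg_apply, Derivation.commutator_apply]
  linear_combination e1

/-- A perturbation with zero obstruction is a multiple of the equation: the logarithmic vector
fields `h ∂ᵢ` already show that `g ∂ᵢ h` is divisible by `h`. -/
theorem Matches.mem_span_of_zero {f : (Fin n → ℂ) → ℂ} (h0 : germ f 0 ≠ 0)
    [IsReduced (Stalk (0 : Fin n → ℂ) ⧸ Ideal.span {germ f 0})] {g : Stalk (0 : Fin n → ℂ)}
    (h : Matches (0 : LogDer f (0 : Fin n → ℂ) →ₗ[Stalk (0 : Fin n → ℂ)] Normal f 0) g) :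
    g ∈ Ideal.span {germ f 0} := by
  refine mem_span_of_mul_coordField_mem h0 fun i => ?_
  have h1 := h.mem h0 (δ := ⟨germ f 0 • coordField 0 i, smul_mem_logDer _⟩)
    (a := coordField 0 i (germ f 0)) (σ := 0)
    (by simp only [Derivation.smul_apply, smul_eq_mul, mul_comm]) (by simp)
  obtain ⟨p, hp⟩ := Ideal.mem_span_singleton'.1 h1
  simp only [Derivation.zero_apply, Derivation.smul_apply, smul_eq_mul] at hp
  refine Ideal.mem_span_singleton'.2 ⟨coordField 0 i g - p, ?_⟩
  linear_combination -hp

theorem Matches.exists_eq_d0_iff {f : (Fin n → ℂ) → ℂ} (h0 : germ f 0 ≠ 0)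
    [IsReduced (Stalk (0 : Fin n → ℂ) ⧸ Ideal.span {germ f 0})] {g : Stalk (0 : Fin n → ℂ)}
    {ψ : LogDer f (0 : Fin n → ℂ) →ₗ[Stalk (0 : Fin n → ℂ)] Normal f 0} (h : Matches ψ g) :
    (∃ m, ψ = d0 m) ↔ g ∈ tjurina (germ f 0) := by
  constructor
  · rintro ⟨m, rfl⟩
    obtain ⟨σ, rfl⟩ := (LogDer f 0).mkQ_surjective m
    have h1 := h.sub h0 (matches_d0 (f := f) σ)
    rw [sub_self] at h1
    exact mem_tjurina_iff_sub_mem_span.2 ⟨σ, h1.mem_span_of_zero h0⟩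
  · rintro ⟨σ, c, rfl⟩
    exact ⟨_, h.eq_d0⟩

end Match

/-! ### The determinant of a first order family of vector fields -/

section Determinant

/-- The ring homomorphism `s ↦ s + t D(s)` to the dual numbers. -/
def derivationHom {k S : Type} [CommRing k] [CommRing S] [Algebra k S] (D : Derivation k S S) :
    S →+* TrivSqZeroExt S S where
  toFun s := TrivSqZeroExt.inl s + TrivSqZeroExt.inr (D s)
  map_one' := by simp
  map_zero' := by simp
  map_add' r s := by
    refine TrivSqZeroExt.ext ?_ ?_ <;> simp
  map_mul' r s := by
    refine TrivSqZeroExt.ext ?_ ?_ <;> simp [mul_comm]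

/-- If `D(M) = C M + M J`, then `M + t D(M) = (1 + t C) M (1 + t J)` over the dual numbers, and
`D(det M)` is a multiple of `det M`. -/
theorem derivation_det_mem {k S ι : Type} [CommRing k] [CommRing S] [Algebra k S] [Fintype ι]
    [DecidableEq ι] (D : Derivation k S S) {M C J : Matrix ι ι S} (h : M.map D = C * M + M * J) :
    D M.det ∈ Ideal.span {M.det} := by
  have hM : M.map (derivationHom D) = (1 + C.map TrivSqZeroExt.inr) *
      M.map (TrivSqZeroExt.inlHom S S) * (1 + J.map TrivSqZeroExt.inr) := by
    ext i j
    · have h1 : ∀ i j, TrivSqZeroExt.fst ((C.map (TrivSqZeroExt.inr : S → TrivSqZeroExt S S) *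
          M.map (TrivSqZeroExt.inlHom S S)) i j) = 0 := fun i j => by
        simp [Matrix.mul_apply, TrivSqZeroExt.fst_sum]
      have h2 : TrivSqZeroExt.fst (((1 + C.map (TrivSqZeroExt.inr : S → TrivSqZeroExt S S)) *
          M.map (TrivSqZeroExt.inlHom S S) *
            J.map (TrivSqZeroExt.inr : S → TrivSqZeroExt S S)) i j) = 0 := by
        rw [Matrix.mul_apply, TrivSqZeroExt.fst_sum]
        simp
      rw [mul_add, mul_one, Matrix.add_apply, TrivSqZeroExt.fst_add, h2, add_mul, one_mul,
        Matrix.add_apply, TrivSqZeroExt.fst_add, h1]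
      simp [derivationHom]
    · have h0 := congrFun (congrFun h i) j
      have h1 : ∀ i j, TrivSqZeroExt.fst ((C.map (TrivSqZeroExt.inr : S → TrivSqZeroExt S S) *
          M.map (TrivSqZeroExt.inlHom S S)) i j) = 0 := fun i j => by
        simp [Matrix.mul_apply, TrivSqZeroExt.fst_sum]
      rw [mul_add, mul_one, add_mul, one_mul, add_mul]
      simp only [Matrix.add_apply, TrivSqZeroExt.snd_add]
      have h3 : TrivSqZeroExt.snd ((C.map (TrivSqZeroExt.inr : S → TrivSqZeroExt S S) *
          M.map (TrivSqZeroExt.inlHom S S) *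
            J.map (TrivSqZeroExt.inr : S → TrivSqZeroExt S S)) i j) = 0 := by
        rw [Matrix.mul_apply, TrivSqZeroExt.snd_sum]
        refine Finset.sum_eq_zero fun m _ => ?_
        rw [TrivSqZeroExt.snd_mul, h1]
        simp
      rw [h3]
      simp only [Matrix.map_apply, Matrix.add_apply, Matrix.mul_apply] at h0
      simp [derivationHom, Matrix.mul_apply, TrivSqZeroExt.snd_sum, h0, mul_comm]
  have hdet := congrArg Matrix.det hM
  rw [Matrix.det_mul, Matrix.det_mul] at hdet
  have h1 : (M.map (derivationHom D)).det = derivationHom D M.det :=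
    ((derivationHom D).map_det M).symm
  have h2 : (M.map (TrivSqZeroExt.inlHom S S)).det = TrivSqZeroExt.inl M.det :=
    ((TrivSqZeroExt.inlHom S S).map_det M).symm
  rw [h1, h2] at hdet
  have h3 := congrArg TrivSqZeroExt.snd hdet
  simp only [derivationHom, RingHom.coe_mk, MonoidHom.coe_mk, OneHom.coe_mk,
    TrivSqZeroExt.snd_add, TrivSqZeroExt.snd_inl, TrivSqZeroExt.snd_inr, zero_add,
    TrivSqZeroExt.snd_mul, TrivSqZeroExt.fst_mul, TrivSqZeroExt.fst_inl, smul_eq_mul,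
    MulOpposite.smul_eq_mul_unop, MulOpposite.unop_op, zero_add] at h3
  rw [h3, Ideal.mem_span_singleton]
  refine dvd_add ?_ ?_
  · rw [mul_right_comm]
    exact dvd_mul_left _ _
  · rw [mul_zero, zero_add, mul_right_comm]
    exact dvd_mul_left _ _

end Determinant

/-! ### Closed cochains are obstruction classes -/

section Saito

variable {n : ℕ} {f : (Fin n → ℂ) → ℂ}

/-- Evaluation of a relative vector field in terms of its coefficients. -/
theorem fatDer_apply_eq_sum {ι : Type} [Fintype ι] {V : Type} [AddCommGroup V] [Module ℂ V]
    [Module ℂᵐᵒᵖ V] [IsCentralScalar ℂ V] (b : Module.Basis ι ℂ V)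
    (Δ : Derivation (TrivSqZeroExt ℂ V) (FatStalk n V) (FatStalk n V)) (z : FatStalk n V) :
    Δ z = ∑ m, Δ (1 ⊗ₜ coord 0 m) * constDer (TrivSqZeroExt ℂ V) (coordField 0 m) z := by
  have h : Δ = ∑ m, Δ (1 ⊗ₜ coord 0 m) • constDer (TrivSqZeroExt ℂ V) (coordField 0 m) := by
    refine relDer_ext fun r => ?_
    rw [derivation_sum_apply]
    simp only [Derivation.smul_apply, constDer_tmul, smul_eq_mul]
    refine fatStalk_ext b ?_ fun i => ?_
    · rw [map_sum]
      simp only [map_mul, restrict_one_tmul, ← restrictDer_apply]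
      conv_lhs => rw [der_eq_sum (restrictDer (residue V) Δ)]
      rw [derivation_sum_apply]
      rfl
    · rw [map_sum]
      simp only [contract_mul, restrict_one_tmul, contract_one_tmul, ← contractDer_apply,
        mul_zero, zero_add]
      conv_lhs => rw [der_eq_sum (contractDer (b.coord i) Δ)]
      rw [derivation_sum_apply]
      simp only [Derivation.smul_apply, smul_eq_mul, mul_comm]
  conv_lhs => rw [h]
  rw [derivation_sum_apply]
  rfl

/-- Every closed cochain is the obstruction class of a perturbation. By Saito's criterion the
determinant of a basis of the logarithmic vector fields is an equation of `D`; the cochain lifts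
the basis to relative vector fields that are closed under brackets up to linear combination, and
the `ε`-component of the determinant of the lifted basis gives the perturbation. -/
theorem exists_matches (h0 : germ f 0 ≠ 0)
    [IsReduced (Stalk (0 : Fin n → ℂ) ⧸ Ideal.span {germ f 0})] {v : Fin n → Der (0 : Fin n → ℂ)}
    (hv : ∀ k, v k ∈ LogDer f 0)
    (hspan : Submodule.span (Stalk (0 : Fin n → ℂ)) (Set.range v) = LogDer f 0)
    (ψ : LogDer f (0 : Fin n → ℂ) →ₗ[Stalk (0 : Fin n → ℂ)] Normal f 0)
    (hψ : ∀ δ δ', d1 ψ δ δ' = 0) : ∃ g, Matches ψ g := by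
  choose σ hσ using fun k => (LogDer f 0).mkQ_surjective (ψ ⟨v k, hv k⟩)
  choose a ha using fun k => exists_mul_of_mem_logDer (hv k)
  have hcomb : ∀ δ ∈ LogDer f (0 : Fin n → ℂ), ∃ c : Fin n → Stalk (0 : Fin n → ℂ),
      δ = ∑ k, c k • v k := by
    intro δ hδ
    rw [← hspan, Submodule.mem_span_range_iff_exists_fun] at hδ
    obtain ⟨c, hc⟩ := hδ
    exact ⟨c, hc.symm⟩
  choose c hc using fun i j => hcomb _ (lie_mem_logDer (hv i) (hv j))
  have hclosed : ∀ i j, -⁅v i, σ j⁆ + ⁅v j, σ i⁆ + ∑ l, c i j l • σ l ∈ LogDer f 0 := by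
    intro i j
    have h1 := hψ ⟨v i, hv i⟩ ⟨v j, hv j⟩
    have h2 : bracket ⟨v i, hv i⟩ ⟨v j, hv j⟩ =
        ∑ l, c i j l • (⟨v l, hv l⟩ : LogDer f (0 : Fin n → ℂ)) := by
      refine Subtype.ext ((hc i j).trans ?_)
      simp
    rw [d1, h2, map_sum, ← hσ, ← hσ, act_mk, act_mk] at h1
    simp only [map_smul, ← hσ] at h1
    rw [← Submodule.Quotient.mk_eq_zero, ← Submodule.mkQ_apply, map_add, map_add, map_neg, map_sum]
    simp only [map_smul]
    exact h1
  choose e he using fun i j => hcomb _ (hclosed i j)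
  set b : Module.Basis Unit ℂ ℂ := Module.Basis.singleton Unit ℂ
  set D := fun i => fatDer b (v i) fun _ => σ i with hDdef
  have hDr : ∀ i, restrictDer (residue ℂ) (D i) = v i := fun i => restrictDer_fatDer b _ _
  have hDc : ∀ i u, contractDer (b.coord u) (D i) = σ i := fun i u => contractDer_fatDer b _ _ u
  set M : Matrix (Fin n) (Fin n) (FatStalk n ℂ) := Matrix.of fun k l => D k (1 ⊗ₜ coord 0 l)
    with hM
  have hMr : ∀ k l, restrict (residue ℂ) (M k l) = v k (coord 0 l) := fun k l =>
    DFunLike.congr_fun (hDr k) (coord 0 l)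
  have hMc : ∀ k l u, contract (b.coord u) (M k l) = σ k (coord 0 l) := fun k l u =>
    DFunLike.congr_fun (hDc k u) (coord 0 l)
  have hlie : ∀ i j l, D i (M j l) =
      ∑ m, fatMk b (c i j m) (fun _ => -e i j m) * M m l + D j (M i l) := by
    intro i j l
    have h1 := DFunLike.congr_fun (hc i j) (coord 0 l)
    have h2 := DFunLike.congr_fun (he i j) (coord 0 l)
    simp only [Derivation.commutator_apply, derivation_sum_apply, Derivation.smul_apply,
      Derivation.add_apply, Derivation.neg_apply, smul_eq_mul] at h1 h2
    refine fatStalk_ext b ?_ fun u => ?_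
    · rw [map_add, map_sum, restrict_der, restrict_der, hDr, hDr, hMr, hMr]
      simp only [map_mul, restrict_fatMk, hMr]
      linear_combination h1
    · rw [map_add, map_sum, contract_der, contract_der, hDr, hDr, hDc, hDc, hMr, hMr, hMc, hMc]
      simp only [contract_mul, restrict_fatMk, contract_coord_fatMk, hMr, hMc,
        Finset.sum_add_distrib]
      have h3 : ∑ m, v m (coord 0 l) * -e i j m = -∑ m, e i j m * v m (coord 0 l) := by
        rw [← Finset.sum_neg_distrib]
        exact Finset.sum_congr rfl fun m _ => by ring
      rw [h3]
      linear_combination -h2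
  have hdet : ∀ i, D i M.det ∈ Ideal.span {M.det} := by
    intro i
    refine derivation_det_mem (D i) (C := Matrix.of fun j m => fatMk b (c i j m) fun _ => -e i j m)
      (J := Matrix.of fun m l => constDer _ (coordField 0 m) (M i l)) ?_
    ext1 j l
    rw [Matrix.map_apply, hlie, Matrix.add_apply, Matrix.mul_apply, Matrix.mul_apply,
      fatDer_apply_eq_sum b (D j) (M i l)]
    rfl
  set p := (Matrix.of fun k l => v k (coord 0 l)).det with hp
  have hpr : restrict (residue ℂ) M.det = p := by
    rw [AlgHom.map_det]
    congr 1
    ext1 k l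
    exact hMr k l
  have hsaito : Ideal.span {p} = Ideal.span {germ f 0} := span_det_eq_span h0 hspan
  obtain ⟨u, hu⟩ := Ideal.mem_span_singleton'.1
    (hsaito.symm ▸ Ideal.mem_span_singleton_self (germ f 0))
  have hp0 : p ≠ 0 := fun h => h0 (by rw [← hu, h, mul_zero])
  refine ⟨u * contract (b.coord ()) M.det, matches_of_span hv hspan fun i =>
    ⟨a i, σ i, ha i, (hσ i).symm, ?_⟩⟩
  obtain ⟨w, hw, hw'⟩ := (mem_span_singleton_iff_contract b hpr).1 (hdet i)
  have hw2 := hw' ()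
  rw [restrict_der, hDr, hpr] at hw
  rw [contract_der, hDr, hDc, hpr] at hw2
  obtain ⟨q, hq⟩ := Ideal.mem_span_singleton'.1 hw2
  have hai := ha i
  rw [← hu, Derivation.leibniz, smul_eq_mul, smul_eq_mul, hw] at hai
  have hau : a i * u = v i u + u * w := mul_right_cancel₀ hp0 (by linear_combination -hai)
  rw [← hsaito, ← hu]
  refine Ideal.mem_span_singleton'.2 ⟨σ i u + u * q, ?_⟩
  simp only [Derivation.leibniz, smul_eq_mul]
  linear_combination u * hq + contract (b.coord ()) M.det * hau

end Saito

/-! ### From stalks to neighbourhoods -/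

section Spread

variable {n : ℕ} {f : (Fin n → ℂ) → ℂ} {x : Fin n → ℂ}

theorem eventually_germ_eq {F G : (Fin n → ℂ) → ℂ} (hF : AnalyticAt ℂ F x)
    (hG : AnalyticAt ℂ G x) (h : germ F x = germ G x) : ∀ᶠ y in 𝓝 x, germ F y = germ G y := by
  filter_upwards [((germ_eq_germ_iff hF hG).1 h).eventually_nhds, hF.eventually_analyticAt]
    with y hy hy' using germ_congr hy' hy

/-- The derivative of a function along a vector field. -/
def fieldApply (v : (Fin n → ℂ) → (Fin n → ℂ)) (F : (Fin n → ℂ) → ℂ) (y : Fin n → ℂ) : ℂ :=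
  ∑ i, v y i * fderiv ℂ F y (Pi.single i 1)

theorem analyticAt_fieldApply {v : (Fin n → ℂ) → (Fin n → ℂ)} {F : (Fin n → ℂ) → ℂ}
    (hv : AnalyticAt ℂ v x) (hF : AnalyticAt ℂ F x) : AnalyticAt ℂ (fieldApply v F) x :=
  Finset.analyticAt_fun_sum _ fun i _ => (analyticAt_pi_iff.1 hv i).fun_mul (analyticAt_partial hF i)

theorem fieldGerm_germ {v : (Fin n → ℂ) → (Fin n → ℂ)} {F : (Fin n → ℂ) → ℂ}
    (hv : AnalyticAt ℂ v x) (hF : AnalyticAt ℂ F x) :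
    fieldGerm v x (germ F x) = germ (fieldApply v F) x := by
  have h := germ_sum (x := x) Finset.univ
    (F := fun i y => v y i * fderiv ℂ F y (Pi.single i 1))
    fun i _ => (analyticAt_pi_iff.1 hv i).fun_mul (analyticAt_partial hF i)
  rw [fieldGerm, derivation_sum_apply]
  refine Eq.trans (Finset.sum_congr rfl fun i _ => ?_) h.symm
  rw [Derivation.smul_apply, coordField_germ hF, smul_eq_mul,
    germ_mul (analyticAt_pi_iff.1 hv i) (analyticAt_partial hF i)]

theorem exists_fieldGerm_eq (δ : Der x) :
    ∃ v : (Fin n → ℂ) → (Fin n → ℂ), AnalyticAt ℂ v x ∧ fieldGerm v x = δ := by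
  choose V hV hV' using fun i => exists_germ_eq (δ (coord x i))
  refine ⟨fun y i => V i y, analyticAt_pi_iff.2 hV, ?_⟩
  conv_rhs => rw [der_eq_sum δ]
  exact Finset.sum_congr rfl fun i _ => by rw [← hV' i]

theorem fieldGerm_congr {v w : (Fin n → ℂ) → (Fin n → ℂ)} (hv : AnalyticAt ℂ v x)
    (h : v =ᶠ[𝓝 x] w) : fieldGerm v x = fieldGerm w x :=
  Finset.sum_congr rfl fun i _ => by
    rw [germ_congr (analyticAt_pi_iff.1 hv i) (h.mono fun y hy => congrFun hy i)]

theorem eventuallyEq_of_fieldGerm_eq {v w : (Fin n → ℂ) → (Fin n → ℂ)} (hv : AnalyticAt ℂ v x)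
    (hw : AnalyticAt ℂ w x) (h : fieldGerm v x = fieldGerm w x) : v =ᶠ[𝓝 x] w := by
  have h1 : ∀ i, ∀ᶠ y in 𝓝 x, v y i = w y i := fun i => by
    refine (germ_eq_germ_iff (analyticAt_pi_iff.1 hv i) (analyticAt_pi_iff.1 hw i)).1 ?_
    have := DFunLike.congr_fun h (coord x i)
    rwa [fieldGerm, fieldGerm, sum_coordField_coord, sum_coordField_coord] at this
  filter_upwards [eventually_all.2 h1] with y hy using funext hy

theorem analyticAt_sum_smul {ι : Type} [Fintype ι] {P : ι → (Fin n → ℂ) → ℂ}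
    {v : ι → (Fin n → ℂ) → (Fin n → ℂ)} (hP : ∀ k, AnalyticAt ℂ (P k) x)
    (hv : ∀ k, AnalyticAt ℂ (v k) x) : AnalyticAt ℂ (fun y => ∑ k, P k y • v k y) x :=
  Finset.analyticAt_fun_sum _ fun k _ => (hP k).fun_smul (hv k)

theorem fieldGerm_sum_smul {ι : Type} [Fintype ι] {P : ι → (Fin n → ℂ) → ℂ}
    {v : ι → (Fin n → ℂ) → (Fin n → ℂ)} (hP : ∀ k, AnalyticAt ℂ (P k) x)
    (hv : ∀ k, AnalyticAt ℂ (v k) x) :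
    fieldGerm (fun y => ∑ k, P k y • v k y) x = ∑ k, germ (P k) x • fieldGerm (v k) x := by
  have h : ∀ i, germ (fun y => (∑ k, P k y • v k y) i) x =
      ∑ k, germ (P k) x * germ (fun y => v k y i) x := fun i => by
    simp only [Finset.sum_apply, Pi.smul_apply, smul_eq_mul]
    rw [germ_sum _ fun k _ => (hP k).fun_mul (analyticAt_pi_iff.1 (hv k) i)]
    exact Finset.sum_congr rfl fun k _ => germ_mul (hP k) (analyticAt_pi_iff.1 (hv k) i)
  simp only [fieldGerm, h, Finset.sum_smul, Finset.smul_sum, mul_smul]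
  exact Finset.sum_comm

/-- A family of linear maps of stalks that sends a local basis of `Der(-log D)` to sections is a
section of `𝒞¹`. -/
theorem isSection1_of_basis {W V : Set (Fin n → ℂ)} {r : ℕ}
    {v s : Fin r → (Fin n → ℂ) → (Fin n → ℂ)} (hV : V ⊆ W) (hv : ∀ k, IsLogField f W (v k))
    (hspan : ∀ y ∈ W,
      Submodule.span (Stalk y) (Set.range fun k => fieldGerm (v k) y) = LogDer f y)
    (hs : ∀ k, AnalyticOnNhd ℂ (s k) V) (ψ : Family1 f)
    (hψ : ∀ y ∈ V, ∀ k, ∀ h : fieldGerm (v k) y ∈ LogDer f y,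
      ψ y ⟨fieldGerm (v k) y, h⟩ = (LogDer f y).mkQ (fieldGerm (s k) y)) :
    IsSection1 f V ψ := by
  intro W' hW' hW'V w hw x hx
  have h1 := hw.2 x hx
  rw [← hspan x (hV (hW'V hx)), Submodule.mem_span_range_iff_exists_fun] at h1
  obtain ⟨c, hc⟩ := h1
  choose P hP hPc using fun k => exists_germ_eq (c k)
  have hvx : ∀ k, AnalyticAt ℂ (v k) x := fun k => (hv k).1 x (hV (hW'V hx))
  simp only [← hPc] at hc
  rw [← fieldGerm_sum_smul hP hvx] at hc
  have h2 := eventuallyEq_of_fieldGerm_eq (analyticAt_sum_smul hP hvx) (hw.1 x hx) hc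
  obtain ⟨N, hN, hNo, hxN⟩ := eventually_nhds_iff.1
    (h2.eventually_nhds.and (eventually_all.2 fun k => (hP k).eventually_analyticAt))
  refine ⟨N ∩ W', hNo.inter hW', ⟨hxN, hx⟩, Set.inter_subset_right,
    fun y => ∑ k, P k y • s k y, fun y hy => ?_, fun y hy hl => ?_⟩
  · exact analyticAt_sum_smul (hN y hy.1).2 fun k => hs k y (hW'V hy.2)
  · have hyV := hW'V hy.2
    have hvy : ∀ k, AnalyticAt ℂ (v k) y := fun k => (hv k).1 y (hV hyV)
    have h3 : fieldGerm w y = ∑ k, germ (P k) y • fieldGerm (v k) y := by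
      rw [← fieldGerm_sum_smul (hN y hy.1).2 hvy]
      exact (fieldGerm_congr (analyticAt_sum_smul (hN y hy.1).2 hvy) (hN y hy.1).1).symm
    have h4 : (⟨fieldGerm w y, hl⟩ : LogDer f y) =
        ∑ k, germ (P k) y • ⟨fieldGerm (v k) y, (hv k).2 y (hV hyV)⟩ := by
      refine Subtype.ext (h3.trans ?_)
      simp
    rw [h4, map_sum, fieldGerm_sum_smul (hN y hy.1).2 fun k => hs k y hyV, map_sum]
    exact Finset.sum_congr rfl fun k _ => by rw [map_smul, map_smul, hψ y hyV k]

theorem exists_linearMap_of_basis {r : ℕ} {v : Fin r → Der x} (hv : ∀ k, v k ∈ LogDer f x)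
    (hli : LinearIndependent (Stalk x) v)
    (hspan : Submodule.span (Stalk x) (Set.range v) = LogDer f x) (m : Fin r → Normal f x) :
    ∃ ψ : LogDer f x →ₗ[Stalk x] Normal f x, ∀ k, ψ ⟨v k, hv k⟩ = m k := by
  have hli' : LinearIndependent (Stalk x) (fun k => (⟨v k, hv k⟩ : LogDer f x)) :=
    LinearIndependent.of_comp (LogDer f x).subtype hli
  have htop : ⊤ ≤ Submodule.span (Stalk x) (Set.range fun k => (⟨v k, hv k⟩ : LogDer f x)) := by
    rintro ⟨δ, hδ⟩ -
    have hδ' := hδ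
    rw [← hspan, Submodule.mem_span_range_iff_exists_fun] at hδ'
    obtain ⟨c, rfl⟩ := hδ'
    refine (Submodule.mem_span_range_iff_exists_fun _).2 ⟨c, Subtype.ext ?_⟩
    simp
  refine ⟨(Module.Basis.mk hli' htop).constr (Stalk x) m, fun k => ?_⟩
  have := (Module.Basis.mk hli' htop).constr_basis (Stalk x) m k
  rwa [Module.Basis.mk_apply] at this

/-- The obstruction class of an admissible perturbation is defined on a neighbourhood. -/
theorem exists_cocycle_matches {U : Set (Fin n → ℂ)} (hf : IsFreeDivisor f U) (h0 : 0 ∈ U)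
    {g : Stalk (0 : Fin n → ℂ)} (hg : g ∈ admissiblePerturbation (germ f 0)) :
    ∃ ψ ∈ cocycles f 0, Matches (ψ 0) g := by
  obtain ⟨W, hW, h0W, hWU, r, v, hv, hb⟩ := hf.locally_free 0 h0
  choose a ha using fun k => exists_mul_of_mem_logDer ((hv k).2 0 h0W)
  choose σ c hσ using fun k => hg _ _ (ha k)
  choose s hs hsσ using fun k => exists_fieldGerm_eq (-σ k)
  choose A hA hAa using fun k => exists_germ_eq (a k)
  choose C hC hCc using fun k => exists_germ_eq (c k)
  obtain ⟨G, hG, rfl⟩ := exists_germ_eq g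
  have hf0 : AnalyticAt ℂ f 0 := hf.analytic 0 h0
  have hv0 : ∀ k, AnalyticAt ℂ (v k) 0 := fun k => (hv k).1 0 h0W
  have e1 : ∀ k, ∀ᶠ y in 𝓝 (0 : Fin n → ℂ),
      germ (fieldApply (v k) f) y = germ (fun y => A k y * f y) y := fun k => by
    refine eventually_germ_eq (analyticAt_fieldApply (hv0 k) hf0) ((hA k).fun_mul hf0) ?_
    rw [← fieldGerm_germ (hv0 k) hf0, germ_mul (hA k) hf0, hAa, ha]
  have e2 : ∀ k, ∀ᶠ y in 𝓝 (0 : Fin n → ℂ),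
      germ (fun y => fieldApply (s k) f y + (fieldApply (v k) G y - A k y * G y)) y =
        germ (fun y => C k y * f y) y := fun k => by
    refine eventually_germ_eq ((analyticAt_fieldApply (hs k) hf0).fun_add
      ((analyticAt_fieldApply (hv0 k) hG).fun_sub ((hA k).fun_mul hG))) ((hC k).fun_mul hf0) ?_
    rw [germ_add (analyticAt_fieldApply (hs k) hf0)
      ((analyticAt_fieldApply (hv0 k) hG).fun_sub ((hA k).fun_mul hG)),
      germ_sub (analyticAt_fieldApply (hv0 k) hG) ((hA k).fun_mul hG), germ_mul (hA k) hG,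
      germ_mul (hC k) hf0, ← fieldGerm_germ (hs k) hf0, ← fieldGerm_germ (hv0 k) hG, hsσ, hAa,
      hCc, hσ, Derivation.neg_apply]
    ring
  obtain ⟨N, hN, hNo, h0N⟩ := eventually_nhds_iff.1
    ((eventually_all.2 e1).and <| (eventually_all.2 e2).and <|
      (eventually_all.2 fun k => (hs k).eventually_analyticAt).and <|
      (eventually_all.2 fun k => (hA k).eventually_analyticAt).and <|
      (eventually_all.2 fun k => (hC k).eventually_analyticAt).and <|
      hG.eventually_analyticAt)
  have hex : ∀ y, ∃ ψ : LogDer f y →ₗ[Stalk y] Normal f y, y ∈ W → ∀ k,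
      ∀ h : fieldGerm (v k) y ∈ LogDer f y,
      ψ ⟨fieldGerm (v k) y, h⟩ = (LogDer f y).mkQ (fieldGerm (s k) y) := by
    intro y
    by_cases hy : y ∈ W
    · obtain ⟨ψ, hψ⟩ := exists_linearMap_of_basis (fun k => (hv k).2 y hy) (hb y hy).1 (hb y hy).2
        fun k => (LogDer f y).mkQ (fieldGerm (s k) y)
      exact ⟨ψ, fun _ k _ => hψ k⟩
    · exact ⟨0, fun h => (hy h).elim⟩
  choose ψ hψ using hex
  have hmatch : ∀ y ∈ N ∩ W, Matches (ψ y) (germ G y) := by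
    intro y hy
    obtain ⟨h1, h2, h3, h4, h5, h6⟩ := hN y hy.1
    have hfy : AnalyticAt ℂ f y := hf.analytic y (hWU hy.2)
    have hvy : ∀ k, AnalyticAt ℂ (v k) y := fun k => (hv k).1 y hy.2
    refine matches_of_span (fun k => (hv k).2 y hy.2) (hb y hy.2).2 fun k =>
      ⟨germ (A k) y, fieldGerm (s k) y, ?_, hψ y hy.2 k _,
        Ideal.mem_span_singleton'.2 ⟨germ (C k) y, ?_⟩⟩
    · rw [fieldGerm_germ (hvy k) hfy, h1 k, germ_mul (h4 k) hfy]
    · rw [← germ_mul (h5 k) hfy, ← h2 k, germ_add (analyticAt_fieldApply (h3 k) hfy)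
        ((analyticAt_fieldApply (hvy k) h6).fun_sub ((h4 k).fun_mul h6)),
        germ_sub (analyticAt_fieldApply (hvy k) h6) ((h4 k).fun_mul h6), germ_mul (h4 k) h6,
        fieldGerm_germ (h3 k) hfy, fieldGerm_germ (hvy k) h6]
  refine ⟨ψ, ⟨N ∩ W, hNo.inter hW, ⟨h0N, h0W⟩,
    isSection1_of_basis Set.inter_subset_right hv (fun y hy => (hb y hy).2)
      (fun k y hy => (hN y hy.1).2.2.1 k) ψ fun y hy => hψ y hy.2, fun y hy δ ν => ?_⟩,
    hmatch 0 ⟨h0N, h0W⟩⟩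
  exact (hmatch y hy).d1_eq_zero (hf.germ_ne_zero y (hWU hy.2)) δ ν

/-- A section of `𝒞¹` that is exact on the stalk at `0` is exact near `0`. -/
theorem mem_coboundaries_of_stalk {U : Set (Fin n → ℂ)} (hf : IsFreeDivisor f U) (h0 : 0 ∈ U)
    {ψ : Family1 f} (hψ : ψ ∈ cocycles f 0) {m : Normal f (0 : Fin n → ℂ)} (hm : ψ 0 = d0 m) :
    ψ ∈ coboundaries f 0 := by
  obtain ⟨V, hV, h0V, hsec, -⟩ := hψ
  obtain ⟨W, hW, h0W, hWU, r, v, hv, hb⟩ := hf.locally_free 0 h0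
  obtain ⟨σ, rfl⟩ := (LogDer f 0).mkQ_surjective m
  obtain ⟨s, hs, rfl⟩ := exists_fieldGerm_eq σ
  have hf0 : AnalyticAt ℂ f 0 := hf.analytic 0 h0
  have hv0 : ∀ k, AnalyticAt ℂ (v k) 0 := fun k => (hv k).1 0 h0W
  choose N hNo h0N hNV u hu hψu using fun k => hsec (V ∩ W) (hV.inter hW) Set.inter_subset_left
    (v k) ⟨fun y hy => (hv k).1 y hy.2, fun y hy => (hv k).2 y hy.2⟩ 0 ⟨h0V, h0W⟩
  have hu0 : ∀ k, AnalyticAt ℂ (u k) 0 := fun k => hu k 0 (h0N k)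
  have h1 : ∀ k, ∃ c, c * germ f 0 = fieldGerm (u k) 0 (germ f 0) -
      (-⁅fieldGerm (v k) 0, fieldGerm s 0⁆ : Der (0 : Fin n → ℂ)) (germ f 0) := fun k => by
    have h2 := hψu k 0 (h0N k) ((hv k).2 0 h0W)
    rw [hm, d0_mkQ] at h2
    exact Ideal.mem_span_singleton'.1 (mkQ_eq_mkQ_iff.1 h2.symm)
  choose c hc using h1
  choose C hC hCc using fun k => exists_germ_eq (c k)
  have key : ∀ k y, AnalyticAt ℂ (u k) y → AnalyticAt ℂ (v k) y → AnalyticAt ℂ s y →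
      AnalyticAt ℂ f y → fieldGerm (u k) y (germ f y) -
        (-⁅fieldGerm (v k) y, fieldGerm s y⁆ : Der y) (germ f y) =
      germ (fun z => fieldApply (u k) f z + (fieldApply (v k) (fieldApply s f) z -
        fieldApply s (fieldApply (v k) f) z)) y := by
    intro k y hu hv hs hf
    have hsf := analyticAt_fieldApply hs hf
    have hvf := analyticAt_fieldApply hv hf
    rw [germ_add (analyticAt_fieldApply hu hf)
      ((analyticAt_fieldApply hv hsf).fun_sub (analyticAt_fieldApply hs hvf)),
      germ_sub (analyticAt_fieldApply hv hsf) (analyticAt_fieldApply hs hvf),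
      ← fieldGerm_germ hu hf, ← fieldGerm_germ hv hsf, ← fieldGerm_germ hs hvf,
      ← fieldGerm_germ hs hf, ← fieldGerm_germ hv hf, Derivation.neg_apply,
      Derivation.commutator_apply, sub_neg_eq_add]
  have e1 : ∀ k, ∀ᶠ y in 𝓝 (0 : Fin n → ℂ), germ (fun z => C k z * f z) y =
      germ (fun z => fieldApply (u k) f z + (fieldApply (v k) (fieldApply s f) z -
        fieldApply s (fieldApply (v k) f) z)) y := fun k => by
    refine eventually_germ_eq ((hC k).fun_mul hf0) ((analyticAt_fieldApply (hu0 k) hf0).fun_add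
      ((analyticAt_fieldApply (hv0 k) (analyticAt_fieldApply hs hf0)).fun_sub
        (analyticAt_fieldApply hs (analyticAt_fieldApply (hv0 k) hf0)))) ?_
    rw [germ_mul (hC k) hf0, hCc, hc, key k 0 (hu0 k) (hv0 k) hs hf0]
  obtain ⟨O, hO, hOo, h0O⟩ := eventually_nhds_iff.1
    ((eventually_all.2 e1).and <| (eventually_all.2 fun k => (hC k).eventually_analyticAt).and <|
      hs.eventually_analyticAt.and <|
      (eventually_all.2 fun k => (hNo k).mem_nhds (h0N k)).and (hW.mem_nhds h0W))
  refine ⟨O, hOo, h0O, fun y => (LogDer f y).mkQ (fieldGerm s y),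
    fun y hy => ⟨O, hOo, hy, subset_rfl, s, fun z hz => (hO z hz).2.2.1, fun z _ => rfl⟩,
    fun y hy => ?_⟩
  obtain ⟨h1, h2, h3, h4, h5⟩ := hO y hy
  have hfy : AnalyticAt ℂ f y := hf.analytic y (hWU h5)
  refine LinearMap.ext fun δ => ?_
  obtain ⟨δ, hδ⟩ := δ
  have hδ' := hδ
  rw [← (hb y h5).2, Submodule.mem_span_range_iff_exists_fun] at hδ'
  obtain ⟨p, rfl⟩ := hδ'
  have h6 : (⟨∑ k, p k • fieldGerm (v k) y, hδ⟩ : LogDer f y) =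
      ∑ k, p k • ⟨fieldGerm (v k) y, (hv k).2 y h5⟩ := by
    refine Subtype.ext ?_
    simp
  rw [h6, map_sum, map_sum]
  refine Finset.sum_congr rfl fun k _ => ?_
  rw [map_smul, map_smul, hψu k y (h4 k), d0_mkQ]
  congr 1
  rw [mkQ_eq_mkQ_iff]
  refine Ideal.mem_span_singleton'.2 ⟨germ (C k) y, ?_⟩
  rw [key k y (hu k y (h4 k)) ((hv k).1 y h5) h3 hfy, ← h1 k, germ_mul (h2 k) hfy]

end Spread

/-! ### The first cohomology -/

section Cohomology

variable {n : ℕ} {f : (Fin n → ℂ) → ℂ} {U : Set (Fin n → ℂ)}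

theorem cocycles_exists_matches (hf : IsFreeDivisor f U) (h0 : 0 ∈ U) (ψ : cocycles f 0) :
    ∃ g : admissiblePerturbation (germ f 0), Matches (ψ.1 0) g.1 := by
  obtain ⟨ψ, V, hV, h0V, -, hd⟩ := ψ
  obtain ⟨W, -, h0W, -, r, v, hv, hb⟩ := hf.locally_free 0 h0
  have hne := hf.germ_ne_zero 0 h0
  have hred := hf.reduced 0 h0
  obtain rfl := card_eq_of_basis_logDer hne (hb 0 h0W).1 (hb 0 h0W).2
  obtain ⟨g, hg⟩ := exists_matches hne (fun k => (hv k).2 0 h0W) (hb 0 h0W).2 (ψ 0) (hd 0 h0V)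
  exact ⟨⟨g, hg.mem_admissiblePerturbation hne⟩, hg⟩

/-- The admissible perturbations modulo the infinitesimally trivial ones. -/
abbrev PerturbationClass (h : Stalk (0 : Fin n → ℂ)) : Type :=
  admissiblePerturbation h ⧸
    ((tjurina h).restrictScalars ℂ).submoduleOf (admissiblePerturbation h)

theorem perturbationClass_mk_eq_iff {h : Stalk (0 : Fin n → ℂ)}
    (g g' : admissiblePerturbation h) :
    (Submodule.Quotient.mk g : PerturbationClass h) = Submodule.Quotient.mk g' ↔
      (g : Stalk (0 : Fin n → ℂ)) - g' ∈ tjurina h :=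
  Submodule.Quotient.eq _

theorem perturbationClass_eq_of_matches (hf : IsFreeDivisor f U) (h0 : 0 ∈ U)
    {ψ : LogDer f (0 : Fin n → ℂ) →ₗ[Stalk (0 : Fin n → ℂ)] Normal f 0}
    {g g' : admissiblePerturbation (germ f 0)} (hg : Matches ψ g.1) (hg' : Matches ψ g'.1) :
    (Submodule.Quotient.mk g : PerturbationClass (germ f 0)) = Submodule.Quotient.mk g' := by
  have hred := hf.reduced 0 h0
  have h1 := hg.sub (hf.germ_ne_zero 0 h0) hg'
  rw [sub_self] at h1
  rw [perturbationClass_mk_eq_iff, mem_tjurina_iff_sub_mem_span]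
  refine ⟨0, ?_⟩
  rw [Derivation.zero_apply, sub_zero]
  exact h1.mem_span_of_zero (hf.germ_ne_zero 0 h0)

/-- The class of the perturbation whose obstruction is a given cocycle. -/
def perturbationOfCocycle (hf : IsFreeDivisor f U) (h0 : 0 ∈ U) :
    cocycles f 0 →ₗ[ℂ] PerturbationClass (germ f (0 : Fin n → ℂ)) where
  toFun ψ := Submodule.Quotient.mk (cocycles_exists_matches hf h0 ψ).choose
  map_add' ψ ψ' := by
    rw [← Submodule.Quotient.mk_add]
    exact perturbationClass_eq_of_matches hf h0
      (cocycles_exists_matches hf h0 (ψ + ψ')).choose_spec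
      ((cocycles_exists_matches hf h0 ψ).choose_spec.add (hf.germ_ne_zero 0 h0)
        (cocycles_exists_matches hf h0 ψ').choose_spec)
  map_smul' c ψ := by
    rw [RingHom.id_apply, ← Submodule.Quotient.mk_smul]
    exact perturbationClass_eq_of_matches hf h0
      (cocycles_exists_matches hf h0 (c • ψ)).choose_spec
      ((cocycles_exists_matches hf h0 ψ).choose_spec.smul c)

theorem perturbationOfCocycle_eq (hf : IsFreeDivisor f U) (h0 : 0 ∈ U) {ψ : cocycles f 0}
    {g : admissiblePerturbation (germ f 0)} (hg : Matches (ψ.1 0) g.1) :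
    perturbationOfCocycle hf h0 ψ = Submodule.Quotient.mk g :=
  perturbationClass_eq_of_matches hf h0 (cocycles_exists_matches hf h0 ψ).choose_spec hg

theorem perturbationOfCocycle_surjective (hf : IsFreeDivisor f U) (h0 : 0 ∈ U) :
    Function.Surjective (perturbationOfCocycle hf h0) := by
  intro q
  obtain ⟨g, rfl⟩ := Submodule.Quotient.mk_surjective _ q
  obtain ⟨ψ, hψ, hm⟩ := exists_cocycle_matches hf h0 g.2
  exact ⟨⟨ψ, hψ⟩, perturbationOfCocycle_eq hf h0 hm⟩

theorem ker_perturbationOfCocycle (hf : IsFreeDivisor f U) (h0 : 0 ∈ U) :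
    LinearMap.ker (perturbationOfCocycle hf h0) =
      (coboundaries f 0).submoduleOf (cocycles f 0) := by
  ext ψ
  obtain ⟨g, hg⟩ := cocycles_exists_matches hf h0 ψ
  have hred := hf.reduced 0 h0
  rw [LinearMap.mem_ker, perturbationOfCocycle_eq hf h0 hg, ← Submodule.Quotient.mk_zero,
    perturbationClass_mk_eq_iff, ZeroMemClass.coe_zero, sub_zero,
    ← hg.exists_eq_d0_iff (hf.germ_ne_zero 0 h0)]
  change (∃ m, ψ.1 0 = d0 m) ↔ ψ.1 ∈ coboundaries f 0
  constructor
  · rintro ⟨m, hm⟩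
    exact mem_coboundaries_of_stalk hf h0 ψ.2 hm
  · rintro ⟨V, -, h0V, m, -, hm⟩
    exact ⟨m 0, hm 0 h0V⟩

/-- The first cohomology is the space of admissible perturbations of the equation modulo the
infinitesimally trivial ones. -/
def cohomologyEquiv (hf : IsFreeDivisor f U) (h0 : 0 ∈ U) :
    H1 f 0 ≃ₗ[ℂ] PerturbationClass (germ f (0 : Fin n → ℂ)) :=
  (Submodule.quotEquivOfEq _ _ (ker_perturbationOfCocycle hf h0).symm).trans
    ((perturbationOfCocycle hf h0).quotKerEquivOfSurjective
      (perturbationOfCocycle_surjective hf h0))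

/-- First order deformations are classified by admissible perturbations of the equation modulo
the infinitesimally trivial ones. -/
def perturbationEquiv (hf : germ f 0 ≠ 0) (hf0 : value 0 (germ f 0) = 0) :
    PerturbationClass (germ f (0 : Fin n → ℂ)) ≃ FT1 f :=
  Equiv.ofBijective
    (fun q => Quotient.liftOn' q (dualClass hf) fun g g' h =>
      (dualClass_eq_iff hf g g').2 ((perturbationClass_mk_eq_iff g g').1 (Quotient.sound' h)))
    ⟨fun q q' h => by
      obtain ⟨g, rfl⟩ := Submodule.Quotient.mk_surjective _ q
      obtain ⟨g', rfl⟩ := Submodule.Quotient.mk_surjective _ q'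
      exact (perturbationClass_mk_eq_iff g g').2 ((dualClass_eq_iff hf g g').1 h),
    fun z => by
      obtain ⟨g, rfl⟩ := dualClass_surjective hf hf0 z
      exact ⟨Submodule.Quotient.mk g, rfl⟩⟩

theorem perturbationEquiv_mk (hf : germ f 0 ≠ 0) (hf0 : value 0 (germ f 0) = 0)
    (g : admissiblePerturbation (germ f (0 : Fin n → ℂ))) :
    perturbationEquiv hf hf0 (Submodule.Quotient.mk g) = dualClass hf g := rfl

end Cohomology

end

end FreeDivisor

open FreeDivisor in
theorem mainTheorem5 (n : ℕ) (f : (Fin n → ℂ) → ℂ) (U : Set (Fin n → ℂ)) (h0 : 0 ∈ U)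
    (hf0 : f 0 = 0) (hf : IsFreeDivisor f U) :
    (∀ a b : FT1 f, ∃! z : FT1Pair f,
      FDMaps (TrivSqZeroExt.map (LinearMap.fst ℂ ℂ ℂ)) z a ∧
      FDMaps (TrivSqZeroExt.map (LinearMap.snd ℂ ℂ ℂ)) z b) ∧
    ∃ e : H1 f 0 ≃ FT1 f,
      (∀ (x y : H1 f 0) (z : FT1Pair f),
        FDMaps (TrivSqZeroExt.map (LinearMap.fst ℂ ℂ ℂ)) z (e x) →
        FDMaps (TrivSqZeroExt.map (LinearMap.snd ℂ ℂ ℂ)) z (e y) →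
        FDMaps (TrivSqZeroExt.map (LinearMap.coprod LinearMap.id LinearMap.id)) z
          (e (x + y))) ∧
      ∀ (c : ℂ) (x : H1 f 0),
        FDMaps (TrivSqZeroExt.map (c • LinearMap.id)) (e x) (e (c • x)) := by
  have hne := hf.germ_ne_zero 0 h0
  have hval : value 0 (germ f 0) = 0 := (value_germ (hf.analytic 0 h0)).trans hf0
  refine ⟨existsUnique_fdMaps hne hval,
    (cohomologyEquiv hf h0).toEquiv.trans (perturbationEquiv hne hval), fun x y z => ?_,
    fun c x => ?_⟩
  · obtain ⟨g, hg⟩ := Submodule.Quotient.mk_surjective _ (cohomologyEquiv hf h0 x)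
    obtain ⟨g', hg'⟩ := Submodule.Quotient.mk_surjective _ (cohomologyEquiv hf h0 y)
    simp only [Equiv.trans_apply, LinearEquiv.coe_toEquiv, map_add, ← hg, ← hg',
      ← Submodule.Quotient.mk_add, perturbationEquiv_mk]
    exact fdMaps_add hne hval g g' z
  · obtain ⟨g, hg⟩ := Submodule.Quotient.mk_surjective _ (cohomologyEquiv hf h0 x)
    simp only [Equiv.trans_apply, LinearEquiv.coe_toEquiv, map_smul, ← hg,
      ← Submodule.Quotient.mk_smul, perturbationEquiv_mk]
    exact fdMaps_smul hne hval c g
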